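/- Let $n\ge 1$. A rational ray is a nonzero vector of $\mathbb{Q}^n$ up to positive scaling; rational rays are the points of $S^{n-1}(\mathbb{Q})\subset S^{n-1}\subset\mathbb{R}^n$. A geodesic triangulation of $S^{n-1}$ is a finite triangulation $T$ with vertices in $S^{n-1}(\mathbb{Q})$ whose simplices are the intersections of $S^{n-1}$ with simplicial cones (cones spanned by linearly independent rays). Let $C_{T,\bullet}$ be its augmented oriented simplicial chain complex over $\mathbb{Z}$, shifted so that a simplex with $k$ vertices has degree $k$. If $T'$ refines $T$ (every simplex of $T$ is a union of simplices of $T'$), there is a map $C_{T,\bullet}\to C_{T',\bullet}$ sending an oriented simplex with $k$ vertices to the sum of the $k$-vertex simplices of $T'$ contained in it, with the same orientation. Let $$\widetilde{\mathrm{Chains}}(n)_\bullet=\varinjlim_T C_{T,\bullet},\qquad \mathrm{Chains}(n)_n=\widetilde{\mathrm{Chains}}(n)_n/H_n(\widetilde{\mathrm{Chains}}(n)).$$ For linearly independent rational rays $r_1,\dots,r_n$ let $\Delta(r_1,\dots,r_n)\in\mathrm{Chains}(n)_n$ be the class of the geodesic simplex with these vertices, oriented by their order, in any triangulation containing it. (Such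 a triangulation exists, and the class does not depend on it.) Let $\mathrm{OS}(n)$ be the Orlik–Solomon algebra: the quotient of the exterior algebra over $\mathbb{Z}$ on symbols $[\ell]$, $\ell\in\mathbb{P}^{n-1}(\mathbb{Q})$, by the two-sided ideal generated by the elements $$\partial([\ell_1]\wedge\dots\wedge[\ell_k])=\sum_{i=1}^k(-1)^{i-1}[\ell_1]\wedge\dots\wedge\widehat{[\ell_i]}\wedge\dots\wedge[\ell_k]$$ for all $k$ and all lines $\ell_1,\dots,\ell_k$ spanning a space of rank less than $k$. Let $\mathrm{St}(n)=\mathrm{OS}(n)_n$ be its part of degree $n$, the Steinberg module. Then there is a unique group homomorphism $$R_{St}:\mathrm{Chains}(n)_n\to\mathrm{St}(n),\qquad \Delta(r_1,\dots,r_n)\mapsto[\mathbb{Q}r_1]\wedge\dots\wedge[\mathbb{Q}r_n]\quad\text{for all linearly independent } r_1,\dots,r_n.$$ It is surjective and $\mathrm{GL}_n(\mathbb{Q})$-equivariant, and its kernel is generated, as an abelian group, by the "wedge" classes $$\Delta(r_1,r_2,\dots,r_n)-\Delta(-r_1,r_2,\dots,r_n)$$ for linearly independent tuples $(r_1,\dots,r_n)$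 of rational rays. -/

import Mathlib

open scoped LinearAlgebra.Projectivization DirectSum

noncomputable section

namespace SphericalChains

/-! ### Rational rays and the cones over geodesic simplices -/

/-- A point of `S^{n-1}(ℚ)`: a rational ray in `ℝ^n`, that is, a nonzero vector of `ℚ^n` up to
positive rational scaling. -/
abbrev RatRay (n : ℕ) : Type := Module.Ray ℚ (Fin n → ℚ)

/-- `GL_n(ℚ)`, as the group of linear automorphisms of `ℚ^n`. -/
abbrev GLQ (n : ℕ) : Type := (Fin n → ℚ) ≃ₗ[ℚ] (Fin n → ℚ)

variable {n : ℕ}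

/-- A vector of `ℚ^n`, seen in `ℝ^n`. -/
def toReal (v : Fin n → ℚ) : Fin n → ℝ := fun i => (v i : ℝ)

/-- The closed convex cone in `ℝ^n` spanned by a set of rational rays. Its intersection with the
unit sphere is the geodesic simplex with these vertices, when the rays are independent. -/
def cone (s : Set (RatRay n)) : PointedCone ℝ (Fin n → ℝ) :=
  PointedCone.hull ℝ ((fun ρ : RatRay n => toReal ρ.someVector) '' s)

/-- Linear independence of a family of rays. -/
def Indep {ι : Type} (r : ι → RatRay n) : Prop :=
  LinearIndependent ℚ (fun i => (r i).someVector)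

/-- Two `k`-tuples of rays such that the second one lies in the span of the first one and is
expressed in it by a matrix of positive determinant: if both are independent, the two oriented
simplices that they span lie in the same great sphere and have the same orientation. -/
def SameOrientation {k : ℕ} (r t : Fin k → RatRay n) : Prop :=
  ∃ A : Matrix (Fin k) (Fin k) ℚ, 0 < A.det ∧
    ∀ i, (t i).someVector = ∑ j, A i j • (r j).someVector

/-! ### Oriented simplices and the boundary map -/

/-- The graded-commutative ring generated in degree one by symbols `[x]`, `x : X`, with
`[x] ∧ [x] = 0`. -/
abbrev Symbols (X : Type) : Type := ExteriorAlgebra ℤ (X →₀ ℤ)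

/-- The monomial `[x_1] ∧ ... ∧ [x_k]`. -/
def monomial {X : Type} {k : ℕ} (x : Fin k → X) : Symbols X :=
  ExteriorAlgebra.ιMulti ℤ k (fun i => Finsupp.single (x i) 1)

/-- The differential `∂`: the graded derivation with `∂ [x] = 1`, that is,
`∂ ([x_1] ∧ ... ∧ [x_k]) = ∑_i (-1)^(i-1) [x_1] ∧ ... ∧ (omit [x_i]) ∧ ... ∧ [x_k]`. -/
def boundary (X : Type) : Symbols X →+ Symbols X :=
  (CliffordAlgebra.contractLeft (Q := (0 : QuadraticForm ℤ (X →₀ ℤ)))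
    (Finsupp.linearCombination ℤ (fun _ : X => (1 : ℤ)))).toAddMonoidHom

/-- The ring homomorphism induced by a map of symbols. -/
def symbolsMap {X Y : Type} (f : X → Y) : Symbols X →ₐ[ℤ] Symbols Y :=
  ExteriorAlgebra.map (Finsupp.lmapDomain ℤ ℤ f)

/-! ### Geodesic triangulations of the sphere -/

/-- A finite geodesic triangulation of `S^{n-1} ⊆ ℝ^n` with vertices in `S^{n-1}(ℚ)`, given by the
vertex sets of its simplices (with the empty simplex) and described through the cones over the
simplices. -/
structure Triangulation (n : ℕ) where
  faces : Set (Set (RatRay n))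
  finite : faces.Finite
  empty_mem : ∅ ∈ faces
  down_closed : ∀ s ∈ faces, ∀ t ⊆ s, t ∈ faces
  indep : ∀ s ∈ faces, Indep (fun ρ : s => (ρ : RatRay n))
  inter : ∀ s ∈ faces, ∀ t ∈ faces, cone s ⊓ cone t = cone (s ∩ t)
  cover : ∀ x : Fin n → ℝ, ∃ s ∈ faces, x ∈ cone s

/-- `T.Refines T'`: every simplex of `T'` is a union of simplices of `T`. -/
def Triangulation.Refines (T T' : Triangulation n) : Prop :=
  ∀ s ∈ T'.faces, ∃ U ⊆ T.faces, (cone s : Set (Fin n → ℝ)) = ⋃ t ∈ U, (cone t : Set (Fin n → ℝ))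

/-- The ordered tuple `r` lists, without repetition, the vertices of a simplex of `T`. -/
def Triangulation.IsFace (T : Triangulation n) {k : ℕ} (r : Fin k → RatRay n) : Prop :=
  Function.Injective r ∧ Set.range r ∈ T.faces

/-- Degree `k` of the augmented oriented simplicial chain complex of `T`, shifted by one: it is
generated by the oriented simplices `[r_1, ..., r_k]` with `k` vertices, where reordering the
vertices multiplies by the sign of the permutation. The differential is `boundary`. -/
def Triangulation.chains (T : Triangulation n) (k : ℕ) : AddSubgroup (Symbols (RatRay n)) :=
  AddSubgroup.closure {x | ∃ r : Fin k → RatRay n, T.IsFace r ∧ x = monomial r}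

/-- The oriented simplex `[r_1, ..., r_k]` as a chain of `T`. -/
def Triangulation.simplex (T : Triangulation n) {k : ℕ} (r : Fin k → RatRay n) (h : T.IsFace r) :
    T.chains k :=
  ⟨monomial r, AddSubgroup.subset_closure ⟨r, h, rfl⟩⟩

/-- The tuples `t_1, ..., t_m` list, once each and with the orientation of `r`, all simplices of
`T` with `k` vertices that are contained in the simplex spanned by `r_1, ..., r_k`. -/
structure Triangulation.IsSubdivision (T : Triangulation n) {k : ℕ} (r : Fin k → RatRay n)
    {m : ℕ} (t : Fin m → Fin k → RatRay n) : Prop where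
  isFace : ∀ j, T.IsFace (t j)
  le : ∀ j, cone (Set.range (t j)) ≤ cone (Set.range r)
  sameOrientation : ∀ j, SameOrientation r (t j)
  unique : ∀ u : Fin k → RatRay n, T.IsFace u → cone (Set.range u) ≤ cone (Set.range r) →
    ∃! j, Set.range (t j) = Set.range u

/-! ### The complex of spherical chains -/

open Classical in
/-- The identifications in the colimit over all triangulations: if `T'` refines `T`, then a simplex
of `T` is identified with its image under the transition map, the sum of the simplices of `T'`
that subdivide it. -/
def refinementRelations (n k : ℕ) :
    AddSubgroup (⨁ T : Triangulation n, T.chains k) :=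
  AddSubgroup.closure {x | ∃ (T T' : Triangulation n) (_ : T'.Refines T)
    (r : Fin k → RatRay n) (h : T.IsFace r) (m : ℕ) (t : Fin m → Fin k → RatRay n)
    (ht : T'.IsSubdivision r t),
    x = DirectSum.of (fun T : Triangulation n => T.chains k) T (T.simplex r h) -
      ∑ j, DirectSum.of (fun T : Triangulation n => T.chains k) T'
        (T'.simplex (t j) (ht.isFace j))}

/-- The degree `k` part of the complex of spherical chains: the colimit of the groups `T.chains k`
over all geodesic triangulations, ordered by refinement. -/
abbrev PreChains (n k : ℕ) : Type :=
  (⨁ T : Triangulation n, T.chains k) ⧸ refinementRelations n k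

open Classical in
/-- The canonical map from the chains of a triangulation to the colimit. -/
def Triangulation.toPreChains (T : Triangulation n) (k : ℕ) : T.chains k →+ PreChains n k :=
  (QuotientAddGroup.mk' (refinementRelations n k)).comp
    (DirectSum.of (fun T : Triangulation n => T.chains k) T)

/-- The chains of `T` in degree `k` with boundary zero. -/
def Triangulation.cycles (T : Triangulation n) (k : ℕ) : AddSubgroup (T.chains k) :=
  ((boundary (RatRay n)).comp (T.chains k).subtype).ker

/-- The top homology group `H_n` of the complex of spherical chains, as a subgroup of its top
degree part: a top degree cycle of the colimit is the class of a top degree cycle of some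
triangulation. -/
def topHomology (n : ℕ) : AddSubgroup (PreChains n n) :=
  ⨆ T : Triangulation n, (T.cycles n).map (T.toPreChains n)

/-- The group of top spherical chains `Chains(n)_n`: the top degree part of the complex of
spherical chains modulo the top homology. -/
abbrev TopChains (n : ℕ) : Type := PreChains n n ⧸ topHomology n

/-- The class in `Chains(n)_n` of the oriented simplex `[r_1, ..., r_n]` of `T`. -/
def Triangulation.simplexClass (T : Triangulation n) (r : Fin n → RatRay n) (h : T.IsFace r) :
    TopChains n :=
  QuotientAddGroup.mk' (topHomology n) (T.toPreChains n (T.simplex r h))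

open Classical in
/-- The class `Δ(r_1, ..., r_n)` of the simplex spanned by independent rays: its class in any
triangulation that contains it (and zero if there is no such triangulation). -/
def Δ (r : Fin n → RatRay n) : TopChains n :=
  if h : ∃ T : Triangulation n, T.IsFace r then h.choose.simplexClass r h.choose_spec else 0

/-! ### The Orlik-Solomon algebra and the Steinberg module -/

/-- A point of `ℙ^{n-1}(ℚ)`: a line in `ℚ^n`. -/
abbrev Line (n : ℕ) : Type := ℙ ℚ (Fin n → ℚ)

/-- The line `ℚ r` spanned by a ray. -/
def line (r : RatRay n) : Line n := Projectivization.mk ℚ r.someVector r.someVector_ne_zero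

/-- The two-sided ideal generated by `∂ ([ℓ_1] ∧ ... ∧ [ℓ_k])` for all lines `ℓ_1, ..., ℓ_k` that
span a space of rank less than `k`. -/
def osIdeal (n : ℕ) : TwoSidedIdeal (Symbols (Line n)) :=
  TwoSidedIdeal.span {x | ∃ (k : ℕ) (ℓ : Fin k → Line n),
    Module.finrank ℚ (⨆ i, (ℓ i).submodule : Submodule ℚ (Fin n → ℚ)) < k ∧
      x = boundary (Line n) (monomial ℓ)}

/-- The Orlik-Solomon algebra `OS(n)`. -/
def OS (n : ℕ) : Type := (osIdeal n).ringCon.Quotient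

instance (n : ℕ) : Ring (OS n) := inferInstanceAs (Ring (osIdeal n).ringCon.Quotient)

/-- The quotient map onto the Orlik-Solomon algebra. -/
def OS.mk (n : ℕ) : Symbols (Line n) →+* OS n := (osIdeal n).ringCon.mk'

/-- The Steinberg module `St(n) = OS(n)_n`: the part of degree `n` of the Orlik-Solomon algebra. -/
def St (n : ℕ) : AddSubgroup (OS n) :=
  (⋀[ℤ]^n (Line n →₀ ℤ)).toAddSubgroup.map (OS.mk n).toAddMonoidHom

lemma monomial_mem {X : Type} {k : ℕ} (x : Fin k → X) :
    monomial x ∈ (⋀[ℤ]^k (X →₀ ℤ)).toAddSubgroup :=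
  ExteriorAlgebra.ιMulti_range ℤ k ⟨_, rfl⟩

/-- The element `[ℓ_1] ∧ ... ∧ [ℓ_n]` of the Steinberg module. -/
def St.wedge (ℓ : Fin n → Line n) : St n :=
  ⟨OS.mk n (monomial ℓ), ⟨monomial ℓ, monomial_mem ℓ, rfl⟩⟩

/-! ### The actions of `GL_n(ℚ)` -/

/-- The action of `GL_n(ℚ)` on rays. -/
def rayAct (γ : GLQ n) : RatRay n → RatRay n := Module.Ray.map γ

/-- The action of `GL_n(ℚ)` on lines. -/
def lineAct (γ : GLQ n) : Line n → Line n :=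
  Projectivization.map γ.toLinearMap γ.injective


lemma rayAct_injective (γ : GLQ n) : Function.Injective (rayAct γ) :=
  (Module.Ray.map γ).injective

lemma rayAct_symm (γ : GLQ n) (ρ : RatRay n) : rayAct γ.symm (rayAct γ ρ) = ρ := by
  unfold rayAct
  rw [← Module.Ray.map_symm]
  exact Equiv.symm_apply_apply _ _

lemma rayAct_symm' (γ : GLQ n) (ρ : RatRay n) : rayAct γ (rayAct γ.symm ρ) = ρ :=
  rayAct_symm γ.symm ρ

lemma someVector_rayAct (γ : GLQ n) (ρ : RatRay n) :
    ∃ c : ℚ, 0 < c ∧ (rayAct γ ρ).someVector = c • γ ρ.someVector := by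
  have h0 : γ ρ.someVector ≠ 0 := by
    simp
  have h : SameRay ℚ (γ ρ.someVector) (rayAct γ ρ).someVector := by
    rw [← ray_eq_iff h0 (rayAct γ ρ).someVector_ne_zero, Module.Ray.someVector_ray]
    conv_rhs => rw [← ρ.someVector_ray]
    rfl
  obtain ⟨c, hc, h⟩ := h.exists_pos_left h0 (rayAct γ ρ).someVector_ne_zero
  exact ⟨c, hc, h.symm⟩

lemma line_rayAct (γ : GLQ n) (ρ : RatRay n) : line (rayAct γ ρ) = lineAct γ (line ρ) := by
  obtain ⟨c, hc, h⟩ := someVector_rayAct γ ρ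
  unfold line lineAct
  rw [Projectivization.map_mk, Projectivization.mk_eq_mk_iff']
  exact ⟨c, h.symm⟩

/-- The action of `GL_n(ℚ)` on `ℝ^n`. -/
def realAct (γ : GLQ n) : (Fin n → ℝ) →ₗ[ℝ] (Fin n → ℝ) :=
  Matrix.toLin' ((LinearMap.toMatrix' γ.toLinearMap).map (Rat.castHom ℝ))

lemma realAct_toReal (γ : GLQ n) (v : Fin n → ℚ) : realAct γ (toReal v) = toReal (γ v) := by
  have h : γ v = (LinearMap.toMatrix' γ.toLinearMap).mulVec v := by
    rw [LinearMap.toMatrix'_mulVec]; rfl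
  ext i
  rw [h]
  simp [realAct, toReal, Matrix.toLin'_apply, Matrix.mulVec, dotProduct]

lemma realAct_symm (γ : GLQ n) (x : Fin n → ℝ) : realAct γ.symm (realAct γ x) = x := by
  have h : LinearMap.toMatrix' γ.symm.toLinearMap * LinearMap.toMatrix' γ.toLinearMap = 1 := by
    rw [← LinearMap.toMatrix'_comp]
    simp
  unfold realAct
  rw [← LinearMap.comp_apply, ← Matrix.toLin'_mul, ← Matrix.map_mul, h]
  simp

lemma realAct_injective (γ : GLQ n) : Function.Injective (realAct γ) :=
  Function.LeftInverse.injective (realAct_symm γ)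

lemma toReal_smul (c : ℚ) (v : Fin n → ℚ) : toReal (c • v) = (c : ℝ) • toReal v := by
  ext i; simp [toReal]

lemma cone_rayAct (γ : GLQ n) (s : Set (RatRay n)) :
    cone (rayAct γ '' s) = (cone s).map (realAct γ) := by
  apply le_antisymm
  · refine Submodule.span_le.2 ?_
    rintro _ ⟨_, ⟨ρ, hρ, rfl⟩, rfl⟩
    obtain ⟨c, hc, h⟩ := someVector_rayAct γ ρ
    have hmem : toReal ρ.someVector ∈ cone s := Submodule.subset_span ⟨ρ, hρ, rfl⟩
    refine PointedCone.mem_map.2 ⟨(c : ℝ) • toReal ρ.someVector,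
      (cone s).smul_mem (by exact_mod_cast hc.le) hmem, ?_⟩
    simp only [h, map_smul, realAct_toReal, toReal_smul]
  · refine Submodule.map_le_iff_le_comap.2 (Submodule.span_le.2 ?_)
    rintro _ ⟨ρ, hρ, rfl⟩
    obtain ⟨c, hc, h⟩ := someVector_rayAct γ ρ
    change realAct γ (toReal ρ.someVector) ∈ cone (rayAct γ '' s)
    have hmem : toReal (rayAct γ ρ).someVector ∈ cone (rayAct γ '' s) :=
      Submodule.subset_span ⟨_, ⟨ρ, hρ, rfl⟩, rfl⟩
    have : realAct γ (toReal ρ.someVector) = ((c⁻¹ : ℚ) : ℝ) • toReal (rayAct γ ρ).someVector := by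
      rw [h, realAct_toReal, ← toReal_smul, smul_smul, inv_mul_cancel₀ hc.ne', one_smul]
    rw [this]
    exact PointedCone.smul_mem _ (by exact_mod_cast (inv_pos.2 hc).le) hmem

lemma indep_rayAct {ι : Type} (γ : GLQ n) {r : ι → RatRay n} (h : Indep r) :
    Indep (fun i => rayAct γ (r i)) := by
  unfold Indep at *
  choose c hc hcv using someVector_rayAct γ
  have h1 : LinearIndependent ℚ (fun i => γ (r i).someVector) :=
    h.map' γ.toLinearMap (LinearEquiv.ker γ)
  have h2 := h1.units_smul (fun i => Units.mk0 (c (r i)) (hc _).ne')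
  convert! h2 using 2 with i
  exact hcv _

lemma sameOrientation_rayAct (γ : GLQ n) {k : ℕ} {r t : Fin k → RatRay n}
    (h : SameOrientation r t) :
    SameOrientation (fun i => rayAct γ (r i)) (fun i => rayAct γ (t i)) := by
  choose c hc hcv using someVector_rayAct γ
  obtain ⟨A, hA, h⟩ := h
  refine ⟨Matrix.diagonal (fun i => c (t i)) * A * Matrix.diagonal (fun j => (c (r j))⁻¹), ?_, ?_⟩
  · rw [Matrix.det_mul, Matrix.det_mul, Matrix.det_diagonal, Matrix.det_diagonal]
    exact mul_pos (mul_pos (Finset.prod_pos fun i _ => hc _) hA)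
      (Finset.prod_pos fun i _ => inv_pos.2 (hc _))
  · intro i
    simp only [hcv, h i, map_sum, map_smul, Finset.smul_sum, Matrix.mul_diagonal,
      Matrix.diagonal_mul, smul_smul]
    refine Finset.sum_congr rfl fun j _ => ?_
    rw [mul_assoc, inv_mul_cancel₀ (hc _).ne', mul_one]

/-- The pushforward of a triangulation. -/
def Triangulation.act (γ : GLQ n) (T : Triangulation n) : Triangulation n where
  faces := (fun s => rayAct γ '' s) '' T.faces
  finite := T.finite.image _
  empty_mem := ⟨∅, T.empty_mem, Set.image_empty _⟩
  down_closed := by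
    rintro _ ⟨s, hs, rfl⟩ t ht
    obtain ⟨u, hu, rfl⟩ := Set.subset_image_iff.1 ht
    exact ⟨u, T.down_closed s hs u hu, rfl⟩
  indep := by
    rintro _ ⟨s, hs, rfl⟩
    have h := indep_rayAct γ (T.indep s hs)
    have h' := h.comp (Equiv.Set.image _ s (rayAct_injective γ)).symm (Equiv.injective _)
    unfold Indep
    convert! h' using 2 with ρ
    have := congrArg Subtype.val
      ((Equiv.Set.image _ s (rayAct_injective γ)).apply_symm_apply ρ)
    exact congrArg Module.Ray.someVector this.symm
  inter := by
    rintro _ ⟨s, hs, rfl⟩ _ ⟨t, ht, rfl⟩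
    rw [← Set.image_inter (rayAct_injective γ), cone_rayAct, cone_rayAct, cone_rayAct,
      ← T.inter s hs t ht]
    apply SetLike.coe_injective
    simp only [PointedCone.coe_map, Submodule.coe_inf]
    exact (Set.image_inter (realAct_injective γ)).symm
  cover := by
    intro x
    obtain ⟨s, hs, hx⟩ := T.cover (realAct γ.symm x)
    refine ⟨_, ⟨s, hs, rfl⟩, ?_⟩
    rw [cone_rayAct]
    exact PointedCone.mem_map.2 ⟨_, hx, realAct_symm γ.symm x⟩

lemma range_rayAct (γ : GLQ n) {k : ℕ} (r : Fin k → RatRay n) :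
    Set.range (fun i => rayAct γ (r i)) = rayAct γ '' Set.range r :=
  Set.range_comp _ _

lemma Triangulation.act_isFace (γ : GLQ n) {T : Triangulation n} {k : ℕ} {r : Fin k → RatRay n}
    (h : T.IsFace r) : (T.act γ).IsFace (fun i => rayAct γ (r i)) :=
  ⟨(rayAct_injective γ).comp h.1, by rw [range_rayAct]; exact ⟨_, h.2, rfl⟩⟩

lemma Triangulation.act_refines (γ : GLQ n) {T T' : Triangulation n} (h : T.Refines T') :
    (T.act γ).Refines (T'.act γ) := by
  rintro _ ⟨s, hs, rfl⟩
  obtain ⟨U, hU, hs⟩ := h s hs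
  refine ⟨(fun s => rayAct γ '' s) '' U, Set.image_mono hU, ?_⟩
  simp only [cone_rayAct, PointedCone.coe_map, hs, Set.image_iUnion, Set.biUnion_image]

lemma Triangulation.act_isSubdivision (γ : GLQ n) {T : Triangulation n} {k m : ℕ}
    {r : Fin k → RatRay n} {t : Fin m → Fin k → RatRay n} (h : T.IsSubdivision r t) :
    (T.act γ).IsSubdivision (fun i => rayAct γ (r i)) (fun j i => rayAct γ (t j i)) where
  isFace j := T.act_isFace γ (h.isFace j)
  le j := by
    rw [range_rayAct, range_rayAct, cone_rayAct, cone_rayAct]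
    exact Submodule.map_mono (h.le j)
  sameOrientation j := sameOrientation_rayAct γ (h.sameOrientation j)
  unique := by
    rintro u ⟨hu, s, hs, hsu⟩ hle
    have hu' : T.IsFace (fun i => rayAct γ.symm (u i)) := by
      refine ⟨(rayAct_injective γ.symm).comp hu, ?_⟩
      rw [range_rayAct, ← hsu]
      simpa [Set.image_image, rayAct_symm] using hs
    have hru : Set.range u = rayAct γ '' Set.range (fun i => rayAct γ.symm (u i)) := by
      rw [← range_rayAct]; simp [rayAct_symm']
    rw [hru, range_rayAct γ r, cone_rayAct, cone_rayAct] at hle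
    have hle' : cone (Set.range fun i => rayAct γ.symm (u i)) ≤ cone (Set.range r) := by
      intro x hx
      have hx' : realAct γ x ∈ (cone (Set.range fun i => rayAct γ.symm (u i))).map (realAct γ) :=
        PointedCone.mem_map.2 ⟨x, hx, rfl⟩
      obtain ⟨y, hy, hxy⟩ := PointedCone.mem_map.1 (hle hx')
      rwa [← realAct_injective γ hxy]
    obtain ⟨j, hj, hj'⟩ := h.unique _ hu' hle'
    refine ⟨j, ?_, ?_⟩
    · simp only [range_rayAct]; rw [hj, hru]
    · intro j₂ h₂
      simp only [range_rayAct] at h₂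
      rw [hru] at h₂
      exact hj' _ ((rayAct_injective γ).image_injective h₂)

lemma symbolsMap_monomial {X Y : Type} (f : X → Y) {k : ℕ} (x : Fin k → X) :
    symbolsMap f (monomial x) = monomial (fun i => f (x i)) := by
  simp only [symbolsMap, monomial, ExteriorAlgebra.map_apply_ιMulti]
  congr 1
  ext i : 1
  simp [Function.comp]

lemma boundary_symbolsMap {X Y : Type} (f : X → Y) (x : Symbols X) :
    boundary Y (symbolsMap f x) = symbolsMap f (boundary X x) := by
  induction x using CliffordAlgebra.left_induction with
  | algebraMap r =>
    have h : ∀ Z : Type, boundary Z (algebraMap ℤ (Symbols Z) r) = 0 :=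
      fun Z => CliffordAlgebra.contractLeft_algebraMap (Q := (0 : QuadraticForm ℤ (Z →₀ ℤ))) _ r
    have h' : symbolsMap f (algebraMap ℤ (Symbols X) r) = algebraMap ℤ (Symbols Y) r :=
      AlgHom.commutes _ _
    exact (congrArg _ h').trans ((h Y).trans ((congrArg _ (h X)).trans (map_zero _)).symm)
  | add x y hx hy => simp only [map_add, hx, hy]
  | ι_mul x m hx =>
    have h1 : symbolsMap f (CliffordAlgebra.ι 0 m) =
        CliffordAlgebra.ι 0 (Finsupp.lmapDomain ℤ ℤ f m) := ExteriorAlgebra.map_apply_ι _ _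
    have h2 : ∀ (Z : Type) (a : Z →₀ ℤ) (b : Symbols Z),
        boundary Z (CliffordAlgebra.ι 0 a * b) =
          (Finsupp.linearCombination ℤ (fun _ : Z => (1 : ℤ)) a) • b -
            CliffordAlgebra.ι 0 a * boundary Z b :=
      fun Z a b => CliffordAlgebra.contractLeft_ι_mul _ _ _
    rw [map_mul, h1, h2, h2, map_sub, map_smul, map_mul, h1, hx]
    congr 2
    rw [Finsupp.lmapDomain_apply, Finsupp.linearCombination_mapDomain]
    rfl

/-- The pushforward of the chains of a triangulation. -/
def Triangulation.chainsAct (γ : GLQ n) (T : Triangulation n) (k : ℕ) :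
    T.chains k →+ (T.act γ).chains k :=
  ((symbolsMap (rayAct γ)).toLinearMap.toAddMonoidHom.comp (T.chains k).subtype).codRestrict _ <| by
    rintro ⟨x, hx⟩
    change symbolsMap (rayAct γ) x ∈ _
    induction hx using AddSubgroup.closure_induction with
    | mem x hx =>
      obtain ⟨r, hr, rfl⟩ := hx
      rw [symbolsMap_monomial]
      exact AddSubgroup.subset_closure ⟨_, T.act_isFace γ hr, rfl⟩
    | zero => rw [map_zero]; exact zero_mem _
    | add x y _ _ hx hy => rw [map_add]; exact add_mem hx hy
    | neg x _ hx => rw [map_neg]; exact neg_mem hx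

lemma Triangulation.chainsAct_simplex (γ : GLQ n) (T : Triangulation n) {k : ℕ}
    (r : Fin k → RatRay n) (h : T.IsFace r) :
    T.chainsAct γ k (T.simplex r h) = (T.act γ).simplex _ (T.act_isFace γ h) :=
  Subtype.ext (symbolsMap_monomial _ _)

open Classical in
/-- The action of `GL_n(ℚ)` on the direct sum of the chain groups of all triangulations. -/
def sumAct (γ : GLQ n) (k : ℕ) :
    (⨁ T : Triangulation n, T.chains k) →+ (⨁ T : Triangulation n, T.chains k) :=
  DirectSum.toAddMonoid fun T =>
    (DirectSum.of (fun T : Triangulation n => T.chains k) (T.act γ)).comp (T.chainsAct γ k)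

/-- The action of `GL_n(ℚ)` on the complex of spherical chains, by pushforward of simplices. -/
def preChainsAct (γ : GLQ n) (k : ℕ) : PreChains n k →+ PreChains n k :=
  QuotientAddGroup.map _ _ (sumAct γ k) <| by
    refine (AddSubgroup.closure_le _).2 ?_
    rintro _ ⟨T, T', hT, r, h, m, t, ht, rfl⟩
    refine AddSubgroup.subset_closure ⟨T.act γ, T'.act γ, Triangulation.act_refines γ hT, _,
      T.act_isFace γ h, m, _, T'.act_isSubdivision γ ht, ?_⟩
    simp [sumAct, Triangulation.chainsAct_simplex]

lemma preChainsAct_toPreChains (γ : GLQ n) (T : Triangulation n) (k : ℕ) (x : T.chains k) :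
    preChainsAct γ k (T.toPreChains k x) = (T.act γ).toPreChains k (T.chainsAct γ k x) := by
  classical
  change QuotientAddGroup.mk' _ (sumAct γ k _) = _
  unfold sumAct
  rw [DirectSum.toAddMonoid_of]
  rfl

/-- The action of `GL_n(ℚ)` on the top spherical chains. -/
def TopChains.act (γ : GLQ n) : TopChains n →+ TopChains n :=
  QuotientAddGroup.map _ _ (preChainsAct γ n) <| by
    refine iSup_le fun T => ?_
    rintro _ ⟨x, hx, rfl⟩
    rw [AddSubgroup.mem_comap, preChainsAct_toPreChains]
    refine AddSubgroup.mem_iSup_of_mem (T.act γ) ⟨_, ?_, rfl⟩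
    change boundary _ (symbolsMap (rayAct γ) x) = 0
    rw [boundary_symbolsMap]
    have hx' : boundary _ (x : Symbols (RatRay n)) = 0 := hx
    rw [hx', map_zero]

lemma submodule_lineAct (γ : GLQ n) (ℓ : Line n) :
    (lineAct γ ℓ).submodule = ℓ.submodule.map γ.toLinearMap := by
  induction ℓ using Projectivization.ind with
  | h v hv =>
    simp [lineAct, Projectivization.map_mk, Projectivization.submodule_mk, Submodule.map_span]

lemma osIdeal_le_comap (γ : GLQ n) :
    osIdeal n ≤ (osIdeal n).comap (symbolsMap (lineAct γ)).toRingHom := by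
  refine TwoSidedIdeal.span_le.2 ?_
  rintro _ ⟨k, ℓ, hℓ, rfl⟩
  refine (TwoSidedIdeal.mem_comap _).2 (TwoSidedIdeal.subset_span ⟨k, fun i => lineAct γ (ℓ i), ?_,
    ?_⟩)
  · have h : (⨆ i, (lineAct γ (ℓ i)).submodule : Submodule ℚ (Fin n → ℚ)) =
        (⨆ i, (ℓ i).submodule : Submodule ℚ (Fin n → ℚ)).map γ.toLinearMap := by
      rw [Submodule.map_iSup]
      exact iSup_congr fun i => submodule_lineAct γ (ℓ i)
    rw [h]
    exact (Submodule.finrank_map_le _ _).trans_lt hℓ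
  · change symbolsMap (lineAct γ) _ = _
    rw [← boundary_symbolsMap, symbolsMap_monomial]

/-- The action of `GL_n(ℚ)` on the Orlik-Solomon algebra. -/
def OS.act (γ : GLQ n) : OS n →+* OS n :=
  RingCon.lift (osIdeal n).ringCon ((OS.mk n).comp (symbolsMap (lineAct γ)).toRingHom) <| by
    intro x y h
    have h1 := osIdeal_le_comap γ (((osIdeal n).rel_iff x y).1 h)
    rw [TwoSidedIdeal.mem_comap, map_sub] at h1
    exact (RingCon.eq _).2 (((osIdeal n).rel_iff _ _).2 h1)

/-- The action of `GL_n(ℚ)` on the Steinberg module. -/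
def St.act (γ : GLQ n) : St n →+ St n :=
  ((OS.act γ).toAddMonoidHom.comp (St n).subtype).codRestrict _ <| by
    rintro ⟨_, x, hx, rfl⟩
    refine ⟨symbolsMap (lineAct γ) x, ?_, rfl⟩
    have h := Submodule.mem_map_of_mem (f := (symbolsMap (lineAct γ)).toLinearMap) hx
    rw [Submodule.map_pow] at h
    exact pow_le_pow_left' ((ExteriorAlgebra.ι_range_map_map _).le.trans
      LinearMap.map_le_range) _ h

end SphericalChains

end

/-! Well-definedness of `Δ`. Independent rays span a simplex of the triangulation by orthants. Any
two triangulations have a common refinement, obtained by repeatedly cutting edges along hyperplanes,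
and the subdivision of a simplex there does not depend on the triangulation it came from.

The map. In the colimit a simplex is identified with the sum of its pieces, so the Steinberg symbol
has to be additive. It is, because linear relations between oriented indicator functions of cones,
valid outside finitely many hyperplanes, carry over to symbols (`OS.sum_monomial_eq_zero`). If a
line `p` lies in the span of the lines of a monomial `ℓ`, then `∂ ([p] ∧ ℓ) = 0` in the
Orlik-Solomon algebra gives `ℓ = [p] ∧ ∂ ℓ`. Choosing `p` as a function of the span only and
iterating, a monomial becomes a signed sum over permutations of terms that depend only on the flags
of its vectors (`OS.mk_monomial_eq_sum_flag`). The coefficient of a flag can be read off the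
indicator function: for a basis `e` adapted to the flag, take the `2^n` points `∑ ε_k δ^(n-1-k) e_k`
(indices from `0`) with signs `ε` and small `δ > 0`, and count those in the cone with weight `∏
ε_k`. Up to the orientation sign this is the coefficient (`eventually_sum_signs`). Top cycles die
because a cycle `x` equals `∂ ([ρ] ∧ x)` for any ray `ρ`, and `n + 1` lines in `ℚ^n` are dependent.

The kernel. Modulo wedges, the class `D` of a simplex depends only on the lines of its vertices.
Cutting an edge gives a three-term relation for `D`, now with arbitrary nonzero scalars. By
induction on the support of `w` it becomes `D(v) = ∑_i D(v with v_i replaced by w)`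
(`eq_sum_update`), which says that `D`, extended to symbols, vanishes on boundaries. Since it also
vanishes on dependent monomials, the Leibniz rule makes it vanish on the whole Orlik-Solomon ideal
(`symbolsToChains_of_mem_osIdeal`). An element of the kernel is represented by a symbol in that
ideal, hence is zero modulo wedges. -/

noncomputable section

namespace SphericalChains

/-! ### Linear maps out of the ring of symbols -/

section Symbols

variable {X : Type} {N : Type*} [AddCommGroup N]

/-- The multilinear extension of a function on tuples of symbols. -/
def multilinearExtension : ∀ {k : ℕ}, ((Fin k → X) → N) →
    MultilinearMap ℤ (fun _ : Fin k => X →₀ ℤ) N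
  | 0, g => MultilinearMap.constOfIsEmpty ℤ _ (g Fin.elim0)
  | _ + 1, g => LinearMap.uncurryLeft
      (Finsupp.linearCombination ℤ fun x => multilinearExtension fun t => g (Fin.cons x t))

lemma multilinearExtension_single {k : ℕ} (g : (Fin k → X) → N) (x : Fin k → X) :
    multilinearExtension g (fun i => Finsupp.single (x i) 1) = g x := by
  induction k with
  | zero =>
    simp only [multilinearExtension, MultilinearMap.constOfIsEmpty_apply]
    exact congrArg g (Subsingleton.elim _ _)
  | succ k ih =>
    simp only [multilinearExtension, LinearMap.uncurryLeft_apply,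
      Finsupp.linearCombination_single, one_smul]
    refine (ih (fun t => g (Fin.cons (x 0) t)) (Fin.tail x)).trans ?_
    rw [Fin.cons_self_tail]

lemma multilinearExtension_apply {k : ℕ} (g : (Fin k → X) → N) (v : Fin k → X →₀ ℤ) (S : Finset X)
    (hS : ∀ i, (v i).support ⊆ S) :
    multilinearExtension g v = ∑ x ∈ Fintype.piFinset fun _ => S, (∏ i, v i (x i)) • g x := by
  have hv : v = fun i => ∑ a ∈ S, v i a • Finsupp.single a (1 : ℤ) := by
    funext i
    conv_lhs => rw [← Finsupp.sum_single (v i)]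
    rw [Finsupp.sum_of_support_subset _ (hS i) _ (by simp)]
    simp
  conv_lhs => rw [hv]
  rw [MultilinearMap.map_sum_finset]
  refine Finset.sum_congr rfl fun x _ => ?_
  rw [MultilinearMap.map_smul_univ, multilinearExtension_single]

open Classical in
/-- The alternating extension of an alternating function on tuples of symbols. -/
def alternatingExtension {k : ℕ} (g : (Fin k → X) → N)
    (hg : ∀ x i j, i ≠ j → x i = x j → g x = 0)
    (hs : ∀ x i j, i ≠ j → g (x ∘ Equiv.swap i j) = -g x) :
    (X →₀ ℤ) [⋀^Fin k]→ₗ[ℤ] N :=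
  { multilinearExtension g with
    map_eq_zero_of_eq' := by
      intro v i j hv hij
      change multilinearExtension g v = 0
      rw [multilinearExtension_apply g v (Finset.univ.biUnion fun i => (v i).support)
        fun i => Finset.subset_biUnion_of_mem (fun i => (v i).support) (Finset.mem_univ i)]
      -- Swapping positions `i` and `j` pairs off the terms. Fixed points of the pairing have `x i =
      -- x j` and vanish by `hg`, which `hs` alone does not give when `N` has 2-torsion.
      refine Finset.sum_involution (fun x _ => x ∘ Equiv.swap i j) ?_ ?_ ?_ ?_
      · intro x _
        rw [hs x i j hij, smul_neg]
        have : ∏ l, v l ((x ∘ Equiv.swap i j) l) = ∏ l, v l (x l) := by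
          refine Fintype.prod_equiv (Equiv.swap i j) _ _ fun l => ?_
          have : v l = v (Equiv.swap i j l) := by
            by_cases h1 : l = i
            · subst h1; simp [hv]
            by_cases h2 : l = j
            · subst h2; simp [hv]
            rw [Equiv.swap_apply_of_ne_of_ne h1 h2]
          rw [← this]; rfl
        rw [this, add_neg_cancel]
      · intro x _ hx h
        refine hx ?_
        rw [hg x i j hij, smul_zero]
        have := congrFun h j
        simpa using this
      · intro x hx
        simp only [Fintype.mem_piFinset] at hx ⊢
        exact fun l => hx _
      · intro x _
        funext l
        simp }

lemma alternatingExtension_single {k : ℕ} (g : (Fin k → X) → N) (hg) (hs) (x : Fin k → X) :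
    alternatingExtension g hg hs (fun i => Finsupp.single (x i) 1) = g x :=
  multilinearExtension_single g x

open Classical in
/-- The linear map on the ring of symbols that is given by an alternating function in degree `k`
and vanishes in all other degrees. -/
def symbolsLift {k : ℕ} (g : (Fin k → X) → N)
    (hg : ∀ x i j, i ≠ j → x i = x j → g x = 0)
    (hs : ∀ x i j, i ≠ j → g (x ∘ Equiv.swap i j) = -g x) : Symbols X →ₗ[ℤ] N :=
  ExteriorAlgebra.liftAlternating fun i =>
    if h : k = i then h ▸ alternatingExtension g hg hs else 0

lemma symbolsLift_monomial {k : ℕ} (g : (Fin k → X) → N) (hg) (hs) (x : Fin k → X) :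
    symbolsLift g hg hs (monomial x) = g x := by
  rw [symbolsLift, monomial, ExteriorAlgebra.liftAlternating_apply_ιMulti]
  simp only [dite_true]
  exact alternatingExtension_single g hg hs x

lemma symbolsLift_monomial_of_ne {k l : ℕ} (hkl : k ≠ l) (g : (Fin k → X) → N) (hg) (hs)
    (x : Fin l → X) : symbolsLift g hg hs (monomial x) = 0 := by
  rw [symbolsLift, monomial, ExteriorAlgebra.liftAlternating_apply_ιMulti]
  simp [hkl]

/-! ### Monomials and the differential -/

/-- The generator `[x]`. -/
def symbol (x : X) : Symbols X := ExteriorAlgebra.ι ℤ (Finsupp.single x 1)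

lemma monomial_zero (x : Fin 0 → X) : monomial x = 1 := ExteriorAlgebra.ιMulti_zero_apply _

lemma monomial_succ {k : ℕ} (x : Fin (k + 1) → X) :
    monomial x = symbol (x 0) * monomial (Fin.tail x) :=
  ExteriorAlgebra.ιMulti_succ_apply _

lemma monomial_cons {k : ℕ} (a : X) (x : Fin k → X) :
    monomial (Fin.cons a x : Fin (k + 1) → X) = symbol a * monomial x :=
  monomial_succ _

lemma monomial_mul {k l : ℕ} (x : Fin k → X) (y : Fin l → X) :
    monomial x * monomial y = monomial (Fin.append x y) := by
  unfold monomial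
  rw [ExteriorAlgebra.ιMulti_mul_ιMulti]
  congr 1
  funext i
  refine Fin.addCases (fun i => ?_) (fun i => ?_) i <;> simp

lemma monomial_perm {k : ℕ} (x : Fin k → X) (σ : Equiv.Perm (Fin k)) :
    monomial (x ∘ σ) = Equiv.Perm.sign σ • monomial x :=
  AlternatingMap.map_perm (ExteriorAlgebra.ιMulti ℤ k) (fun i => Finsupp.single (x i) 1) σ

lemma monomial_swap {k : ℕ} (x : Fin k → X) {i j : Fin k} (h : i ≠ j) :
    monomial (x ∘ Equiv.swap i j) = -monomial x := by
  rw [monomial_perm, Equiv.Perm.sign_swap h]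
  simp

lemma monomial_insertNth {k : ℕ} (i : Fin (k + 1)) (a : X) (x : Fin k → X) :
    monomial (i.insertNth a x : Fin (k + 1) → X) = (-1 : ℤ) ^ (i : ℕ) • (symbol a * monomial x) := by
  have h := AlternatingMap.map_insertNth (ExteriorAlgebra.ιMulti ℤ (k + 1)) i (Finsupp.single a 1)
    (fun j => Finsupp.single (x j) (1 : ℤ))
  rw [← monomial_cons]
  unfold monomial
  convert! h using 3
  · rename_i j
    refine Fin.succAboveCases i ?_ (fun j => ?_) j <;> simp
  · funext j
    refine Fin.cases ?_ (fun j => ?_) j <;> simp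

lemma boundary_symbol_mul (a : X) (b : Symbols X) :
    boundary X (symbol a * b) = b - symbol a * boundary X b := by
  have h := CliffordAlgebra.contractLeft_ι_mul (Q := (0 : QuadraticForm ℤ (X →₀ ℤ)))
    (Finsupp.linearCombination ℤ (fun _ : X => (1 : ℤ))) (Finsupp.single a 1) b
  rw [Finsupp.linearCombination_single, smul_eq_mul, one_mul, one_smul] at h
  exact h

lemma boundary_one : boundary X (1 : Symbols X) = 0 :=
  CliffordAlgebra.contractLeft_one (Q := (0 : QuadraticForm ℤ (X →₀ ℤ))) _

lemma symbol_mul_self (a : X) : symbol a * symbol a = 0 := ExteriorAlgebra.ι_sq_zero _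

lemma boundary_monomial {k : ℕ} (x : Fin (k + 1) → X) :
    boundary X (monomial x) = ∑ i : Fin (k + 1), (-1 : ℤ) ^ (i : ℕ) • monomial (x ∘ i.succAbove) := by
  induction k with
  | zero =>
    rw [monomial_succ, boundary_symbol_mul]
    simp [monomial_zero, boundary_one]
  | succ k ih =>
    rw [monomial_succ, boundary_symbol_mul, ih, Fin.sum_univ_succ (n := k + 1), Finset.mul_sum,
      sub_eq_add_neg, ← Finset.sum_neg_distrib]
    congr 1
    · simp; rfl
    · refine Finset.sum_congr rfl fun i _ => ?_
      rw [monomial_succ (x ∘ i.succ.succAbove), mul_smul_comm, Fin.val_succ, pow_succ, mul_neg_one,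
        neg_smul]
      congr 4
      funext j
      simp [Fin.tail]

/-- Since `[x_0] ∧ [x_0] = 0`, only the first term of the boundary survives. Through this identity
the Orlik-Solomon ideal contains dependent monomials themselves, not only their boundaries. -/
lemma monomial_eq_symbol_mul_boundary {k : ℕ} (x : Fin (k + 1) → X) :
    monomial x = symbol (x 0) * boundary X (monomial x) := by
  rw [monomial_succ, boundary_symbol_mul, mul_sub, ← mul_assoc, symbol_mul_self]
  simp

lemma closure_monomial :
    AddSubgroup.closure {z : Symbols X | ∃ (k : ℕ) (x : Fin k → X), z = monomial x} = ⊤ := by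
  refine (AddSubgroup.eq_top_iff' _).2 fun z => ?_
  induction z using CliffordAlgebra.left_induction with
  | algebraMap r =>
    rw [Algebra.algebraMap_eq_smul_one]
    refine zsmul_mem (AddSubgroup.subset_closure ?_) r
    exact ⟨0, Fin.elim0, (monomial_zero _).symm⟩
  | add x y hx hy => exact add_mem hx hy
  | ι_mul z m hz =>
    induction m using Finsupp.induction_linear with
    | zero => simp
    | add a b ha hb => rw [map_add, add_mul]; exact add_mem ha hb
    | single a c =>
      have h : CliffordAlgebra.ι (0 : QuadraticForm ℤ (X →₀ ℤ)) (Finsupp.single a c) =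
          c • symbol a := by
        rw [show Finsupp.single a c = c • Finsupp.single a 1 by simp, map_smul]; rfl
      rw [h, smul_mul_assoc]
      refine zsmul_mem ?_ c
      induction hz using AddSubgroup.closure_induction with
      | mem z hz =>
        obtain ⟨k, x, rfl⟩ := hz
        exact AddSubgroup.subset_closure ⟨k + 1, Fin.cons a x, (monomial_cons a x).symm⟩
      | zero => simp
      | add x y _ _ hx hy => rw [mul_add]; exact add_mem hx hy
      | neg x _ hx => rw [mul_neg]; exact neg_mem hx

lemma symbols_induction {p : Symbols X → Prop} (mono : ∀ (k : ℕ) (x : Fin k → X), p (monomial x))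
    (add : ∀ x y, p x → p y → p (x + y)) (neg : ∀ x, p x → p (-x)) (z : Symbols X) : p z := by
  have hz : z ∈ AddSubgroup.closure {z : Symbols X | ∃ (k : ℕ) (x : Fin k → X), z = monomial x} := by
    rw [closure_monomial]; trivial
  induction hz using AddSubgroup.closure_induction with
  | mem z hz => obtain ⟨k, x, rfl⟩ := hz; exact mono k x
  | zero => simpa using add _ _ (mono 0 Fin.elim0) (neg _ (mono 0 Fin.elim0))
  | add x y _ _ hx hy => exact add x y hx hy
  | neg x _ hx => exact neg x hx

/-- The differential is a graded derivation. -/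
lemma boundary_monomial_mul {k : ℕ} (x : Fin k → X) (b : Symbols X) :
    boundary X (monomial x * b) =
      boundary X (monomial x) * b + (-1 : ℤ) ^ k • (monomial x * boundary X b) := by
  induction k with
  | zero => simp [monomial_zero, boundary_one]
  | succ k ih =>
    rw [monomial_succ, mul_assoc, boundary_symbol_mul, boundary_symbol_mul, ih, pow_succ]
    simp only [mul_add, sub_mul, mul_assoc, mul_smul_comm, mul_neg_one, neg_smul]
    abel

/-- A linear map which kills all boundaries and all multiples of a monomial kills all multiples of
the boundary of that monomial. -/
lemma map_mul_boundary_mul (G : Symbols X →+ N) (hG : ∀ z, G (boundary X z) = 0) {k : ℕ}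
    (x : Fin k → X) (hx : ∀ a b, G (a * monomial x * b) = 0) (a b : Symbols X) :
    G (a * boundary X (monomial x) * b) = 0 := by
  induction a using symbols_induction with
  | mono l y =>
    -- Of the three Leibniz terms of `∂ (y ∧ x ∧ b)`, two contain the monomial of `x` intact and
    -- vanish by `hx`; the third is the wanted one up to sign.
    have h := hG (monomial y * (monomial x * b))
    rw [boundary_monomial_mul, boundary_monomial_mul, map_add, ← mul_assoc, hx, zero_add,
      map_zsmul, mul_add, map_add, mul_smul_comm, map_zsmul, ← mul_assoc, ← mul_assoc, hx,
      smul_zero, add_zero] at h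
    rcases neg_one_pow_eq_or ℤ l with h' | h' <;> rw [h'] at h <;> simpa using h
  | add y z hy hz => rw [add_mul, add_mul, map_add, hy, hz, add_zero]
  | neg y hy => rw [neg_mul, neg_mul, map_neg, hy, neg_zero]

end Symbols

variable {n : ℕ}

/-! ### Cones and nonnegative combinations of rays -/

/-- A vector of `ℝ^n` that spans the ray. -/
def rayVec (ρ : RatRay n) : Fin n → ℝ := toReal ρ.someVector

/-- The linear combination of rays with given real coefficients. -/
def comb : (RatRay n →₀ ℝ) →ₗ[ℝ] (Fin n → ℝ) := Finsupp.linearCombination ℝ rayVec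

lemma comb_single (ρ : RatRay n) (a : ℝ) : comb (Finsupp.single ρ a) = a • rayVec ρ :=
  Finsupp.linearCombination_single _ _ _

lemma comb_eq_sum (c : RatRay n →₀ ℝ) : comb c = ∑ ρ ∈ c.support, c ρ • rayVec ρ :=
  Finsupp.linearCombination_apply _ _

lemma toReal_add (v w : Fin n → ℚ) : toReal (v + w) = toReal v + toReal w := by
  ext i; simp [toReal]

lemma toReal_sum {ι : Type*} (s : Finset ι) (v : ι → Fin n → ℚ) :
    toReal (∑ i ∈ s, v i) = ∑ i ∈ s, toReal (v i) := by
  ext j; simp [toReal]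

lemma toReal_zero : toReal (0 : Fin n → ℚ) = 0 := by
  ext i; simp [toReal]

lemma rayVec_mem_cone {s : Set (RatRay n)} {ρ : RatRay n} (h : ρ ∈ s) : rayVec ρ ∈ cone s :=
  Submodule.subset_span ⟨ρ, h, rfl⟩

lemma mem_cone_iff {s : Set (RatRay n)} {x : Fin n → ℝ} :
    x ∈ cone s ↔ ∃ c : RatRay n →₀ ℝ, 0 ≤ c ∧ (c.support : Set (RatRay n)) ⊆ s ∧ comb c = x := by
  classical
  constructor
  · intro hx
    induction hx using Submodule.span_induction with
    | mem x hx =>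
      obtain ⟨ρ, hρ, rfl⟩ := hx
      refine ⟨Finsupp.single ρ 1, Finsupp.single_nonneg.2 zero_le_one, ?_, ?_⟩
      · refine (Finset.coe_subset.2 Finsupp.support_single_subset).trans ?_
        simpa using hρ
      · rw [comb_single, one_smul]; rfl
    | zero => exact ⟨0, le_rfl, by simp, map_zero _⟩
    | add x y _ _ hx hy =>
      obtain ⟨c, hc, hcs, rfl⟩ := hx
      obtain ⟨d, hd, hds, rfl⟩ := hy
      refine ⟨c + d, add_nonneg hc hd, ?_, map_add _ _ _⟩
      refine (Finset.coe_subset.2 Finsupp.support_add).trans ?_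
      rw [Finset.coe_union]
      exact Set.union_subset hcs hds
    | smul a x _ hx =>
      obtain ⟨c, hc, hcs, rfl⟩ := hx
      refine ⟨(a : ℝ) • c, smul_nonneg a.2 hc, ?_, map_smul _ _ _⟩
      exact (Finset.coe_subset.2 Finsupp.support_smul).trans hcs
  · rintro ⟨c, hc, hcs, rfl⟩
    rw [comb_eq_sum]
    exact Submodule.sum_mem _ fun ρ hρ => PointedCone.smul_mem _ (hc ρ) (rayVec_mem_cone (hcs hρ))

lemma cone_mono {s t : Set (RatRay n)} (h : s ⊆ t) : cone s ≤ cone t :=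
  Submodule.span_mono (Set.image_mono h)

lemma cone_le_iff {s : Set (RatRay n)} {C : PointedCone ℝ (Fin n → ℝ)} :
    cone s ≤ C ↔ ∀ ρ ∈ s, rayVec ρ ∈ C := by
  refine Submodule.span_le.trans ?_
  rw [Set.image_subset_iff]
  rfl

lemma comb_mem_cone {c : RatRay n →₀ ℝ} (hc : 0 ≤ c) : comb c ∈ cone (c.support : Set (RatRay n)) :=
  mem_cone_iff.2 ⟨c, hc, subset_rfl, rfl⟩

/-! ### Rational functionals and independence -/

/-- The extension of a rational functional to `ℝ^n`. -/
def realFun (φ : (Fin n → ℚ) →ₗ[ℚ] ℚ) : (Fin n → ℝ) →ₗ[ℝ] ℝ :=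
  ∑ i, (φ (Pi.single i 1) : ℝ) • LinearMap.proj i

lemma realFun_toReal (φ : (Fin n → ℚ) →ₗ[ℚ] ℚ) (v : Fin n → ℚ) :
    realFun φ (toReal v) = φ v := by
  have h : φ v = ∑ i, v i * φ (Pi.single i 1) := by
    conv_lhs => rw [pi_eq_sum_univ' v]
    simp
  rw [h]
  simp [realFun, toReal, mul_comm]

/-- A basis containing given independent rays. -/
lemma exists_basis_of_indep {s : Set (RatRay n)} (hs : Indep (fun ρ : s => (ρ : RatRay n))) :
    ∃ (ι : Type) (_ : Fintype ι) (b : Module.Basis ι ℚ (Fin n → ℚ)) (e : s → ι),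
      Function.Injective e ∧ ∀ ρ, b (e ρ) = (ρ : RatRay n).someVector := by
  have hv : LinearIndependent ℚ (fun ρ : s => (ρ : RatRay n).someVector) := hs
  have h := hv.linearIndepOn_id
  let b := Module.Basis.extend h
  have hfin : Finite (h.extend (Set.subset_univ _)) := Module.Finite.finite_basis b
  have hmem : ∀ ρ : s, (ρ : RatRay n).someVector ∈ h.extend (Set.subset_univ _) :=
    fun ρ => h.subset_extend _ ⟨ρ, rfl⟩
  refine ⟨_, Fintype.ofFinite _, b, fun ρ => ⟨_, hmem ρ⟩, ?_, ?_⟩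
  · intro ρ ρ' hρ
    simp only [Subtype.mk.injEq] at hρ
    exact hv.injective hρ
  · intro ρ
    exact Module.Basis.extend_apply_self h _

lemma Indep.finite {s : Set (RatRay n)} (hs : Indep (fun ρ : s => (ρ : RatRay n))) : s.Finite := by
  obtain ⟨ι, _, b, e, he, -⟩ := exists_basis_of_indep hs
  have := Finite.of_injective e he
  exact s.toFinite

/-- Independent rays have unique coefficients over `ℝ`. -/
lemma comb_injOn {s : Set (RatRay n)} (hs : Indep (fun ρ : s => (ρ : RatRay n)))
    {c d : RatRay n →₀ ℝ} (hc : (c.support : Set (RatRay n)) ⊆ s)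
    (hd : (d.support : Set (RatRay n)) ⊆ s) (h : comb c = comb d) : c = d := by
  classical
  obtain ⟨ι, _, b, e, he, hb⟩ := exists_basis_of_indep hs
  -- The rational coordinate functionals of a basis through `s` extend to `ℝ^n` and read off the
  -- coefficients; this turns independence over `ℚ` into uniqueness over `ℝ`.
  have key : ∀ (a : RatRay n →₀ ℝ), (a.support : Set (RatRay n)) ⊆ s → ∀ ρ : s,
      realFun (b.coord (e ρ)) (comb a) = a ρ := by
    intro a ha ρ
    rw [comb_eq_sum, map_sum]
    have : ∀ ρ' ∈ a.support, realFun (b.coord (e ρ)) (a ρ' • rayVec ρ') =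
        if ρ' = (ρ : RatRay n) then a ρ' else 0 := by
      intro ρ' hρ'
      have := hb ⟨ρ', ha hρ'⟩
      rw [map_smul, rayVec, realFun_toReal, ← this, Module.Basis.coord_apply,
        Module.Basis.repr_self, Finsupp.single_apply, he.eq_iff, Subtype.ext_iff]
      split_ifs <;> simp
    rw [Finset.sum_congr rfl this, Finset.sum_ite_eq']
    by_cases hρ : (ρ : RatRay n) ∈ a.support
    · rw [if_pos hρ]
    · rw [if_neg hρ, Finsupp.notMem_support_iff.1 hρ]
  ext ρ
  by_cases hρ : ρ ∈ s
  · rw [← key c hc ⟨ρ, hρ⟩, ← key d hd ⟨ρ, hρ⟩, h]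
  · rw [Finsupp.notMem_support_iff.1 fun h => hρ (hc h),
      Finsupp.notMem_support_iff.1 fun h => hρ (hd h)]

/-- The rational points of a simplicial cone are cut out by finitely many rational functionals. -/
lemma exists_functionals {s : Set (RatRay n)} (hs : Indep (fun ρ : s => (ρ : RatRay n))) :
    ∃ Λ : Finset ((Fin n → ℚ) →ₗ[ℚ] ℚ), ∀ v, toReal v ∈ cone s ↔ ∀ φ ∈ Λ, 0 ≤ φ v := by
  classical
  obtain ⟨ι, _, b, e, he, hb⟩ := exists_basis_of_indep hs
  -- All coordinates are to be nonnegative, and those outside `s` also nonpositive.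
  refine ⟨Finset.univ.image b.coord ∪
    (Finset.univ.filter fun i => i ∉ Set.range e).image fun i => -b.coord i, fun v => ?_⟩
  have hcoord : ∀ i, ∀ ρ ∈ s, 0 ≤ b.coord i ρ.someVector := by
    intro i ρ hρ
    rw [← hb ⟨ρ, hρ⟩, Module.Basis.coord_apply, Module.Basis.repr_self, Finsupp.single_apply]
    split_ifs <;> simp
  have hcoord' : ∀ i, i ∉ Set.range e → ∀ ρ ∈ s, b.coord i ρ.someVector = 0 := by
    intro i hi ρ hρ
    rw [← hb ⟨ρ, hρ⟩, Module.Basis.coord_apply, Module.Basis.repr_self, Finsupp.single_apply,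
      if_neg fun h => hi ⟨_, h⟩]
  have hpos : ∀ φ : (Fin n → ℚ) →ₗ[ℚ] ℚ, (∀ ρ ∈ s, 0 ≤ φ ρ.someVector) → toReal v ∈ cone s →
      0 ≤ φ v := by
    intro φ hφ hv
    obtain ⟨c, hc, hcs, hcv⟩ := mem_cone_iff.1 hv
    have : (0 : ℝ) ≤ φ v := by
      rw [← realFun_toReal, ← hcv, comb_eq_sum, map_sum]
      refine Finset.sum_nonneg fun ρ hρ => ?_
      rw [map_smul, rayVec, realFun_toReal]
      exact mul_nonneg (hc ρ) (by exact_mod_cast hφ ρ (hcs hρ))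
    exact_mod_cast this
  constructor
  · intro hv φ hφ
    rcases Finset.mem_union.1 hφ with h | h
    · obtain ⟨i, -, rfl⟩ := Finset.mem_image.1 h
      exact hpos _ (hcoord i) hv
    · obtain ⟨i, hi, rfl⟩ := Finset.mem_image.1 h
      exact hpos _ (fun ρ hρ => by simp [hcoord' i (Finset.mem_filter.1 hi).2 ρ hρ]) hv
  · intro h
    have h1 : ∀ i, 0 ≤ b.coord i v := fun i =>
      h _ (Finset.mem_union_left _ (Finset.mem_image_of_mem _ (Finset.mem_univ i)))
    have h2 : ∀ i, i ∉ Set.range e → b.coord i v = 0 := fun i hi =>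
      le_antisymm (by simpa using h _ (Finset.mem_union_right _ (Finset.mem_image_of_mem _
        (Finset.mem_filter.2 ⟨Finset.mem_univ i, hi⟩)))) (h1 i)
    rw [← b.sum_repr v, toReal_sum]
    refine Submodule.sum_mem _ fun i _ => ?_
    rw [toReal_smul]
    by_cases hi : i ∈ Set.range e
    · obtain ⟨ρ, rfl⟩ := hi
      rw [hb]
      exact PointedCone.smul_mem _ (by exact_mod_cast h1 (e ρ)) (rayVec_mem_cone ρ.2)
    · have := h2 i hi
      rw [Module.Basis.coord_apply] at this
      rw [this]; simp

/-! ### Triangulations and normal forms -/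

/-- The common point lies in the cone over the intersection of the two supports, and an expression
of it there agrees with both by independence. Together with `exists_comb`, every vector has exactly
one normal form in `T`; triangulations are mostly handled through this. -/
lemma Triangulation.comb_unique (T : Triangulation n) {c d : RatRay n →₀ ℝ} (hc : 0 ≤ c)
    (hd : 0 ≤ d) (hcT : (c.support : Set (RatRay n)) ∈ T.faces)
    (hdT : (d.support : Set (RatRay n)) ∈ T.faces) (h : comb c = comb d) : c = d := by
  have hmem : comb c ∈ cone (c.support : Set (RatRay n)) ⊓ cone (d.support : Set (RatRay n)) :=
    ⟨comb_mem_cone hc, h ▸ comb_mem_cone hd⟩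
  rw [T.inter _ hcT _ hdT] at hmem
  obtain ⟨a, -, has, hca⟩ := mem_cone_iff.1 hmem
  rw [comb_injOn (T.indep _ hcT) subset_rfl (has.trans Set.inter_subset_left) hca.symm,
    comb_injOn (T.indep _ hdT) subset_rfl (has.trans Set.inter_subset_right)
      (h.symm.trans hca.symm)]

lemma Triangulation.exists_comb (T : Triangulation n) (x : Fin n → ℝ) :
    ∃ c : RatRay n →₀ ℝ, 0 ≤ c ∧ (c.support : Set (RatRay n)) ∈ T.faces ∧ comb c = x := by
  obtain ⟨s, hs, hx⟩ := T.cover x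
  obtain ⟨c, hc, hcs, rfl⟩ := mem_cone_iff.1 hx
  exact ⟨c, hc, T.down_closed s hs _ hcs, rfl⟩

/-- A ray of a simplex lying in the cone of another simplex is one of its vertices. -/
lemma Triangulation.mem_of_rayVec_mem_cone (T : Triangulation n) {ρ : RatRay n}
    {s : Set (RatRay n)} (hρ : {ρ} ∈ T.faces) (hs : s ∈ T.faces) (h : rayVec ρ ∈ cone s) :
    ρ ∈ s := by
  classical
  obtain ⟨c, hc, hcs, hcρ⟩ := mem_cone_iff.1 h
  have h1 : ((Finsupp.single ρ (1 : ℝ)).support : Set (RatRay n)) = {ρ} := by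
    rw [Finsupp.support_single _ one_ne_zero, Finset.coe_singleton]
  have := T.comb_unique hc (Finsupp.single_nonneg.2 zero_le_one) (T.down_closed s hs _ hcs)
    (by rwa [h1]) (by rw [hcρ, comb_single, one_smul])
  refine hcs ?_
  rw [this, h1]
  rfl

/-- A family of sets of rays such that every vector has exactly one normal form is a
triangulation. -/
def Triangulation.ofNormalForm (F : Set (Set (RatRay n))) (hfin : F.Finite) (hempty : ∅ ∈ F)
    (hdown : ∀ s ∈ F, ∀ t ⊆ s, t ∈ F)
    (hunique : ∀ c d : RatRay n →₀ ℝ, 0 ≤ c → 0 ≤ d → (c.support : Set (RatRay n)) ∈ F →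
      (d.support : Set (RatRay n)) ∈ F → comb c = comb d → c = d)
    (hexists : ∀ x : Fin n → ℝ, ∃ c : RatRay n →₀ ℝ, 0 ≤ c ∧
      (c.support : Set (RatRay n)) ∈ F ∧ comb c = x) : Triangulation n where
  faces := F
  finite := hfin
  empty_mem := hempty
  down_closed := hdown
  indep := by
    intro s hs
    refine linearIndepOn_iff.2 fun l hl hl0 => ?_
    have hl : (l.support : Set (RatRay n)) ⊆ s := (Finsupp.mem_supported _ _).1 hl
    -- The positive and negative parts of a rational relation are two normal forms of the same
    -- vector; their equality forces all coefficients to vanish.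
    let p : RatRay n →₀ ℝ := l.mapRange (fun q : ℚ => max (q : ℝ) 0) (by simp)
    let m : RatRay n →₀ ℝ := l.mapRange (fun q : ℚ => max (-(q : ℝ)) 0) (by simp)
    have hp : (p.support : Set (RatRay n)) ⊆ s :=
      (Finset.coe_subset.2 Finsupp.support_mapRange).trans hl
    have hm : (m.support : Set (RatRay n)) ⊆ s :=
      (Finset.coe_subset.2 Finsupp.support_mapRange).trans hl
    have hpm : comb p - comb m = 0 := by
      rw [← map_sub]
      have : p - m = l.mapRange (fun q : ℚ => (q : ℝ)) (by simp) := by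
        ext ρ
        simp only [p, m, Finsupp.coe_sub, Pi.sub_apply, Finsupp.mapRange_apply]
        rcases le_total (l ρ : ℝ) 0 with h | h
        · rw [max_eq_right h, max_eq_left (by linarith)]; ring
        · rw [max_eq_left h, max_eq_right (by linarith)]; ring
      rw [this, comb, Finsupp.linearCombination_apply, Finsupp.sum_mapRange_index (by simp)]
      rw [Finsupp.linearCombination_apply] at hl0
      have h0 := congrArg toReal hl0
      rw [Finsupp.sum, toReal_sum, toReal_zero] at h0
      simp only [toReal_smul] at h0
      exact h0
    have heq := hunique p m (fun ρ => le_max_right _ _) (fun ρ => le_max_right _ _)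
      (hdown s hs _ hp) (hdown s hs _ hm) (sub_eq_zero.1 hpm)
    ext ρ
    have h := DFunLike.congr_fun heq ρ
    simp only [p, m, Finsupp.mapRange_apply] at h
    have : (l ρ : ℝ) = 0 := by
      rcases le_total (l ρ : ℝ) 0 with h' | h'
      · rw [max_eq_right h', max_eq_left (by linarith)] at h; linarith
      · rw [max_eq_left h', max_eq_right (by linarith)] at h; linarith
    simpa using this
  inter := by
    intro s hs t ht
    refine le_antisymm ?_ (le_inf (cone_mono Set.inter_subset_left) (cone_mono Set.inter_subset_right))
    rintro x ⟨hxs, hxt⟩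
    obtain ⟨c, hc, hcs, rfl⟩ := mem_cone_iff.1 hxs
    obtain ⟨d, hd, hdt, hcd⟩ := mem_cone_iff.1 hxt
    have h := hunique c d hc hd (hdown s hs _ hcs) (hdown t ht _ hdt) hcd.symm
    exact mem_cone_iff.2 ⟨c, hc, Set.subset_inter hcs (h ▸ hdt), rfl⟩
  cover := by
    intro x
    obtain ⟨c, hc, hcF, rfl⟩ := hexists x
    exact ⟨_, hcF, comb_mem_cone hc⟩

/-! ### Subdividing an edge -/

/-- `someVector` is an arbitrary representative, so identities between vectors of rays hold only up
to positive factors such as `d`. -/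
lemma someVector_rayOfNeZero (v : Fin n → ℚ) (hv : v ≠ 0) :
    ∃ d : ℚ, 0 < d ∧ (rayOfNeZero ℚ v hv).someVector = d • v := by
  have h : SameRay ℚ v (rayOfNeZero ℚ v hv).someVector := by
    rw [← ray_eq_iff hv (rayOfNeZero ℚ v hv).someVector_ne_zero, Module.Ray.someVector_ray]
  obtain ⟨c, hc, h⟩ := h.exists_pos_left hv (rayOfNeZero ℚ v hv).someVector_ne_zero
  exact ⟨c, hc, h.symm⟩

/-- The ray `m` lies in the interior of the edge with vertices `a` and `b`. -/
structure Triangulation.EdgePoint (T : Triangulation n) (a b m : RatRay n) : Prop where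
  ne : a ≠ b
  edge : {a, b} ∈ T.faces
  exists_coeff : ∃ α β : ℝ, 0 < α ∧ 0 < β ∧ rayVec m = α • rayVec a + β • rayVec b

namespace Triangulation.EdgePoint

variable {T : Triangulation n} {a b m : RatRay n}

/-- A vertex is its own normal form, whereas a point inside an edge has a normal form with two
positive coefficients. -/
lemma notMem (h : T.EdgePoint a b m) {s : Set (RatRay n)} (hs : s ∈ T.faces) : m ∉ s := by
  classical
  intro hm
  obtain ⟨α, β, hα, hβ, hv⟩ := h.exists_coeff
  have hmF : {m} ∈ T.faces := T.down_closed s hs _ (Set.singleton_subset_iff.2 hm)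
  have hsupp : (((Finsupp.single a α + Finsupp.single b β).support : Finset (RatRay n)) :
      Set (RatRay n)) ⊆ {a, b} := by
    intro ρ hρ
    by_contra hne
    simp only [Set.mem_insert_iff, Set.mem_singleton_iff, not_or] at hne
    simp [Ne.symm hne.1, Ne.symm hne.2] at hρ
  have heq := T.comb_unique (c := Finsupp.single m 1)
    (d := Finsupp.single a α + Finsupp.single b β) (Finsupp.single_nonneg.2 zero_le_one)
    (add_nonneg (Finsupp.single_nonneg.2 hα.le) (Finsupp.single_nonneg.2 hβ.le))
    (by rwa [Finsupp.support_single _ one_ne_zero, Finset.coe_singleton])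
    (T.down_closed _ h.edge _ hsupp)
    (by rw [map_add, comb_single, comb_single, comb_single, one_smul, hv])
  have ha := DFunLike.congr_fun heq a
  have hb := DFunLike.congr_fun heq b
  simp only [Finsupp.single_apply, Finsupp.coe_add, Pi.add_apply, h.ne, h.ne.symm, if_true,
    if_false, add_zero, zero_add] at ha hb
  have hma : m = a := by
    by_contra hne; rw [if_neg hne] at ha; exact hα.ne ha
  have hmb : m = b := by
    by_contra hne; rw [if_neg hne] at hb; exact hβ.ne hb
  exact h.ne (hma.symm.trans hmb)

lemma ne_left (h : T.EdgePoint a b m) : m ≠ a := fun h' =>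
  h.notMem h.edge (h' ▸ Set.mem_insert _ _)

lemma ne_right (h : T.EdgePoint a b m) : m ≠ b := fun h' =>
  h.notMem h.edge (h' ▸ Set.mem_insert_of_mem _ rfl)

end Triangulation.EdgePoint

/-- The simplices of the subdivision of `T` at the point `m` of the edge `{a, b}`. -/
def Triangulation.edgeFaces (T : Triangulation n) (a b m : RatRay n) : Set (Set (RatRay n)) :=
  {s | ¬(a ∈ s ∧ b ∈ s) ∧ (m ∈ s → insert a (insert b (s \ {m})) ∈ T.faces) ∧
    (m ∉ s → s ∈ T.faces)}

lemma Triangulation.vertices_finite (T : Triangulation n) : {ρ | {ρ} ∈ T.faces}.Finite :=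
  T.finite.preimage Set.singleton_injective.injOn

open Classical in
/-- The subdivision of `T` at a point `m` of the edge `{a, b}`. -/
def Triangulation.edgeSubdivision (T : Triangulation n) (a b m : RatRay n)
    (h : T.EdgePoint a b m) : Triangulation n :=
  Triangulation.ofNormalForm (T.edgeFaces a b m)
    (by
      refine ((T.vertices_finite.insert m).powerset).subset ?_
      rintro s ⟨-, h1, h2⟩ ρ hρ
      by_cases hρm : ρ = m
      · exact Or.inl hρm
      right
      by_cases hm : m ∈ s
      · exact T.down_closed _ (h1 hm) _ (Set.singleton_subset_iff.2 (Or.inr (Or.inr ⟨hρ, hρm⟩)))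
      · exact T.down_closed _ (h2 hm) _ (Set.singleton_subset_iff.2 hρ))
    ⟨fun h => h.1, fun h => h.elim, fun _ => T.empty_mem⟩
    (by
      rintro s ⟨h0, h1, h2⟩ t hts
      refine ⟨fun h => h0 ⟨hts h.1, hts h.2⟩, fun hm => ?_, fun hm => ?_⟩
      · exact T.down_closed _ (h1 (hts hm)) _ (Set.insert_subset_insert (Set.insert_subset_insert
          (Set.sdiff_subset_sdiff_left hts)))
      · by_cases hms : m ∈ s
        · refine T.down_closed _ (h1 hms) _ fun ρ hρ => Or.inr (Or.inr ⟨hts hρ, ?_⟩)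
          rintro rfl
          exact hm hρ
        · exact T.down_closed _ (h2 hms) _ hts)
    (by
      obtain ⟨α, β, hα, hβ, hv⟩ := h.exists_coeff
      -- `D` moves the weight of `m` back onto `a` and `b`, turning a normal form of the subdivision
      -- into one of `T`.
      let D : (RatRay n →₀ ℝ) → (RatRay n →₀ ℝ) := fun c =>
        c.erase m + c m • (Finsupp.single a α + Finsupp.single b β)
      have hD : ∀ c, comb (D c) = comb c := by
        intro c
        conv_rhs => rw [← Finsupp.single_add_erase m c]
        simp only [D, map_add, map_smul, comb_single, hv]
        rw [add_comm]
      have hDnn : ∀ c, 0 ≤ c → 0 ≤ D c := by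
        intro c hc
        refine add_nonneg (fun ρ => ?_) (smul_nonneg (hc m)
          (add_nonneg (Finsupp.single_nonneg.2 hα.le) (Finsupp.single_nonneg.2 hβ.le)))
        rw [Finsupp.erase_apply]
        split_ifs
        · exact le_rfl
        · exact hc ρ
      have hDo : ∀ c ρ, ρ ≠ m → ρ ≠ a → ρ ≠ b → D c ρ = c ρ := by
        intro c ρ h1 h2 h3
        simp [D, h2.symm, h3.symm, Finsupp.erase_ne h1]
      have hDa : ∀ c, D c a = c a + c m * α := by
        intro c
        simp [D, Finsupp.erase_ne h.ne_left.symm, h.ne.symm]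
      have hDb : ∀ c, D c b = c b + c m * β := by
        intro c
        simp [D, Finsupp.erase_ne h.ne_right.symm, h.ne]
      have hDm : ∀ c, D c m = 0 := by
        intro c
        simp [D, h.ne_left.symm, h.ne_right.symm]
      have hDF : ∀ c, ((c.support : Finset _) : Set (RatRay n)) ∈ T.edgeFaces a b m →
          (((D c).support : Finset _) : Set (RatRay n)) ∈ T.faces := by
        rintro c ⟨-, h1, h2⟩
        by_cases hm : m ∈ c.support
        · refine T.down_closed _ (h1 hm) _ fun ρ hρ => ?_
          by_cases ha : ρ = a
          · exact Or.inl ha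
          by_cases hb : ρ = b
          · exact Or.inr (Or.inl hb)
          have hρm : ρ ≠ m := by
            rintro rfl
            exact Finsupp.mem_support_iff.1 hρ (hDm c)
          refine Or.inr (Or.inr ⟨?_, hρm⟩)
          have := Finsupp.mem_support_iff.1 hρ
          rw [hDo c ρ hρm ha hb] at this
          exact Finsupp.mem_support_iff.2 this
        · refine T.down_closed _ (h2 hm) _ fun ρ hρ => ?_
          have hcm : c m = 0 := Finsupp.notMem_support_iff.1 hm
          have : D c ρ ≠ 0 := Finsupp.mem_support_iff.1 hρ
          simp only [D, hcm, zero_smul, add_zero, Finsupp.erase_of_notMem_support hm] at this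
          exact Finsupp.mem_support_iff.2 this
      intro c d hc hd hcF hdF hcd
      have heq : D c = D d := T.comb_unique (hDnn c hc) (hDnn d hd) (hDF c hcF) (hDF d hdF)
        (by rw [hD, hD, hcd])
      have hzero : ∀ c : RatRay n →₀ ℝ, ((c.support : Finset _) : Set (RatRay n)) ∈
          T.edgeFaces a b m → c a = 0 ∨ c b = 0 := by
        rintro c ⟨h0, -⟩
        by_contra! hne
        exact h0 ⟨Finsupp.mem_support_iff.2 hne.1, Finsupp.mem_support_iff.2 hne.2⟩
      have ea := DFunLike.congr_fun heq a
      have eb := DFunLike.congr_fun heq b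
      rw [hDa, hDa] at ea
      rw [hDb, hDb] at eb
      have hca : 0 ≤ c a := hc a
      have hcb : 0 ≤ c b := hc b
      have hda : 0 ≤ d a := hd a
      have hdb : 0 ≤ d b := hd b
      -- As `c a` or `c b` vanishes, `c m` is the smaller of `D c a / α` and `D c b / β`, and
      -- likewise for `d`; so `D c = D d` determines it.
      have hm : c m = d m := by
        have l1 : ∀ p q γ : ℝ, 0 < γ → p * γ ≤ q * γ → p ≤ q := fun p q γ hγ h =>
          le_of_mul_le_mul_right h hγ
        rcases hzero c hcF with h1 | h1 <;> rcases hzero d hdF with h2 | h2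
        · exact le_antisymm (l1 _ _ α hα (by linarith)) (l1 _ _ α hα (by linarith))
        · exact le_antisymm (l1 _ _ β hβ (by linarith)) (l1 _ _ α hα (by linarith))
        · exact le_antisymm (l1 _ _ α hα (by linarith)) (l1 _ _ β hβ (by linarith))
        · exact le_antisymm (l1 _ _ β hβ (by linarith)) (l1 _ _ β hβ (by linarith))
      ext ρ
      by_cases h1 : ρ = m
      · rw [h1, hm]
      by_cases h2 : ρ = a
      · rw [h2]; rw [hm] at ea; linarith
      by_cases h3 : ρ = b
      · rw [h3]; rw [hm] at eb; linarith
      rw [← hDo c ρ h1 h2 h3, ← hDo d ρ h1 h2 h3, heq])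
    (by
      obtain ⟨α, β, hα, hβ, hv⟩ := h.exists_coeff
      intro x
      obtain ⟨c, hc, hcF, rfl⟩ := T.exists_comb x
      have hcm : c m = 0 := by
        by_contra hne
        exact h.notMem hcF (Finsupp.mem_support_iff.2 hne)
      -- The largest multiple of `m` that can be split off with the weights of `a` and `b` staying
      -- nonnegative; it makes one of them zero.
      set θ := min (c a / α) (c b / β) with hθ
      have hθ0 : 0 ≤ θ := le_min (div_nonneg (hc a) hα.le) (div_nonneg (hc b) hβ.le)
      have hθa : θ * α ≤ c a := (le_div_iff₀ hα).1 (min_le_left _ _)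
      have hθb : θ * β ≤ c b := (le_div_iff₀ hβ).1 (min_le_right _ _)
      let d : RatRay n →₀ ℝ := Finsupp.single m θ + (c - θ • (Finsupp.single a α + Finsupp.single b β))
      have hdm : d m = θ := by
        simp [d, h.ne_left.symm, h.ne_right.symm, hcm]
      have hda : d a = c a - θ * α := by
        simp [d, h.ne_left, h.ne.symm]
      have hdb : d b = c b - θ * β := by
        simp [d, h.ne_right, h.ne]
      have hdo : ∀ ρ, ρ ≠ m → ρ ≠ a → ρ ≠ b → d ρ = c ρ := by
        intro ρ h1 h2 h3
        simp [d, h1.symm, h2.symm, h3.symm]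
      have hdc : ∀ ρ, ρ ≠ m → 0 ≤ d ρ ∧ d ρ ≤ c ρ := by
        intro ρ h1
        by_cases h2 : ρ = a
        · rw [h2, hda]; exact ⟨by linarith, by linarith [mul_nonneg hθ0 hα.le]⟩
        by_cases h3 : ρ = b
        · rw [h3, hdb]; exact ⟨by linarith, by linarith [mul_nonneg hθ0 hβ.le]⟩
        rw [hdo ρ h1 h2 h3]; exact ⟨hc ρ, le_rfl⟩
      have hdsupp : ∀ ρ, ρ ≠ m → ρ ∈ d.support → ρ ∈ c.support := by
        intro ρ h1 h2
        rw [Finsupp.mem_support_iff] at h2 ⊢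
        intro h0
        have := hdc ρ h1
        rw [h0] at this
        exact h2 (le_antisymm this.2 this.1)
      refine ⟨d, fun ρ => ?_, ⟨?_, ?_, ?_⟩, ?_⟩
      · by_cases h1 : ρ = m
        · rw [h1, hdm]; exact hθ0
        · exact (hdc ρ h1).1
      · rintro ⟨h1, h2⟩
        replace h1 := Finsupp.mem_support_iff.1 h1
        replace h2 := Finsupp.mem_support_iff.1 h2
        rw [hda] at h1
        rw [hdb] at h2
        rcases min_choice (c a / α) (c b / β) with h' | h' <;> rw [← hθ] at h' <;> rw [h'] at h1 h2
        · rw [div_mul_cancel₀ _ hα.ne'] at h1; exact h1 (sub_self _)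
        · rw [div_mul_cancel₀ _ hβ.ne'] at h2; exact h2 (sub_self _)
      · intro hm
        have hθ1 : 0 < θ := lt_of_le_of_ne hθ0 fun h0 =>
          Finsupp.mem_support_iff.1 hm (hdm.trans h0.symm)
        refine T.down_closed _ hcF _ ?_
        rintro ρ (rfl | rfl | hρ)
        · exact Finsupp.mem_support_iff.2 ((mul_pos hθ1 hα).trans_le hθa).ne'
        · exact Finsupp.mem_support_iff.2 ((mul_pos hθ1 hβ).trans_le hθb).ne'
        · exact hdsupp ρ hρ.2 hρ.1
      · intro hm
        refine T.down_closed _ hcF _ fun ρ hρ => hdsupp ρ ?_ hρ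
        rintro rfl
        exact hm hρ
      · simp only [d, map_add, map_sub, map_smul, comb_single, hv]
        abel)

/-! ### Refinement through containment of simplices -/

/-- Every simplex of `T` is contained in a simplex of `T'`. -/
def Triangulation.Finer (T T' : Triangulation n) : Prop :=
  ∀ s ∈ T.faces, ∃ t ∈ T'.faces, cone s ≤ cone t

lemma Triangulation.Finer.refl (T : Triangulation n) : T.Finer T := fun s hs => ⟨s, hs, le_rfl⟩

lemma Triangulation.Finer.trans {T T' T'' : Triangulation n} (h : T.Finer T') (h' : T'.Finer T'') :
    T.Finer T'' := by
  intro s hs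
  obtain ⟨t, ht, hst⟩ := h s hs
  obtain ⟨u, hu, htu⟩ := h' t ht
  exact ⟨u, hu, hst.trans htu⟩

/-- A face of a simplicial cone that contains a positive combination contains its summands. -/
lemma Triangulation.mem_cone_of_sum_mem (T : Triangulation n) {s t : Set (RatRay n)}
    (hs : s ∈ T.faces) (ht : t ∈ T.faces) {ι : Type*} (I : Finset ι) (w : ι → ℝ)
    (x : ι → Fin n → ℝ) (hw : ∀ i ∈ I, 0 < w i) (hx : ∀ i ∈ I, x i ∈ cone t)
    (h : ∑ i ∈ I, w i • x i ∈ cone s) : ∀ i ∈ I, x i ∈ cone s := by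
  classical
  choose! c hc hct hcx using fun i hi => mem_cone_iff.1 (hx i hi)
  obtain ⟨d, hd, hds, hdx⟩ := mem_cone_iff.1 h
  have hsum : ((∑ i ∈ I, w i • c i).support : Set (RatRay n)) ⊆ t := by
    intro ρ hρ
    have hρ := Finsupp.mem_support_iff.1 hρ
    rw [Finsupp.finsetSum_apply] at hρ
    obtain ⟨i, hi, hne⟩ := Finset.exists_ne_zero_of_sum_ne_zero hρ
    refine hct i hi (Finsupp.mem_support_iff.2 fun h0 => hne ?_)
    rw [Finsupp.smul_apply, h0, smul_zero]
  have hnn : 0 ≤ ∑ i ∈ I, w i • c i :=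
    Finset.sum_nonneg fun i hi => smul_nonneg (hw i hi).le (hc i hi)
  have heq := T.comb_unique hd hnn (T.down_closed s hs _ hds) (T.down_closed t ht _ hsum) (by
    rw [hdx, map_sum]
    exact Finset.sum_congr rfl fun i hi => by rw [map_smul, hcx i hi])
  intro i hi
  refine mem_cone_iff.2 ⟨c i, hc i hi, fun ρ hρ => hds ?_, hcx i hi⟩
  refine Finsupp.mem_support_iff.2 ?_
  rw [heq, Finsupp.finsetSum_apply]
  refine (Finset.sum_pos' (fun j hj => mul_nonneg (hw j hj).le (hc j hj ρ)) ⟨i, hi, ?_⟩).ne'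
  exact mul_pos (hw i hi) (lt_of_le_of_ne (hc i hi ρ) (Finsupp.mem_support_iff.1 hρ).symm)

/-- A point of a simplex `s` of `T'` has a carrier in `T`, which lies in some simplex of `T'`. The
vertices of the carrier enter with positive weights, so `mem_cone_of_sum_mem` puts them all in the
cone over `s`. -/
lemma Triangulation.Finer.refines {T T' : Triangulation n} (h : T.Finer T') : T.Refines T' := by
  intro s hs
  refine ⟨{t ∈ T.faces | cone t ≤ cone s}, fun t ht => ht.1, ?_⟩
  ext x
  simp only [Set.mem_iUnion]
  constructor
  · intro hx
    obtain ⟨c, hc, hcT, rfl⟩ := T.exists_comb x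
    obtain ⟨t, ht, hct⟩ := h _ hcT
    refine ⟨_, ⟨hcT, cone_le_iff.2 ?_⟩, comb_mem_cone hc⟩
    refine T'.mem_cone_of_sum_mem hs ht c.support c rayVec (fun ρ hρ => ?_) (fun ρ hρ => ?_) ?_
    · exact lt_of_le_of_ne (hc ρ) (Finsupp.mem_support_iff.1 hρ).symm
    · exact hct (rayVec_mem_cone hρ)
    · rw [← comb_eq_sum]; exact hx
  · rintro ⟨t, ht, hx⟩
    exact ht.2 hx

lemma Triangulation.edgeSubdivision_finer (T : Triangulation n) {a b m : RatRay n}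
    (h : T.EdgePoint a b m) : (T.edgeSubdivision a b m h).Finer T := by
  rintro s ⟨-, h1, h2⟩
  by_cases hm : m ∈ s
  · refine ⟨_, h1 hm, cone_le_iff.2 fun ρ hρ => ?_⟩
    by_cases hρm : ρ = m
    · obtain ⟨α, β, hα, hβ, hv⟩ := h.exists_coeff
      rw [hρm, hv]
      exact add_mem (PointedCone.smul_mem _ hα.le (rayVec_mem_cone (Or.inl rfl)))
        (PointedCone.smul_mem _ hβ.le (rayVec_mem_cone (Or.inr (Or.inl rfl))))
    · exact rayVec_mem_cone (Or.inr (Or.inr ⟨hρ, hρm⟩))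
  · exact ⟨s, h2 hm, le_rfl⟩

/-! ### Common refinements -/

/-- The functional does not change sign on any simplex of `T`. -/
def Triangulation.Coherent (T : Triangulation n) (φ : (Fin n → ℚ) →ₗ[ℚ] ℚ) : Prop :=
  ∀ s ∈ T.faces, (∀ ρ ∈ s, 0 ≤ φ ρ.someVector) ∨ (∀ ρ ∈ s, φ ρ.someVector ≤ 0)

lemma realFun_nonneg {φ : (Fin n → ℚ) →ₗ[ℚ] ℚ} {s : Set (RatRay n)}
    (h : ∀ ρ ∈ s, 0 ≤ φ ρ.someVector) {x : Fin n → ℝ} (hx : x ∈ cone s) : 0 ≤ realFun φ x := by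
  obtain ⟨c, hc, hcs, rfl⟩ := mem_cone_iff.1 hx
  rw [comb_eq_sum, map_sum]
  refine Finset.sum_nonneg fun ρ hρ => ?_
  rw [map_smul, rayVec, realFun_toReal]
  exact mul_nonneg (hc ρ) (by exact_mod_cast h ρ (hcs hρ))

lemma Triangulation.Coherent.of_finer {T T' : Triangulation n} {φ : (Fin n → ℚ) →ₗ[ℚ] ℚ}
    (hT : T'.Coherent φ) (h : T.Finer T') : T.Coherent φ := by
  intro s hs
  obtain ⟨t, ht, hst⟩ := h s hs
  refine (hT t ht).imp (fun h ρ hρ => ?_) (fun h ρ hρ => ?_)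
  · have := realFun_nonneg h (hst (rayVec_mem_cone hρ))
    rw [rayVec, realFun_toReal] at this
    exact_mod_cast this
  · have := realFun_nonneg (φ := -φ) (s := t) (fun ρ hρ => by simpa using h ρ hρ)
      (hst (rayVec_mem_cone hρ))
    rw [rayVec, realFun_toReal] at this
    have h' : 0 ≤ (-φ) ρ.someVector := by exact_mod_cast this
    simpa using h'

/-- The edges of `T` that cross the kernel of a functional. -/
def Triangulation.crossing (T : Triangulation n) (φ : (Fin n → ℚ) →ₗ[ℚ] ℚ) :
    Set (RatRay n × RatRay n) :=
  {p | {p.1, p.2} ∈ T.faces ∧ 0 < φ p.1.someVector ∧ φ p.2.someVector < 0}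

lemma Triangulation.crossing_finite (T : Triangulation n) (φ : (Fin n → ℚ) →ₗ[ℚ] ℚ) :
    (T.crossing φ).Finite := by
  refine (T.vertices_finite.prod T.vertices_finite).subset fun p hp => ⟨?_, ?_⟩
  · exact T.down_closed _ hp.1 _ (Set.singleton_subset_iff.2 (Or.inl rfl))
  · exact T.down_closed _ hp.1 _ (Set.singleton_subset_iff.2 (Or.inr rfl))

/-- The interior points of edges given by rational vectors. -/
lemma Triangulation.exists_edgePoint (T : Triangulation n) {a b : RatRay n} (hab : a ≠ b)
    (he : {a, b} ∈ T.faces) {p q : ℚ} (hp : 0 < p) (hq : 0 < q) :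
    ∃ h : p • a.someVector + q • b.someVector ≠ 0,
      T.EdgePoint a b (rayOfNeZero ℚ (p • a.someVector + q • b.someVector) h) := by
  classical
  have h : p • a.someVector + q • b.someVector ≠ 0 := by
    intro h0
    have h := (LinearIndepOn.pair_iff _ hab).1 (T.indep _ he : LinearIndepOn ℚ _ {a, b}) p q h0
    exact hp.ne' h.1
  refine ⟨h, hab, he, ?_⟩
  obtain ⟨d, hd, hv⟩ := someVector_rayOfNeZero _ h
  refine ⟨d * p, d * q, by exact_mod_cast mul_pos hd hp, by exact_mod_cast mul_pos hd hq, ?_⟩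
  rw [rayVec, hv, toReal_smul, toReal_add, toReal_smul, toReal_smul, smul_add, smul_smul, smul_smul]
  rfl

/-- Cut a crossing edge at its point in the kernel of `φ`. The new vertex lies in the kernel, so it
is on no crossing edge, and the cut edge disappears: the number of crossing edges drops. -/
lemma Triangulation.exists_finer_coherent (T : Triangulation n) (φ : (Fin n → ℚ) →ₗ[ℚ] ℚ) :
    ∃ T' : Triangulation n, T'.Finer T ∧ T'.Coherent φ := by
  induction hN : (T.crossing φ).ncard using Nat.strong_induction_on generalizing T with
  | _ N ih =>
    by_cases hc : (T.crossing φ) = ∅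
    · refine ⟨T, Finer.refl T, fun s hs => ?_⟩
      by_contra! hne
      obtain ⟨⟨b, hb, hb0⟩, ⟨a, ha, ha0⟩⟩ := hne
      have : (a, b) ∈ T.crossing φ := ⟨T.down_closed s hs _ (Set.pair_subset ha hb), ha0, hb0⟩
      rw [hc] at this
      exact this
    · obtain ⟨⟨a, b⟩, he, ha, hb⟩ := Set.nonempty_iff_ne_empty.2 hc
      simp only at he ha hb
      have hab : a ≠ b := by
        rintro rfl
        exact lt_asymm ha hb
      -- The weights `-φ(b)` at `a` and `φ(a)` at `b` make `φ` vanish on the new vertex.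
      obtain ⟨h0, hm⟩ := T.exists_edgePoint hab he (neg_pos.2 hb) ha
      set m := rayOfNeZero ℚ _ h0 with hmdef
      have hφm : φ m.someVector = 0 := by
        obtain ⟨d, -, hv⟩ := someVector_rayOfNeZero _ h0
        rw [hmdef, hv, map_smul, map_add, map_smul, map_smul, smul_eq_mul, smul_eq_mul, smul_eq_mul]
        ring
      have hlt : ((T.edgeSubdivision a b m hm).crossing φ).ncard < N := by
        rw [← hN]
        refine Set.ncard_lt_ncard ⟨?_, ?_⟩ (T.crossing_finite φ)
        · rintro ⟨x, y⟩ ⟨⟨-, -, h2⟩, hx, hy⟩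
          refine ⟨h2 ?_, hx, hy⟩
          rintro (rfl | rfl)
          · exact hx.ne' hφm
          · exact hy.ne hφm
        · intro hsub
          obtain ⟨⟨h1, -⟩, -⟩ := hsub (a := (a, b)) ⟨he, ha, hb⟩
          exact h1 ⟨Or.inl rfl, Or.inr rfl⟩
      obtain ⟨T', hT', hco⟩ := ih _ hlt _ rfl
      exact ⟨T', hT'.trans (T.edgeSubdivision_finer hm), hco⟩

lemma Triangulation.exists_finer_forall_coherent (T : Triangulation n)
    (Λ : Finset ((Fin n → ℚ) →ₗ[ℚ] ℚ)) :
    ∃ T' : Triangulation n, T'.Finer T ∧ ∀ φ ∈ Λ, T'.Coherent φ := by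
  classical
  induction Λ using Finset.induction_on with
  | empty => exact ⟨T, Finer.refl T, by simp⟩
  | insert φ Λ _ ih =>
    obtain ⟨T', hT', h⟩ := ih
    obtain ⟨T'', hT'', hφ⟩ := T'.exists_finer_coherent φ
    refine ⟨T'', hT''.trans hT', fun ψ hψ => ?_⟩
    rcases Finset.mem_insert.1 hψ with rfl | hψ
    · exact hφ
    · exact (h ψ hψ).of_finer hT''

/-- Two triangulations have a common refinement. -/
lemma Triangulation.exists_common_finer (T T' : Triangulation n) :
    ∃ T'' : Triangulation n, T''.Finer T ∧ T''.Finer T' := by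
  classical
  choose! Λ hΛ using fun s (hs : s ∈ T'.faces) => exists_functionals (T'.indep s hs)
  obtain ⟨T'', hT, hco⟩ := T.exists_finer_forall_coherent (T'.finite.toFinset.biUnion Λ)
  refine ⟨T'', hT, fun u hu => ?_⟩
  have hfin := (T''.indep u hu).finite
  -- A simplex `s` of `T'` whose cone contains the sum of the vertices of `u` contains `u`: a
  -- functional bounding `s` has constant sign on `u`, so if it were negative at a vertex it would
  -- be negative at the sum.
  set v : Fin n → ℚ := ∑ ρ ∈ hfin.toFinset, ρ.someVector with hv
  obtain ⟨s, hs, hx⟩ := T'.cover (toReal v)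
  refine ⟨s, hs, cone_le_iff.2 fun ρ hρ => (hΛ s hs _).2 fun φ hφ => ?_⟩
  have h0 := (hΛ s hs _).1 hx φ hφ
  rcases hco φ (Finset.mem_biUnion.2 ⟨s, T'.finite.mem_toFinset.2 hs, hφ⟩) u hu with h | h
  · exact h ρ hρ
  · rw [hv, map_sum] at h0
    by_contra! hneg
    exact absurd h0 (not_le.2 (Finset.sum_neg' (fun σ hσ => h σ (hfin.mem_toFinset.1 hσ))
      ⟨ρ, hfin.mem_toFinset.2 hρ, hneg⟩))

/-! ### The triangulation by orthants -/

lemma Indep.injective {ι : Type} {r : ι → RatRay n} (h : Indep r) : Function.Injective r := by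
  intro i j hij
  have hv : LinearIndependent ℚ (fun i => (r i).someVector) := h
  exact hv.injective (by simp only [hij])

/-- The basis given by independent rays. -/
def Indep.basis {r : Fin n → RatRay n} (h : Indep r) : Module.Basis (Fin n) ℚ (Fin n → ℚ) :=
  have hv : LinearIndependent ℚ (fun i => (r i).someVector) := h
  basisOfLinearIndependentOfCardEqFinrank' _ hv (by simp)

lemma Indep.basis_apply {r : Fin n → RatRay n} (h : Indep r) (i : Fin n) :
    h.basis i = (r i).someVector := by
  have hv : LinearIndependent ℚ (fun i => (r i).someVector) := h
  exact congrFun (coe_basisOfLinearIndependentOfCardEqFinrank' _ hv (by simp)) i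

/-- Both sides are linear in `x`, and the standard basis vectors are rational. -/
lemma sum_realFun_coord (b : Module.Basis (Fin n) ℚ (Fin n → ℚ)) (x : Fin n → ℝ) :
    ∑ i, realFun (b.coord i) x • toReal (b i) = x := by
  have h : ∑ i, (realFun (b.coord i)).smulRight (toReal (b i)) = LinearMap.id := by
    refine LinearMap.pi_ext' fun k => LinearMap.ext_ring ?_
    have hk : (LinearMap.single ℝ (fun _ : Fin n => ℝ) k) 1 = toReal (Pi.single k 1) := by
      ext i
      by_cases hi : i = k
      · subst hi; simp [toReal]
      · simp [toReal, hi]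
    simp only [LinearMap.comp_apply, LinearMap.sum_apply, LinearMap.smulRight_apply, hk,
      realFun_toReal, LinearMap.id_apply, ← toReal_smul, ← toReal_sum]
    congr 1
    exact b.sum_repr _
  simpa using LinearMap.congr_fun h x

lemma realFun_coord_toReal (b : Module.Basis (Fin n) ℚ (Fin n → ℚ)) (i j : Fin n) :
    realFun (b.coord i) (toReal (b j)) = if i = j then 1 else 0 := by
  rw [realFun_toReal, Module.Basis.coord_apply, Module.Basis.repr_self, Finsupp.single_apply]
  split_ifs with h1 h2 h2 <;> simp_all

lemma someVector_neg (ρ : RatRay n) :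
    ∃ d : ℚ, 0 < d ∧ (-ρ).someVector = -(d • ρ.someVector) := by
  have h0 : -ρ.someVector ≠ 0 := neg_ne_zero.2 ρ.someVector_ne_zero
  have h : SameRay ℚ (-ρ.someVector) (-ρ).someVector := by
    rw [← ray_eq_iff h0 (-ρ).someVector_ne_zero, Module.Ray.someVector_ray, ← neg_rayOfNeZero _ _ ρ.someVector_ne_zero,
      Module.Ray.someVector_ray]
  obtain ⟨c, hc, h⟩ := h.exists_pos_left h0 (-ρ).someVector_ne_zero
  exact ⟨c, hc, by rw [← h, smul_neg]⟩

lemma Indep.ne_neg {r : Fin n → RatRay n} (h : Indep r) (i j : Fin n) : r i ≠ -r j := by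
  intro hij
  by_cases hne : i = j
  · subst hne
    exact Module.Ray.ne_neg_self _ hij
  · obtain ⟨d, -, hd⟩ := someVector_neg (r j)
    have h1 := h.basis_apply i
    rw [hij, hd, ← h.basis_apply j] at h1
    have h2 := congrArg (h.basis.coord i) h1
    simp [hne] at h2

/-- The simplices of the triangulation of the sphere by the orthants of independent rays. -/
def orthantFaces (r : Fin n → RatRay n) : Set (Set (RatRay n)) :=
  {s | s ⊆ Set.range r ∪ Set.range (fun i => -r i) ∧ ∀ i, ¬(r i ∈ s ∧ -r i ∈ s)}

/-- The triangulation of the sphere by the orthants of independent rays. -/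
def orthants (r : Fin n → RatRay n) (h : Indep r) : Triangulation n :=
  Triangulation.ofNormalForm (orthantFaces r)
    (((Set.finite_range r).union (Set.finite_range _)).powerset.subset fun s hs => hs.1)
    ⟨Set.empty_subset _, fun i h => h.1⟩
    (fun s hs t hts => ⟨hts.trans hs.1, fun i hi => hs.2 i ⟨hts hi.1, hts hi.2⟩⟩)
    (by
      classical
      choose d hd hdv using fun i => someVector_neg (r i)
      -- Each coordinate is a difference of the weights of `r i` and `-r i`, the factor `d i` coming
      -- from the representative of `-r i`. Only one of the two weights can be nonzero, so the
      -- coordinate determines both.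
      have key : ∀ c : RatRay n →₀ ℝ, (c.support : Set (RatRay n)) ∈ orthantFaces r → ∀ i,
          realFun (h.basis.coord i) (comb c) = c (r i) - d i * c (-r i) := by
        intro c hc i
        have h1 : c = ∑ j, (Finsupp.single (r j) (c (r j)) + Finsupp.single (-r j) (c (-r j))) := by
          ext ρ
          simp only [Finsupp.coe_finsetSum, Finset.sum_apply, Finsupp.coe_add, Pi.add_apply,
            Finset.sum_add_distrib, Finsupp.single_apply]
          by_cases hρ : ρ ∈ Set.range r ∪ Set.range (fun i => -r i)
          · rcases hρ with ⟨k, rfl⟩ | ⟨k, rfl⟩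
            · simp [h.injective.eq_iff, (h.ne_neg k _).symm]
            · simp [h.injective.eq_iff, h.ne_neg _ k]
          · have h0 : c ρ = 0 := by
              by_contra hne
              exact hρ (hc.1 (Finsupp.mem_support_iff.2 hne))
            rw [Set.mem_union, not_or] at hρ
            rw [Finset.sum_eq_zero, Finset.sum_eq_zero, h0, add_zero]
            · exact fun j _ => if_neg fun hj => hρ.2 ⟨j, hj⟩
            · exact fun j _ => if_neg fun hj => hρ.1 ⟨j, hj⟩
        conv_lhs => rw [h1]
        have h2 : ∀ j, realFun (h.basis.coord i) (rayVec (r j)) = if i = j then 1 else 0 := by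
          intro j
          rw [rayVec, ← h.basis_apply, realFun_coord_toReal]
        have h3 : ∀ j, rayVec (-r j) = -(d j : ℝ) • rayVec (r j) := by
          intro j
          rw [rayVec, hdv, ← neg_smul, toReal_smul]; simp [rayVec]
        simp only [map_sum, map_add, comb_single, map_smul, h3, h2, smul_eq_mul]
        simp [Finset.sum_add_distrib]
        ring
      intro c c' hc hc' hcF hcF' heq
      have hz : ∀ c : RatRay n →₀ ℝ, (c.support : Set (RatRay n)) ∈ orthantFaces r → ∀ i,
          c (r i) = 0 ∨ c (-r i) = 0 := by
        intro c hc i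
        by_contra! hne
        exact hc.2 i ⟨Finsupp.mem_support_iff.2 hne.1, Finsupp.mem_support_iff.2 hne.2⟩
      have hi : ∀ i, c (r i) = c' (r i) ∧ c (-r i) = c' (-r i) := by
        intro i
        have h1 := key c hcF i
        rw [heq, key c' hcF' i] at h1
        have p1 : 0 ≤ c (r i) := hc _
        have p2 : 0 ≤ c (-r i) := hc _
        have p3 : 0 ≤ c' (r i) := hc' _
        have p4 : 0 ≤ c' (-r i) := hc' _
        have hdi : (0 : ℝ) < d i := by exact_mod_cast hd i
        have p5 := mul_nonneg hdi.le p2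
        have p6 := mul_nonneg hdi.le p4
        have h2 : c (r i) = c' (r i) := by
          rcases hz c hcF i with h | h <;> rcases hz c' hcF' i with h' | h' <;>
            simp only [h, h', mul_zero] at * <;> linarith
        refine ⟨h2, mul_left_cancel₀ hdi.ne' (by linarith)⟩
      ext ρ
      by_cases hρ : ρ ∈ Set.range r ∪ Set.range (fun i => -r i)
      · rcases hρ with ⟨k, rfl⟩ | ⟨k, rfl⟩
        · exact (hi k).1
        · exact (hi k).2
      · rw [Finsupp.notMem_support_iff.1 fun h => hρ (hcF.1 h),
          Finsupp.notMem_support_iff.1 fun h => hρ (hcF'.1 h)])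
    (by
      classical
      choose d hd hdv using fun i => someVector_neg (r i)
      intro x
      set y : Fin n → ℝ := fun i => realFun (h.basis.coord i) x with hy
      have hd' : ∀ i, (0 : ℝ) < d i := fun i => by exact_mod_cast hd i
      -- The positive part of each coordinate goes to `r j`, the negative part to `-r j`.
      let c : RatRay n →₀ ℝ := ∑ j, (Finsupp.single (r j) (max (y j) 0) +
        Finsupp.single (-r j) (max (-y j) 0 / d j))
      have h1 : ∀ i, c (r i) = max (y i) 0 := by
        intro i
        simp [c, Finsupp.single_apply, h.injective.eq_iff, (h.ne_neg i _).symm]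
      have h2 : ∀ i, c (-r i) = max (-y i) 0 / d i := by
        intro i
        simp [c, Finsupp.single_apply, h.injective.eq_iff, h.ne_neg _ i]
      refine ⟨c, ?_, ⟨?_, ?_⟩, ?_⟩
      · refine Finset.sum_nonneg fun j _ => add_nonneg (Finsupp.single_nonneg.2 (le_max_right _ _))
          (Finsupp.single_nonneg.2 (div_nonneg (le_max_right _ _) (hd' j).le))
      · intro ρ hρ
        by_contra hne
        rw [Set.mem_union, not_or] at hne
        refine Finsupp.mem_support_iff.1 hρ ?_
        simp only [c, Finsupp.coe_finsetSum, Finset.sum_apply, Finsupp.coe_add, Pi.add_apply,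
          Finsupp.single_apply]
        refine Finset.sum_eq_zero fun j _ => ?_
        rw [if_neg fun hj => hne.1 ⟨j, hj⟩, if_neg fun hj => hne.2 ⟨j, hj⟩, add_zero]
      · rintro i ⟨hi, hi'⟩
        replace hi := Finsupp.mem_support_iff.1 hi
        replace hi' := Finsupp.mem_support_iff.1 hi'
        rw [h1] at hi
        rw [h2] at hi'
        rcases le_total (y i) 0 with h0 | h0
        · exact hi (max_eq_right h0)
        · exact hi' (by rw [max_eq_right (by linarith), zero_div])
      · have h3 : ∀ j, rayVec (-r j) = -(d j : ℝ) • rayVec (r j) := by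
          intro j
          rw [rayVec, hdv, ← neg_smul, toReal_smul]; simp [rayVec]
        conv_rhs => rw [← sum_realFun_coord h.basis x]
        simp only [c, map_sum, map_add, comb_single, h3, smul_smul, ← add_smul, h.basis_apply]
        refine Finset.sum_congr rfl fun j _ => ?_
        change _ • rayVec (r j) = y j • rayVec (r j)
        congr 1
        have := (hd' j).ne'
        field_simp
        rcases le_total (y j) 0 with h0 | h0
        · rw [max_eq_right h0, max_eq_left (by linarith)]; ring
        · rw [max_eq_left h0, max_eq_right (by linarith)]; ring)

lemma orthants_isFace (r : Fin n → RatRay n) (h : Indep r) : (orthants r h).IsFace r := by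
  refine ⟨h.injective, Set.subset_union_left, ?_⟩
  rintro i ⟨-, j, hj⟩
  exact h.ne_neg j i hj

/-! ### Subdivisions of top-dimensional simplices -/

lemma Triangulation.IsFace.indep {T : Triangulation n} {k : ℕ} {r : Fin k → RatRay n}
    (h : T.IsFace r) : Indep r := by
  have h1 : LinearIndependent ℚ (fun ρ : Set.range r => (ρ : RatRay n).someVector) :=
    T.indep _ h.2
  exact h1.comp (fun i => ⟨r i, i, rfl⟩) fun i j hij => h.1 (congrArg Subtype.val hij)

lemma range_eq_of_subset {α : Type*} {k : ℕ} {r t : Fin k → α} (hr : Function.Injective r)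
    (ht : Function.Injective t) (h : Set.range r ⊆ Set.range t) : Set.range r = Set.range t := by
  refine Set.eq_of_subset_of_ncard_le h ?_ (Set.finite_range t)
  rw [Set.ncard_range_of_injective ht, Set.ncard_range_of_injective hr]

lemma Triangulation.IsFace.comp_perm {T : Triangulation n} {k : ℕ} {r : Fin k → RatRay n}
    (h : T.IsFace r) (σ : Equiv.Perm (Fin k)) : T.IsFace (r ∘ σ) :=
  ⟨h.1.comp σ.injective, by rw [σ.surjective.range_comp]; exact h.2⟩

/-- A transposition corrects a negative determinant. For `n ≤ 1` there is none, but then the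
determinant is the product of the diagonal coefficients, which are nonnegative by the inclusion of
cones. -/
lemma exists_sameOrientation {r w : Fin n → RatRay n} (hr : Indep r) (hw : Indep w)
    (hle : cone (Set.range w) ≤ cone (Set.range r)) :
    ∃ σ : Equiv.Perm (Fin n), SameOrientation r (w ∘ σ) := by
  classical
  let A : Matrix (Fin n) (Fin n) ℚ := fun i j => hr.basis.repr (w i).someVector j
  have hA : ∀ i, (w i).someVector = ∑ j, A i j • (r j).someVector := by
    intro i
    conv_lhs => rw [← hr.basis.sum_repr (w i).someVector]
    simp only [hr.basis_apply, A]
  have hdet : A.det ≠ 0 := by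
    have h1 : A = (hr.basis.toMatrix hw.basis).transpose := by
      ext i j
      simp [A, Module.Basis.toMatrix_apply, hw.basis_apply]
    rw [h1, Matrix.det_transpose, ← Module.Basis.det_apply]
    exact (hr.basis.isUnit_det hw.basis).ne_zero
  rcases lt_or_gt_of_ne hdet with hneg | hpos
  · by_cases hn : ∃ i j : Fin n, i ≠ j
    · obtain ⟨i, j, hij⟩ := hn
      refine ⟨Equiv.swap i j, A.submatrix (Equiv.swap i j) id, ?_, fun k => hA _⟩
      rw [Matrix.det_permute, Equiv.Perm.sign_swap hij]
      simpa using hneg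
    · exfalso
      push Not at hn
      have hprod : A.det = ∏ i, A i i := by
        refine Matrix.det_of_isUpperTriangular fun i j hij => ?_
        exact absurd (hn i j) hij.ne'
      rw [hprod] at hneg
      refine absurd hneg (not_lt.2 (Finset.prod_nonneg fun i _ => ?_))
      have := realFun_nonneg (φ := hr.basis.coord i) (s := Set.range r) (by
        rintro _ ⟨j, rfl⟩
        rw [← hr.basis_apply, Module.Basis.coord_apply, Module.Basis.repr_self,
          Finsupp.single_apply]
        split_ifs <;> simp) (hle (rayVec_mem_cone ⟨i, rfl⟩))
      rw [rayVec, realFun_toReal] at this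
      exact_mod_cast this
  · exact ⟨1, A, hpos, hA⟩

/-- Every top-dimensional simplex is subdivided by every triangulation. -/
lemma Triangulation.exists_isSubdivision (T : Triangulation n) {r : Fin n → RatRay n}
    (hr : Indep r) : ∃ (m : ℕ) (t : Fin m → Fin n → RatRay n), T.IsSubdivision r t := by
  classical
  -- `IsSubdivision` asks only for a list of the top simplices of `T` inside the cone, so no
  -- refinement is needed here; that they cover the cone generically is `existsUnique_mem`.
  let U : Set (Set (RatRay n)) := {u ∈ T.faces | u.ncard = n ∧ cone u ≤ cone (Set.range r)}
  have hU : U.Finite := T.finite.subset fun u hu => hu.1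
  have key : ∀ u ∈ U, ∃ w : Fin n → RatRay n, T.IsFace w ∧ Set.range w = u ∧
      SameOrientation r w := by
    rintro u ⟨hu, hcard, hle⟩
    have hfin := (T.indep u hu).finite
    have : Fintype u := hfin.fintype
    have e : Fin n ≃ u := by
      refine (Fintype.equivFinOfCardEq ?_).symm
      rw [← Nat.card_eq_fintype_card, Nat.card_coe_set_eq, hcard]
    let w : Fin n → RatRay n := fun i => e i
    have hrange : Set.range w = u := by
      ext ρ
      exact ⟨by rintro ⟨i, rfl⟩; exact (e i).2, fun h => ⟨e.symm ⟨ρ, h⟩, by simp [w]⟩⟩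
    have hw : T.IsFace w := ⟨Subtype.val_injective.comp e.injective, hrange ▸ hu⟩
    obtain ⟨σ, hσ⟩ := exists_sameOrientation hr hw.indep (by rwa [hrange])
    exact ⟨w ∘ σ, hw.comp_perm σ, by rw [σ.surjective.range_comp, hrange], hσ⟩
  choose w hwF hwr hwo using key
  have : Fintype U := hU.fintype
  let e := Fintype.equivFin U
  refine ⟨Fintype.card U, fun j => w _ (e.symm j).2, fun j => hwF _ _, fun j => ?_,
    fun j => hwo _ _, fun u hu hle => ?_⟩
  · rw [hwr]
    exact (e.symm j).2.2.2
  · have huU : Set.range u ∈ U := ⟨hu.2, by rw [Set.ncard_range_of_injective hu.1]; simp, hle⟩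
    refine ⟨e ⟨_, huU⟩, ?_, fun j hj => ?_⟩
    · simp only [hwr, Equiv.symm_apply_apply]
    · simp only [hwr] at hj
      exact (e.symm_apply_eq).1 (Subtype.ext hj)

/-! ### Classes of simplices -/

lemma Triangulation.simplexClass_eq_sum {T T' : Triangulation n} (hT : T'.Finer T)
    {r : Fin n → RatRay n} (h : T.IsFace r) {m : ℕ} {t : Fin m → Fin n → RatRay n}
    (ht : T'.IsSubdivision r t) :
    T.simplexClass r h = ∑ j, T'.simplexClass (t j) (ht.isFace j) := by
  classical
  have h1 : T.toPreChains n (T.simplex r h) =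
      ∑ j, T'.toPreChains n (T'.simplex (t j) (ht.isFace j)) := by
    rw [← sub_eq_zero]
    have h2 := (QuotientAddGroup.eq_zero_iff _).2 (AddSubgroup.subset_closure
      ⟨T, T', hT.refines, r, h, m, t, ht, rfl⟩ :
        _ ∈ refinementRelations n n)
    rw [← QuotientAddGroup.mk'_apply, map_sub, map_sum] at h2
    exact h2
  simp only [Triangulation.simplexClass, h1, map_sum]

/-- The list of pieces in a common refinement depends on `r` only, so both classes are the same sum.
-/
lemma Triangulation.simplexClass_eq (T T' : Triangulation n) {r : Fin n → RatRay n}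
    (h : T.IsFace r) (h' : T'.IsFace r) : T.simplexClass r h = T'.simplexClass r h' := by
  obtain ⟨T'', hT, hT'⟩ := T.exists_common_finer T'
  obtain ⟨m, t, ht⟩ := T''.exists_isSubdivision h.indep
  rw [simplexClass_eq_sum hT h ht, simplexClass_eq_sum hT' h' ht]

lemma Triangulation.simplexClass_eq_Δ (T : Triangulation n) {r : Fin n → RatRay n}
    (h : T.IsFace r) : T.simplexClass r h = Δ r := by
  have hex : ∃ T : Triangulation n, T.IsFace r := ⟨T, h⟩
  rw [Δ, dif_pos hex]
  exact T.simplexClass_eq _ _ _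

lemma Δ_comp_swap {r : Fin n → RatRay n} (h : Indep r) {i j : Fin n} (hij : i ≠ j) :
    Δ (r ∘ Equiv.swap i j) = -Δ r := by
  have hF := orthants_isFace r h
  rw [← (orthants r h).simplexClass_eq_Δ hF,
    ← (orthants r h).simplexClass_eq_Δ (hF.comp_perm (Equiv.swap i j))]
  have : (orthants r h).simplex _ (hF.comp_perm (Equiv.swap i j)) = -(orthants r h).simplex r hF :=
    Subtype.ext (monomial_swap r hij)
  simp only [Triangulation.simplexClass, this, map_neg]

/-- Cutting a simplex at an interior point of an edge. -/
lemma Δ_eq_add {r : Fin n → RatRay n} (h : Indep r) {i j : Fin n} (hij : i ≠ j) {m : RatRay n}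
    {p q : ℚ} (hp : 0 < p) (hq : 0 < q)
    (hm : m.someVector = p • (r i).someVector + q • (r j).someVector) :
    Δ r = Δ (Function.update r i m) + Δ (Function.update r j m) := by
  classical
  have hF := orthants_isFace r h
  set T := orthants r h with hT
  have hE : T.EdgePoint (r i) (r j) m := by
    refine ⟨h.injective.ne hij, T.down_closed _ hF.2 _ ?_, p, q, by exact_mod_cast hp,
      by exact_mod_cast hq, ?_⟩
    · exact Set.pair_subset ⟨i, rfl⟩ ⟨j, rfl⟩
    · rw [rayVec, hm, toReal_add, toReal_smul, toReal_smul]; rfl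
  have hmr : ∀ k, r k ≠ m := fun k hk => hE.notMem hF.2 ⟨k, hk⟩
  set T' := T.edgeSubdivision _ _ _ hE with hT'
  have hinj : ∀ k, Function.Injective (Function.update r k m) := by
    intro k a b hab
    by_cases ha : a = k <;> by_cases hb : b = k
    · rw [ha, hb]
    · subst ha
      rw [Function.update_self, Function.update_of_ne hb] at hab
      exact absurd hab.symm (hmr _)
    · subst hb
      rw [Function.update_self, Function.update_of_ne ha] at hab
      exact absurd hab (hmr _)
    · rw [Function.update_of_ne ha, Function.update_of_ne hb] at hab
      exact h.injective hab
  have hnot : ∀ k, r k ∉ Set.range (Function.update r k m) := by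
    rintro k ⟨l, hl⟩
    by_cases hlk : l = k
    · subst hlk
      rw [Function.update_self] at hl
      exact hmr _ hl.symm
    · rw [Function.update_of_ne hlk] at hl
      exact hlk (h.injective hl)
  have hsub : ∀ k, ∀ ρ ∈ Set.range (Function.update r k m), ρ ≠ m → ρ ∈ Set.range r := by
    rintro k _ ⟨l, rfl⟩ hne
    by_cases hlk : l = k
    · subst hlk
      simp at hne
    · rw [Function.update_of_ne hlk]
      exact ⟨l, rfl⟩
  have hface : ∀ k, k = i ∨ k = j → T'.IsFace (Function.update r k m) := by
    intro k hk
    refine ⟨hinj k, ⟨?_, fun _ => T.down_closed _ hF.2 _ ?_, fun hmn => ?_⟩⟩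
    · rintro ⟨h1, h2⟩
      rcases hk with rfl | rfl
      · exact hnot _ h1
      · exact hnot _ h2
    · rintro ρ (rfl | rfl | hρ)
      · exact ⟨i, rfl⟩
      · exact ⟨j, rfl⟩
      · exact hsub k ρ hρ.1 hρ.2
    · exact absurd ⟨k, Function.update_self _ _ _⟩ hmn
  have hmcone : rayVec m ∈ cone (Set.range r) := by
    rw [rayVec, hm, toReal_add, toReal_smul, toReal_smul]
    exact add_mem (PointedCone.smul_mem _ (by exact_mod_cast hp.le) (rayVec_mem_cone ⟨i, rfl⟩))
      (PointedCone.smul_mem _ (by exact_mod_cast hq.le) (rayVec_mem_cone ⟨j, rfl⟩))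
  have hle : ∀ k, cone (Set.range (Function.update r k m)) ≤ cone (Set.range r) := by
    intro k
    refine cone_le_iff.2 fun ρ hρ => ?_
    by_cases hρm : ρ = m
    · rw [hρm]; exact hmcone
    · exact rayVec_mem_cone (hsub k ρ hρ hρm)
  have hor : ∀ k (w : Fin n → ℚ), 0 < w k → m.someVector = ∑ l, w l • (r l).someVector →
      SameOrientation r (Function.update r k m) := by
    intro k w hw hmw
    -- The identity matrix with row `k` replaced by the coordinates of `m` has determinant `w k`.
    refine ⟨(1 : Matrix (Fin n) (Fin n) ℚ).updateRow k w, ?_, fun l => ?_⟩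
    · rw [← Matrix.cramer_transpose_apply, Matrix.transpose_one, Matrix.cramer_one]
      exact hw
    · by_cases hlk : l = k
      · subst hlk
        simp [hmw]
      · simp [Function.update_of_ne hlk, Matrix.updateRow_ne hlk, Matrix.one_apply]
  have hmw : m.someVector = ∑ l, (Pi.single i p + Pi.single j q : Fin n → ℚ) l • (r l).someVector := by
    simp [hm, add_smul, Finset.sum_add_distrib, Pi.single_apply]
  have hsd : T'.IsSubdivision r ![Function.update r i m, Function.update r j m] := by
    refine ⟨?_, ?_, ?_, ?_⟩
    · refine Fin.forall_fin_two.2 ⟨hface i (Or.inl rfl), hface j (Or.inr rfl)⟩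
    · exact Fin.forall_fin_two.2 ⟨hle i, hle j⟩
    · refine Fin.forall_fin_two.2 ⟨hor i _ ?_ hmw, hor j _ ?_ hmw⟩
      · simpa [hij] using hp
      · simpa [hij.symm] using hq
    -- The vertices of a top simplex `u` inside the cone are `m` or among the `r l`, and `u` omits
    -- `r i` or `r j`; counting vertices identifies it with one of the two pieces.
    · intro u hu hule
      have hne : Set.range (Function.update r i m) ≠ Set.range (Function.update r j m) := by
        intro he
        refine hnot j (he ▸ ⟨j, ?_⟩)
        rw [Function.update_of_ne hij.symm]
      have hur : ∀ ρ ∈ Set.range u, ρ ≠ m → ρ ∈ Set.range r := by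
        intro ρ hρ hρm
        refine T.mem_of_rayVec_mem_cone ?_ hF.2 (hule (rayVec_mem_cone hρ))
        obtain ⟨-, h1, h2⟩ := hu.2
        by_cases hmu : m ∈ Set.range u
        · exact T.down_closed _ (h1 hmu) _
            (Set.singleton_subset_iff.2 (Or.inr (Or.inr ⟨hρ, hρm⟩)))
        · exact T.down_closed _ (h2 hmu) _ (Set.singleton_subset_iff.2 hρ)
      have heq : ∀ k, r k ∉ Set.range u → Set.range u = Set.range (Function.update r k m) := by
        intro k hk
        refine range_eq_of_subset hu.1 (hinj k) fun ρ hρ => ?_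
        by_cases hρm : ρ = m
        · exact ⟨k, by rw [hρm, Function.update_self]⟩
        · obtain ⟨l, rfl⟩ := hur ρ hρ hρm
          refine ⟨l, Function.update_of_ne ?_ _ _⟩
          rintro rfl
          exact hk hρ
      rcases not_and_or.1 hu.2.1 with h0 | h0
      · refine ⟨0, (heq i h0).symm, Fin.forall_fin_two.2 ⟨fun _ => rfl, fun h1 => ?_⟩⟩
        exact absurd ((heq i h0).symm.trans h1.symm) hne
      · refine ⟨1, (heq j h0).symm, Fin.forall_fin_two.2 ⟨fun h1 => ?_, fun _ => rfl⟩⟩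
        exact absurd (h1.trans (heq j h0)) hne
  rw [← T.simplexClass_eq_Δ hF, Triangulation.simplexClass_eq_sum (T.edgeSubdivision_finer hE) hF hsd,
    Fin.sum_univ_two]
  rw [T'.simplexClass_eq_Δ, T'.simplexClass_eq_Δ]
  rfl

/-! ### Functions on bases satisfying the three-term relation -/

lemma update_smul_linearIndependent {ι V : Type*} [DecidableEq ι] [AddCommGroup V] [Module ℚ V]
    {v : ι → V} (hv : LinearIndependent ℚ v) (S : Finset ι) (a : ι → ℚ) {i : ι} (hi : i ∈ S)
    (ha : a i ≠ 0) : LinearIndependent ℚ (Function.update v i (∑ k ∈ S, a k • v k)) := by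
  refine hv.update i _ ⟨1, one_mem _, ∑ k ∈ S, Finsupp.single k (a k), ?_, ?_⟩
  · rw [Finsupp.finsetSum_apply, mem_nonZeroDivisors_iff_ne_zero]
    simpa [Finsupp.single_apply, hi] using ha
  · simp [Finsupp.linearCombination_single]

section ThreeTerm

variable {ι V N : Type*} [DecidableEq ι] [AddCommGroup V] [Module ℚ V] [AddCommGroup N]
  {D : (ι → V) → N}

/-- Rescale `v i`, apply `hadd`, and remove the factor by `hsmul`. Negative `c` is allowed; in the
application this is what working modulo wedges provides. -/
lemma eq_update_add_update_of_smul
    (hsmul : ∀ v i (c : ℚ), c ≠ 0 → D (Function.update v i (c • v i)) = D v)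
    (hadd : ∀ v i j, LinearIndependent ℚ v → i ≠ j →
      D v = D (Function.update v i (v i + v j)) + D (Function.update v j (v i + v j)))
    {v : ι → V} (hv : LinearIndependent ℚ v) {i j : ι} (hij : i ≠ j) {c : ℚ} (hc : c ≠ 0) :
    D v = D (Function.update v i (c • v i + v j)) + D (Function.update v j (c • v i + v j)) := by
  have hv1 : LinearIndependent ℚ (Function.update v i (c • v i)) := by
    simpa using update_smul_linearIndependent hv {i} (fun _ => c) (Finset.mem_singleton_self i) hc
  have h := hadd _ i j hv1 hij
  rw [hsmul v i c hc, Function.update_self, Function.update_of_ne hij.symm,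
    Function.update_idem, Function.update_comm hij] at h
  have h' := hsmul (Function.update v j (c • v i + v j)) i c hc
  rw [Function.update_of_ne hij] at h'
  rw [h'] at h
  exact h

/-- Induction on `S`. With `u` the combination over `S` and `w = a_j v_j + u`, the three-term
relation splits `D(v_i ↦ u)` into `D(v_j ↦ w, v_i ↦ u) + D(v_i ↦ w)`. By the induction hypothesis
for the tuple with `v_j ↦ w`, the first summands add up to `D(v_j ↦ w)`. -/
lemma eq_sum_update_of_support
    (hsmul : ∀ v i (c : ℚ), c ≠ 0 → D (Function.update v i (c • v i)) = D v)
    (hadd : ∀ v i j, LinearIndependent ℚ v → i ≠ j →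
      D v = D (Function.update v i (v i + v j)) + D (Function.update v j (v i + v j)))
    (S : Finset ι) (hS : S.Nonempty) :
    ∀ (v : ι → V) (a : ι → ℚ), LinearIndependent ℚ v → (∀ i ∈ S, a i ≠ 0) →
      D v = ∑ i ∈ S, D (Function.update v i (∑ k ∈ S, a k • v k)) := by
  induction hS using Finset.Nonempty.cons_induction with
  | singleton i =>
    intro v a hv ha
    rw [Finset.sum_singleton, Finset.sum_singleton, hsmul v i _ (ha i (Finset.mem_singleton_self i))]
  | cons j S hj hS ih =>
    intro v a hv ha
    have hjne : ∀ i ∈ S, j ≠ i := fun i hi h => hj (h ▸ hi)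
    have haS : ∀ i ∈ S, a i ≠ 0 := fun i hi => ha i (Finset.mem_cons_of_mem hi)
    have haj : a j ≠ 0 := ha j (Finset.mem_cons_self j S)
    set u := ∑ k ∈ S, a k • v k with hu
    set w := ∑ k ∈ Finset.cons j S hj, a k • v k with hw
    have hwu : w = a j • v j + u := by rw [hw, Finset.sum_cons]
    have hvj : LinearIndependent ℚ (Function.update v j w) :=
      update_smul_linearIndependent hv _ a (Finset.mem_cons_self j S) haj
    have h1 : ∀ i ∈ S, D (Function.update v i u) =
        D (Function.update (Function.update v j w) i u) + D (Function.update v i w) := by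
      intro i hi
      have h := eq_update_add_update_of_smul hsmul hadd
        (update_smul_linearIndependent hv S a hi (haS i hi)) (hjne i hi) haj
      rw [Function.update_self, Function.update_of_ne (hjne i hi), ← hu, ← hwu,
        Function.update_idem, Function.update_comm (hjne i hi).symm] at h
      exact h
    have hu' : ∑ k ∈ S, a k • Function.update v j w k = u :=
      Finset.sum_congr rfl fun k hk => by rw [Function.update_of_ne (hjne k hk).symm]
    have h2 := ih (Function.update v j w) a hvj haS
    rw [hu'] at h2
    rw [Finset.sum_cons, h2, ih v a hv haS, Finset.sum_congr rfl h1, Finset.sum_add_distrib]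

/-- Only indices in the support of `w` matter: for the others the modified tuple lies in the kernel
of a coordinate functional and `D` is zero on it. This is the form of the relation that matches the
boundary of a monomial. -/
lemma eq_sum_update [Fintype ι] (b : Module.Basis ι ℚ V)
    (hdep : ∀ v : ι → V, ¬LinearIndependent ℚ v → D v = 0)
    (hsmul : ∀ v i (c : ℚ), c ≠ 0 → D (Function.update v i (c • v i)) = D v)
    (hadd : ∀ v i j, LinearIndependent ℚ v → i ≠ j →
      D v = D (Function.update v i (v i + v j)) + D (Function.update v j (v i + v j)))
    {w : V} (hw : w ≠ 0) : D b = ∑ i, D (Function.update b i w) := by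
  have hsum : ∑ k ∈ (b.repr w).support, b.repr w k • b k = w := by
    conv_rhs => rw [← b.linearCombination_repr w]
    rw [Finsupp.linearCombination_apply, Finsupp.sum]
  have hne : (b.repr w).support.Nonempty := by
    rw [Finsupp.support_nonempty_iff]
    simpa using hw
  rw [eq_sum_update_of_support hsmul hadd _ hne b (b.repr w) b.linearIndependent
    fun i hi => Finsupp.mem_support_iff.1 hi, hsum]
  refine Finset.sum_subset (Finset.subset_univ _) fun i _ hi => hdep _ fun hli => ?_
  have h0 : (b.coord i) w = 0 := Finsupp.notMem_support_iff.1 hi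
  have hall : ∀ k, b.coord i (Function.update b i w k) = 0 := by
    intro k
    by_cases hk : k = i
    · subst hk; rw [Function.update_self, h0]
    · rw [Function.update_of_ne hk]
      simp [hk]
  have hspan : Submodule.span ℚ (Set.range (Function.update (⇑b) i w)) = ⊤ := by
    have hfin : Module.Finite ℚ V := Module.Finite.of_basis b
    exact hli.span_eq_top_of_card_eq_finrank' (Module.finrank_eq_card_basis b).symm
  have hker : Submodule.span ℚ (Set.range (Function.update (⇑b) i w)) ≤ LinearMap.ker (b.coord i) :=
    Submodule.span_le.2 (by rintro _ ⟨k, rfl⟩; exact hall k)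
  rw [hspan] at hker
  have := hker (x := b i) trivial
  simp at this

end ThreeTerm

/-- Inserting a symbol in front of the boundary of a monomial. -/
lemma symbol_mul_boundary_monomial {X : Type} {k : ℕ} (a : X) (x : Fin k → X) :
    symbol a * boundary X (monomial x) = ∑ i, monomial (Function.update x i a) := by
  cases k with
  | zero => simp [monomial_zero, boundary_one]
  | succ k =>
    rw [boundary_monomial, Finset.mul_sum]
    refine Finset.sum_congr rfl fun i _ => ?_
    -- Moving `a` from the front to position `i` costs exactly the sign in the boundary.
    rw [mul_smul_comm, ← monomial_insertNth]
    congr 1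
    exact Fin.insertNth_removeNth i a x

/-! ### Lines -/

lemma finrank_iSup_line_lt_iff {k : ℕ} (ℓ : Fin k → Line n) :
    Module.finrank ℚ (⨆ i, (ℓ i).submodule : Submodule ℚ (Fin n → ℚ)) < k ↔
      ¬LinearIndependent ℚ (fun i => (ℓ i).rep) := by
  have h : (⨆ i, (ℓ i).submodule : Submodule ℚ (Fin n → ℚ)) =
      Submodule.span ℚ (Set.range fun i => (ℓ i).rep) := by
    rw [Submodule.span_range_eq_iSup]
    exact iSup_congr fun i => Projectivization.submodule_eq _
  rw [h, linearIndependent_iff_card_le_finrank_span, Fintype.card_fin, not_le]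
  rfl

lemma line_rep (ρ : RatRay n) : ∃ c : ℚ, c ≠ 0 ∧ (line ρ).rep = c • ρ.someVector := by
  obtain ⟨a, ha⟩ := Projectivization.exists_smul_eq_mk_rep ℚ ρ.someVector ρ.someVector_ne_zero
  exact ⟨a, a.ne_zero, ha.symm⟩

/-! ### Chains modulo wedges -/

lemma Indep.of_smul {ι : Type} {r : ι → RatRay n} {v : ι → Fin n → ℚ}
    (hv : LinearIndependent ℚ v)
    (hr : ∀ i, ∃ c : ℚ, c ≠ 0 ∧ (r i).someVector = c • v i) : Indep r := by
  choose c hc hcr using hr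
  have h2 := hv.units_smul (fun i => Units.mk0 (c i) (hc i))
  unfold Indep
  convert! h2 using 2 with i
  exact hcr i

lemma Indep.of_eq_or_eq_neg {ι : Type} {r r' : ι → RatRay n} (h : Indep r)
    (hr : ∀ i, r' i = r i ∨ r' i = -r i) : Indep r' := by
  refine Indep.of_smul (v := fun i => (r i).someVector) h fun i => ?_
  rcases hr i with h' | h'
  · exact ⟨1, one_ne_zero, by rw [h', one_smul]⟩
  · obtain ⟨d, hd, hv⟩ := someVector_neg (r i)
    exact ⟨-d, neg_ne_zero.2 hd.ne', by rw [h', hv, neg_smul]⟩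

lemma Indep.comp_swap {r : Fin n → RatRay n} (h : Indep r) (i j : Fin n) :
    Indep (r ∘ Equiv.swap i j) := by
  have hv : LinearIndependent ℚ (fun i => (r i).someVector) := h
  exact hv.comp _ (Equiv.swap i j).injective

lemma rayOfNeZero_eq_or_eq_neg {v w : Fin n → ℚ} (hv : v ≠ 0) (hw : w ≠ 0) {c : ℚ}
    (h : v = c • w) :
    rayOfNeZero ℚ v hv = rayOfNeZero ℚ w hw ∨ rayOfNeZero ℚ v hv = -rayOfNeZero ℚ w hw := by
  rcases le_total 0 c with hc | hc
  · left
    rw [ray_eq_iff, h]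
    exact SameRay.sameRay_nonneg_smul_left w hc
  · right
    rw [neg_rayOfNeZero, ray_eq_iff, h, ← neg_smul_neg]
    exact SameRay.sameRay_nonneg_smul_left _ (neg_nonneg.2 hc)

section Wedges

variable [NeZero n]

/-- The subgroup generated by the wedge classes. -/
def wedges (n : ℕ) [NeZero n] : AddSubgroup (TopChains n) :=
  AddSubgroup.closure {x | ∃ r : Fin n → RatRay n, Indep r ∧
    x = Δ r - Δ (Function.update r 0 (-r 0))}

/-- The group of top spherical chains modulo wedges. -/
def WedgeQuotient (n : ℕ) [NeZero n] : Type := TopChains n ⧸ wedges n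

instance : AddCommGroup (WedgeQuotient n) :=
  inferInstanceAs (AddCommGroup (TopChains n ⧸ wedges n))

/-- The quotient map. -/
def WedgeQuotient.mk (n : ℕ) [NeZero n] : TopChains n →+ WedgeQuotient n :=
  QuotientAddGroup.mk' (wedges n)

lemma WedgeQuotient.mk_eq_zero {x : TopChains n} : WedgeQuotient.mk n x = 0 ↔ x ∈ wedges n :=
  QuotientAddGroup.eq_zero_iff x

/-- The class of a simplex modulo wedges. -/
def wedgeClass (r : Fin n → RatRay n) : WedgeQuotient n := WedgeQuotient.mk n (Δ r)

lemma wedgeClass_comp_swap {r : Fin n → RatRay n} (h : Indep r) {i j : Fin n} (hij : i ≠ j) :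
    wedgeClass (r ∘ Equiv.swap i j) = -wedgeClass r := by
  rw [wedgeClass, Δ_comp_swap h hij, map_neg, wedgeClass]

/-- A transposition brings index `i` to `0`, the only place where the generators of `wedges` flip a
ray; the two signs it costs cancel. -/
lemma wedgeClass_update_neg {r : Fin n → RatRay n} (h : Indep r) (i : Fin n) :
    wedgeClass (Function.update r i (-r i)) = wedgeClass r := by
  have h0 : ∀ r : Fin n → RatRay n, Indep r →
      wedgeClass (Function.update r 0 (-r 0)) = wedgeClass r := by
    intro r h
    refine Eq.symm (sub_eq_zero.1 ?_)
    rw [wedgeClass, wedgeClass, ← map_sub]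
    exact WedgeQuotient.mk_eq_zero.2 (AddSubgroup.subset_closure ⟨r, h, rfl⟩)
  by_cases hi : i = 0
  · subst hi
    exact h0 r h
  have hi' : (0 : Fin n) ≠ i := fun h => hi h.symm
  set r' := r ∘ Equiv.swap 0 i with hr'
  have hr'0 : r' 0 = r i := by simp [r']
  have hu : Function.update r i (-r i) = Function.update r' 0 (-r' 0) ∘ Equiv.swap 0 i := by
    funext k
    rw [Function.comp_apply, hr'0]
    by_cases hk : k = i
    · subst hk
      rw [Function.update_self, Equiv.swap_apply_right, Function.update_self]
    · rw [Function.update_of_ne hk, Function.update_of_ne, hr', Function.comp_apply,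
        Equiv.swap_apply_self]
      rw [Ne, Equiv.swap_apply_eq_iff, Equiv.swap_apply_left]
      exact hk
  have hI : Indep (Function.update r' 0 (-r' 0)) := by
    refine (h.comp_swap 0 i).of_eq_or_eq_neg fun k => ?_
    by_cases hk : k = 0
    · subst hk; right; rw [Function.update_self]
    · left; rw [Function.update_of_ne hk]
  rw [hu, wedgeClass_comp_swap hI hi', h0 _ (h.comp_swap 0 i), wedgeClass_comp_swap h hi', neg_neg]

lemma wedgeClass_congr {r r' : Fin n → RatRay n} (h : Indep r)
    (hr : ∀ i, r' i = r i ∨ r' i = -r i) : wedgeClass r' = wedgeClass r := by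
  classical
  have key : ∀ S : Finset (Fin n), wedgeClass (fun i => if i ∈ S then r' i else r i) =
      wedgeClass r := by
    intro S
    induction S using Finset.induction_on with
    | empty => simp
    | insert j S hj ih =>
      set f : Fin n → RatRay n := fun i => if i ∈ S then r' i else r i with hf
      have hfI : Indep f := h.of_eq_or_eq_neg fun i => by
        by_cases hi : i ∈ S
        · simpa [hf, hi] using hr i
        · simp [hf, hi]
      have hfj : f j = r j := by simp [hf, hj]
      have hu : (fun i => if i ∈ insert j S then r' i else r i) = Function.update f j (r' j) := by
        funext k
        by_cases hk : k = j
        · subst hk; simp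
        · simp [hf, hk]
      rw [hu, ← ih]
      rcases hr j with h' | h'
      · rw [h', ← hfj, Function.update_eq_self]
      · rw [h', ← hfj, wedgeClass_update_neg hfI]
  simpa using key Finset.univ

/-! ### Classes of tuples of vectors modulo wedges -/

open Classical in
/-- The class modulo wedges of the simplex spanned by independent vectors. -/
def vecClass (v : Fin n → Fin n → ℚ) : WedgeQuotient n :=
  if h : LinearIndependent ℚ v then
    wedgeClass fun i => rayOfNeZero ℚ (v i) (h.ne_zero i) else 0

lemma vecClass_of_not {v : Fin n → Fin n → ℚ} (h : ¬LinearIndependent ℚ v) : vecClass v = 0 :=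
  dif_neg h

lemma vecClass_eq {r : Fin n → RatRay n} {v : Fin n → Fin n → ℚ} (hv : LinearIndependent ℚ v)
    (hr : ∀ i, ∃ c : ℚ, c ≠ 0 ∧ (r i).someVector = c • v i) : vecClass v = wedgeClass r := by
  rw [vecClass, dif_pos hv]
  refine (wedgeClass_congr ?_ fun i => ?_).symm
  · refine Indep.of_smul hv fun i => ?_
    obtain ⟨d, hd, h⟩ := someVector_rayOfNeZero (v i) (hv.ne_zero i)
    exact ⟨d, hd.ne', h⟩
  · obtain ⟨c, hc, h⟩ := hr i
    have := rayOfNeZero_eq_or_eq_neg (r i).someVector_ne_zero (hv.ne_zero i) h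
    rwa [Module.Ray.someVector_ray] at this

lemma vecClass_smul {v v' : Fin n → Fin n → ℚ} (h : ∀ i, ∃ c : ℚ, c ≠ 0 ∧ v' i = c • v i) :
    vecClass v' = vecClass v := by
  choose c hc hcv using h
  have hv' : v' = (fun i => Units.mk0 (c i) (hc i)) • v := by
    funext i
    exact hcv i
  by_cases hv : LinearIndependent ℚ v
  · refine (vecClass_eq (r := fun i => rayOfNeZero ℚ (v i) (hv.ne_zero i)) ?_ fun i => ?_).trans
      (vecClass_eq hv fun i => ?_).symm
    · rw [hv']; exact hv.units_smul _
    · obtain ⟨d, hd, h⟩ := someVector_rayOfNeZero (v i) (hv.ne_zero i)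
      refine ⟨d / c i, div_ne_zero hd.ne' (hc i), ?_⟩
      rw [h, hcv, smul_smul, div_mul_cancel₀ _ (hc i)]
    · obtain ⟨d, hd, h⟩ := someVector_rayOfNeZero (v i) (hv.ne_zero i)
      exact ⟨d, hd.ne', h⟩
  · rw [vecClass_of_not hv, vecClass_of_not]
    intro h
    refine hv ?_
    have h2 := h.units_smul (fun i => (Units.mk0 (c i) (hc i))⁻¹)
    convert! h2 using 1
    funext i
    change v i = (Units.mk0 (c i) (hc i))⁻¹ • v' i
    rw [hcv, eq_inv_smul_iff]
    rfl

lemma vecClass_update_smul (v : Fin n → Fin n → ℚ) (i : Fin n) (c : ℚ) (hc : c ≠ 0) :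
    vecClass (Function.update v i (c • v i)) = vecClass v := by
  refine vecClass_smul fun k => ?_
  by_cases hk : k = i
  · subst hk
    exact ⟨c, hc, by rw [Function.update_self]⟩
  · exact ⟨1, one_ne_zero, by rw [Function.update_of_ne hk, one_smul]⟩

lemma vecClass_comp_swap (v : Fin n → Fin n → ℚ) {i j : Fin n} (hij : i ≠ j) :
    vecClass (v ∘ Equiv.swap i j) = -vecClass v := by
  by_cases hv : LinearIndependent ℚ v
  · have hc : ∀ i, ∃ c : ℚ, c ≠ 0 ∧ (rayOfNeZero ℚ (v i) (hv.ne_zero i)).someVector = c • v i := by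
      intro i
      obtain ⟨d, hd, h⟩ := someVector_rayOfNeZero (v i) (hv.ne_zero i)
      exact ⟨d, hd.ne', h⟩
    rw [vecClass_eq hv hc, vecClass_eq (hv.comp _ (Equiv.swap i j).injective)
      (fun k => hc (Equiv.swap i j k)), ← wedgeClass_comp_swap (Indep.of_smul hv hc) hij]
    rfl
  · rw [vecClass_of_not hv, vecClass_of_not, neg_zero]
    intro h
    refine hv ?_
    have := h.comp _ (Equiv.swap i j).injective
    convert! this using 1
    funext k
    simp

lemma vecClass_add (v : Fin n → Fin n → ℚ) (i j : Fin n) (hv : LinearIndependent ℚ v)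
    (hij : i ≠ j) : vecClass v =
      vecClass (Function.update v i (v i + v j)) + vecClass (Function.update v j (v i + v j)) := by
  set r : Fin n → RatRay n := fun i => rayOfNeZero ℚ (v i) (hv.ne_zero i) with hr
  have hd : ∀ k, ∃ c : ℚ, 0 < c ∧ (r k).someVector = c • v k := fun k =>
    someVector_rayOfNeZero (v k) (hv.ne_zero k)
  have hd' : ∀ k, ∃ c : ℚ, c ≠ 0 ∧ (r k).someVector = c • v k := fun k => by
    obtain ⟨c, hc, h⟩ := hd k
    exact ⟨c, hc.ne', h⟩
  have hsum : ∑ k ∈ {i, j}, (1 : ℚ) • v k = v i + v j := by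
    rw [Finset.sum_pair hij, one_smul, one_smul]
  have hI : ∀ k ∈ ({i, j} : Finset (Fin n)),
      LinearIndependent ℚ (Function.update v k (v i + v j)) := by
    intro k hk
    rw [← hsum]
    exact update_smul_linearIndependent hv _ (fun _ => 1) hk one_ne_zero
  have hij0 : v i + v j ≠ 0 := by
    have := (hI i (by simp)).ne_zero i
    rwa [Function.update_self] at this
  obtain ⟨d, hdpos, hdm⟩ := someVector_rayOfNeZero _ hij0
  have hcl : ∀ k ∈ ({i, j} : Finset (Fin n)), vecClass (Function.update v k (v i + v j)) =
      wedgeClass (Function.update r k (rayOfNeZero ℚ _ hij0)) := by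
    intro k hk
    refine vecClass_eq (hI k hk) fun l => ?_
    by_cases hl : l = k
    · subst hl
      rw [Function.update_self, Function.update_self]
      exact ⟨d, hdpos.ne', hdm⟩
    · rw [Function.update_of_ne hl, Function.update_of_ne hl]
      exact hd' l
  rw [vecClass_eq hv hd', hcl i (by simp), hcl j (by simp)]
  obtain ⟨p, hp, hpi⟩ := hd i
  obtain ⟨q, hq, hqj⟩ := hd j
  -- With representatives `p • v i`, `q • v j` and `d • (v i + v j)` of the three rays, the weights
  -- are `d / p` and `d / q`.
  have hedge := Δ_eq_add (Indep.of_smul hv hd') hij (m := rayOfNeZero ℚ _ hij0)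
    (div_pos hdpos hp) (div_pos hdpos hq) (by
      rw [hdm, hpi, hqj, smul_smul, smul_smul, div_mul_cancel₀ _ hp.ne', div_mul_cancel₀ _ hq.ne',
        smul_add])
  simp only [wedgeClass, ← map_add]
  rw [← hedge]

lemma vecClass_eq_sum_update {v : Fin n → Fin n → ℚ} (hv : LinearIndependent ℚ v)
    {w : Fin n → ℚ} (hw : w ≠ 0) : vecClass v = ∑ i, vecClass (Function.update v i w) := by
  have h := eq_sum_update (basisOfLinearIndependentOfCardEqFinrank' v hv (by simp))
    (D := vecClass) (fun _ => vecClass_of_not) vecClass_update_smul vecClass_add hw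
  rwa [coe_basisOfLinearIndependentOfCardEqFinrank'] at h

/-! ### From symbols back to chains modulo wedges -/

/-- The homomorphism that sends a monomial of independent lines to the class modulo wedges of a
simplex with vertices on these lines. -/
def symbolsToChains (n : ℕ) [NeZero n] : Symbols (Line n) →ₗ[ℤ] WedgeQuotient n :=
  symbolsLift (fun ℓ : Fin n → Line n => vecClass fun i => (ℓ i).rep)
    (fun ℓ i j hij h => vecClass_of_not fun hli => hij (hli.injective (by simp only [h])))
    (fun ℓ _ _ hij => vecClass_comp_swap (fun i => (ℓ i).rep) hij)

lemma symbolsToChains_monomial (ℓ : Fin n → Line n) :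
    symbolsToChains n (monomial ℓ) = vecClass fun i => (ℓ i).rep :=
  symbolsLift_monomial _ _ _ _

lemma symbolsToChains_monomial_line {r : Fin n → RatRay n} (h : Indep r) :
    symbolsToChains n (monomial fun i => line (r i)) = wedgeClass r := by
  choose c hc hcr using fun i => line_rep (r i)
  have hv : LinearIndependent ℚ (fun i => (r i).someVector) := h
  rw [symbolsToChains_monomial, vecClass_smul (v := fun i => (r i).someVector)
    fun i => ⟨c i, hc i, hcr i⟩]
  exact vecClass_eq hv fun i => ⟨1, one_ne_zero, (one_smul _ _).symm⟩

lemma symbolsToChains_monomial_of_not {k : ℕ} {ℓ : Fin k → Line n}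
    (h : ¬LinearIndependent ℚ fun i => (ℓ i).rep) : symbolsToChains n (monomial ℓ) = 0 := by
  by_cases hk : n = k
  · subst hk
    rw [symbolsToChains_monomial, vecClass_of_not h]
  · exact symbolsLift_monomial_of_ne hk _ _ _ _

/-- Only boundaries of `n + 1` lines have degree `n`. Putting one line `p` aside, such a boundary
is, up to sign, the remaining monomial minus the sum of its variants with one line replaced by `p`;
this vanishes by `vecClass_eq_sum_update` if the remaining lines are independent. If no choice of
`p` leaves independent lines, every term is zero. -/
lemma symbolsToChains_boundary (z : Symbols (Line n)) :
    symbolsToChains n (boundary (Line n) z) = 0 := by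
  induction z using symbols_induction with
  | mono k ℓ =>
    cases k with
    | zero => rw [monomial_zero, boundary_one, map_zero]
    | succ k =>
      by_cases hli : ∃ i : Fin (k + 1), n = k ∧ LinearIndependent ℚ fun j => (ℓ (i.succAbove j)).rep
      · obtain ⟨i, rfl, hi⟩ := hli
        have hins : ℓ = i.insertNth (ℓ i) (fun j => ℓ (i.succAbove j)) :=
          (Fin.insertNth_self_removeNth i ℓ).symm
        rw [hins, monomial_insertNth, map_zsmul, boundary_symbol_mul, symbol_mul_boundary_monomial,
          map_zsmul, map_sub, map_sum, symbolsToChains_monomial,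
          vecClass_eq_sum_update hi (Projectivization.rep_nonzero (ℓ i))]
        rw [sub_eq_zero.2, smul_zero]
        refine Finset.sum_congr rfl fun j _ => ?_
        rw [symbolsToChains_monomial]
        congr 1
        funext l
        by_cases hl : l = j
        · subst hl; simp
        · simp [Function.update_of_ne hl]
      · rw [boundary_monomial, map_sum]
        refine Finset.sum_eq_zero fun i _ => ?_
        rw [map_zsmul]
        by_cases hk : n = k
        · rw [symbolsToChains_monomial_of_not, smul_zero]
          exact fun h => hli ⟨i, hk, h⟩
        · rw [symbolsToChains, symbolsLift_monomial_of_ne hk, smul_zero]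
  | add x y hx hy => rw [map_add, map_add, hx, hy, add_zero]
  | neg x hx => rw [map_neg, map_neg, hx, neg_zero]

lemma symbolsToChains_mul_mul {k : ℕ} {ℓ : Fin k → Line n}
    (h : ¬LinearIndependent ℚ fun i => (ℓ i).rep) (a b : Symbols (Line n)) :
    symbolsToChains n (a * monomial ℓ * b) = 0 := by
  induction a using symbols_induction with
  | mono l x =>
    induction b using symbols_induction with
    | mono m y =>
      rw [monomial_mul, monomial_mul]
      refine symbolsToChains_monomial_of_not fun hli => h ?_
      have := hli.comp (fun i : Fin k => Fin.castAdd m (Fin.natAdd l i)) fun i j hij => by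
        simpa using hij
      convert! this using 1
      funext i
      simp
    | add x y hx hy => rw [mul_add, map_add, hx, hy, add_zero]
    | neg x hx => rw [mul_neg, map_neg, hx, neg_zero]
  | add x y hx hy => rw [add_mul, add_mul, map_add, hx, hy, add_zero]
  | neg x hx => rw [neg_mul, neg_mul, map_neg, hx, neg_zero]

lemma symbolsToChains_of_mem_osIdeal {z : Symbols (Line n)} (hz : z ∈ osIdeal n) :
    symbolsToChains n z = 0 := by
  rw [osIdeal, TwoSidedIdeal.mem_span_iff_mem_addSubgroup_closure] at hz
  induction hz using AddSubgroup.closure_induction with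
  | mem z hz =>
    obtain ⟨y, ⟨a, -, x, ⟨k, ℓ, hℓ, rfl⟩, rfl⟩, b, -, rfl⟩ := hz
    exact map_mul_boundary_mul (symbolsToChains n).toAddMonoidHom symbolsToChains_boundary ℓ
      (symbolsToChains_mul_mul ((finrank_iSup_line_lt_iff ℓ).1 hℓ)) a b
  | zero => exact map_zero _
  | add x y _ _ hx hy => rw [map_add, hx, hy, add_zero]
  | neg x _ hx => rw [map_neg, hx, neg_zero]

end Wedges

/-! ### Sums over permutations -/

/-- The permutation that sends `0` to `i` and then proceeds as `τ` on the other elements. -/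
def permCons {k : ℕ} (i : Fin (k + 1)) (τ : Equiv.Perm (Fin k)) : Equiv.Perm (Fin (k + 1)) :=
  i.cycleRange⁻¹ * Equiv.Perm.decomposeFin.symm (0, τ)

lemma permCons_zero {k : ℕ} (i : Fin (k + 1)) (τ : Equiv.Perm (Fin k)) : permCons i τ 0 = i := by
  rw [permCons, Equiv.Perm.mul_apply, Equiv.Perm.decomposeFin_symm_apply_zero]
  exact Fin.cycleRange_symm_zero i

lemma permCons_succ {k : ℕ} (i : Fin (k + 1)) (τ : Equiv.Perm (Fin k)) (j : Fin k) :
    permCons i τ j.succ = i.succAbove (τ j) := by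
  rw [permCons, Equiv.Perm.mul_apply, Equiv.Perm.decomposeFin_symm_apply_succ]
  simp only [Equiv.swap_self, Equiv.refl_apply]
  exact Fin.cycleRange_symm_succ i (τ j)

/-- The factor `(-1) ^ i` is the sign in `boundary_monomial`, so iterated boundaries turn into
signed sums over permutations. -/
lemma sign_permCons {k : ℕ} (i : Fin (k + 1)) (τ : Equiv.Perm (Fin k)) :
    (Equiv.Perm.sign (permCons i τ) : ℤ) = (-1) ^ (i : ℕ) * Equiv.Perm.sign τ := by
  rw [permCons, map_mul, map_inv, Fin.sign_cycleRange, Equiv.Perm.decomposeFin.symm_sign]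
  simp

lemma permCons_bijective (k : ℕ) : Function.Bijective
    fun x : Fin (k + 1) × Equiv.Perm (Fin k) => permCons x.1 x.2 := by
  rw [Fintype.bijective_iff_injective_and_card]
  refine ⟨?_, by simp [Fintype.card_perm, Nat.factorial_succ]⟩
  rintro ⟨i, τ⟩ ⟨j, τ'⟩ h
  simp only at h
  have h0 : i = j := by rw [← permCons_zero i τ, h, permCons_zero]
  subst h0
  congr 1
  ext l
  have := congrArg (fun σ : Equiv.Perm (Fin (k + 1)) => σ l.succ) h
  simp only [permCons_succ] at this
  rw [Fin.succAbove_right_injective this]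

lemma sum_perm_succ {k : ℕ} {M : Type*} [AddCommMonoid M] (f : Equiv.Perm (Fin (k + 1)) → M) :
    ∑ σ, f σ = ∑ i, ∑ τ, f (permCons i τ) := by
  rw [← Fintype.sum_prod_type']
  exact (Fintype.sum_bijective _ (permCons_bijective k) _ _ fun _ => rfl).symm

/-! ### Signs of small perturbations -/

-- The exponents `k.rev` decrease with `k`, so the last nonzero coefficient carries the lowest power
-- of `δ` and decides the sign.
open Filter Topology in
lemma eventually_sign_sum {n : ℕ} (a : Fin n → ℚ) (κ : Fin n) (hκ : a κ ≠ 0)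
    (hlt : ∀ k, κ < k → a k = 0) : ∀ᶠ δ in 𝓝[>] (0 : ℚ),
      (0 < a κ → 0 < ∑ k, a k * δ ^ (k.rev : ℕ)) ∧ (a κ < 0 → ∑ k, a k * δ ^ (k.rev : ℕ) < 0) := by
  set g : ℚ → ℚ := fun δ => ∑ k, a k * δ ^ ((k.rev : ℕ) - (κ.rev : ℕ)) with hg
  have hgc : Continuous g := by fun_prop
  have hg0 : g 0 = a κ := by
    rw [hg]
    simp only
    rw [Finset.sum_eq_single κ]
    · simp
    · intro k _ hk
      rcases lt_or_gt_of_ne hk with h | h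
      · rw [zero_pow, mul_zero]
        have := Fin.rev_lt_rev.2 h
        exact (Nat.sub_pos_of_lt this).ne'
      · rw [hlt k h, zero_mul]
    · simp
  have hfac : ∀ δ : ℚ, ∑ k, a k * δ ^ (k.rev : ℕ) = δ ^ (κ.rev : ℕ) * g δ := by
    intro δ
    rw [hg]
    simp only
    rw [Finset.mul_sum]
    refine Finset.sum_congr rfl fun k _ => ?_
    by_cases h : κ < k
    · rw [hlt k h]; ring
    · have h' : (κ.rev : ℕ) ≤ k.rev := Fin.rev_le_rev.2 (not_lt.1 h)
      rw [mul_left_comm, ← pow_add, Nat.add_sub_cancel' h']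
  have ht : Tendsto g (𝓝[>] 0) (𝓝 (a κ)) := hg0 ▸ (hgc.tendsto 0).mono_left nhdsWithin_le_nhds
  have hpos : ∀ᶠ δ in 𝓝[>] (0 : ℚ), 0 < δ := self_mem_nhdsWithin
  rcases lt_or_gt_of_ne hκ with h | h
  · filter_upwards [ht.eventually_lt_const h, hpos] with δ h1 h2
    refine ⟨fun h3 => absurd h (not_lt.2 h3.le), fun _ => ?_⟩
    rw [hfac]
    exact mul_neg_of_pos_of_neg (pow_pos h2 _) h1
  · filter_upwards [ht.eventually_const_lt h, hpos] with δ h1 h2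
    refine ⟨fun _ => ?_, fun h3 => absurd h (not_lt.2 h3.le)⟩
    rw [hfac]
    exact mul_pos (pow_pos h2 _) h1

lemma exists_last_ne_zero {n : ℕ} (a : Fin n → ℚ) (ha : a ≠ 0) :
    ∃ κ, a κ ≠ 0 ∧ ∀ k, κ < k → a k = 0 := by
  classical
  obtain ⟨i, hi⟩ := Function.ne_iff.1 ha
  have hne : (Finset.univ.filter fun k => a k ≠ 0).Nonempty := ⟨i, by simpa using hi⟩
  refine ⟨Finset.max' _ hne, (Finset.mem_filter.1 (Finset.max'_mem _ hne)).2, fun k hk => ?_⟩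
  by_contra h
  exact absurd (Finset.le_max' _ k (by simpa using h)) (not_le.2 hk)

/-- The perturbation with signs `ε` of the first basis vector of a flag. -/
def perturb {n : ℕ} (ε : Fin n → ℤˣ) (δ : ℚ) (k : Fin n) : ℚ := ((ε k : ℤ) : ℚ) * δ ^ (k.rev : ℕ)

open Filter Topology in
lemma eventually_ne_zero_of_ne_zero {n : ℕ} (a : Fin n → ℚ) (ha : a ≠ 0) (ε : Fin n → ℤˣ) :
    ∀ᶠ δ in 𝓝[>] (0 : ℚ), ∑ k, a k * perturb ε δ k ≠ 0 := by
  obtain ⟨κ, h1, h2⟩ := exists_last_ne_zero a ha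
  have hε : ∀ k, ((ε k : ℤ) : ℚ) ≠ 0 := fun k => by exact_mod_cast (ε k).ne_zero
  filter_upwards [eventually_sign_sum (fun k => a k * ((ε k : ℤ) : ℚ)) κ (mul_ne_zero h1 (hε κ))
    fun k hk => by simp only [h2 k hk, zero_mul]] with δ hδ
  simp only [perturb, ← mul_assoc]
  rcases lt_or_gt_of_ne (mul_ne_zero h1 (hε κ)) with h | h
  · exact (hδ.2 h).ne
  · exact (hδ.1 h).ne'

open Filter Topology in
lemma eventually_nonneg_iff {n : ℕ} (a : Fin n → ℚ) (κ : Fin n) (hκ : a κ ≠ 0)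
    (hlt : ∀ k, κ < k → a k = 0) (ε : Fin n → ℤˣ) : ∀ᶠ δ in 𝓝[>] (0 : ℚ),
      (0 ≤ ∑ k, a k * perturb ε δ k ↔ ε κ = if 0 < a κ then 1 else -1) := by
  have hε : ∀ k, ((ε k : ℤ) : ℚ) ≠ 0 := fun k => by exact_mod_cast (ε k).ne_zero
  filter_upwards [eventually_sign_sum (fun k => a k * ((ε k : ℤ) : ℚ)) κ (mul_ne_zero hκ (hε κ))
    fun k hk => by simp only [hlt k hk, zero_mul]] with δ hδ
  simp only [perturb, ← mul_assoc]
  rcases Int.units_eq_one_or (ε κ) with h1 | h1 <;> simp only [h1] at hδ ⊢ <;>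
    rcases lt_or_gt_of_ne hκ with h | h
  · rw [if_neg (not_lt.2 h.le)]
    have := hδ.2 (by simpa using h)
    exact ⟨fun h' => absurd h' (not_le.2 this), fun h' => by simp at h'⟩
  · rw [if_pos h]
    have := hδ.1 (by simpa using h)
    exact ⟨fun _ => rfl, fun _ => this.le⟩
  · rw [if_neg (not_lt.2 h.le)]
    have := hδ.1 (by simpa using h)
    exact ⟨fun _ => rfl, fun _ => this.le⟩
  · rw [if_pos h]
    have := hδ.2 (by simpa using h)
    exact ⟨fun h' => absurd h' (not_le.2 this), fun h' => by simp at h'⟩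

open Filter Topology in
open Classical in
/-- The signed count of the perturbations of a flag that lie in a simplicial cone. -/
lemma eventually_sum_signs {n : ℕ} (L : Matrix (Fin n) (Fin n) ℚ) (hL : L.det ≠ 0) :
    ∀ᶠ δ in 𝓝[>] (0 : ℚ),
      (∑ σ : Equiv.Perm (Fin n), if ∀ i k, i < k → L (σ i) k = 0 then
          (Equiv.Perm.sign σ : ℤ) else 0) =
        (SignType.sign L.det : ℤ) * ∑ ε : Fin n → ℤˣ, (∏ k, (ε k : ℤ)) *
          if ∀ i, 0 ≤ ∑ k, L i k * perturb ε δ k then 1 else 0 := by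
  have hrow : ∀ i, L i ≠ 0 := fun i hi => hL (Matrix.det_eq_zero_of_row_eq_zero i (congrFun hi))
  choose κ hκ hκ' using fun i => exists_last_ne_zero (L i) (hrow i)
  set s : Fin n → ℤˣ := fun i => if 0 < L i (κ i) then 1 else -1 with hs
  -- For small `δ` the inequality of row `i` constrains a single sign, the one at the last nonzero
  -- entry `κ i`.
  have hev : ∀ᶠ δ in 𝓝[>] (0 : ℚ), ∀ ε : Fin n → ℤˣ, ∀ i,
      (0 ≤ ∑ k, L i k * perturb ε δ k ↔ ε (κ i) = s i) :=
    eventually_all.2 fun ε => eventually_all.2 fun i =>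
      eventually_nonneg_iff (L i) (κ i) (hκ i) (hκ' i) ε
  have htri : ∀ σ : Equiv.Perm (Fin n), (∀ i k, i < k → L (σ i) k = 0) →
      L.det = Equiv.Perm.sign σ * ∏ i, L (σ i) i := by
    intro σ hσ
    have h1 : (L.submatrix σ id).det = ∏ i, L (σ i) i :=
      Matrix.det_of_isLowerTriangular _ fun i j hij => hσ i j hij
    rw [Matrix.det_permute] at h1
    rw [← h1, ← mul_assoc, ← Int.cast_mul, ← Units.val_mul, Int.units_mul_self]
    simp
  have hcond : ∀ σ : Equiv.Perm (Fin n), (∀ i k, i < k → L (σ i) k = 0) ↔ ∀ i, κ (σ i) = i := by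
    intro σ
    constructor
    · intro hσ i
      have hdiag : L (σ i) i ≠ 0 := by
        have := htri σ hσ
        rw [this] at hL
        exact Finset.prod_ne_zero_iff.1 (right_ne_zero_of_mul hL) i (Finset.mem_univ i)
      refine le_antisymm (not_lt.1 fun h => hκ (σ i) (hσ _ _ h)) (not_lt.1 fun h => ?_)
      exact hdiag (hκ' _ _ h)
    · intro hσ i k hik
      exact hκ' _ _ (by rwa [hσ])
  filter_upwards [hev] with δ hδ
  simp only [hδ, hcond]
  -- If `κ` is bijective, exactly one `ε` meets all constraints and exactly one `σ` makes the matrix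
  -- triangular; the signs match because the determinant is `sign σ` times the product of the
  -- diagonal.
  by_cases hex : ∃ σ : Equiv.Perm (Fin n), ∀ i, κ (σ i) = i
  · obtain ⟨σ, hσ⟩ := hex
    have hκσ : ∀ i, κ i = σ.symm i := fun i => by
      conv_lhs => rw [← σ.apply_symm_apply i]
      exact hσ _
    rw [Finset.sum_eq_single σ, if_pos hσ, Finset.sum_eq_single (fun k => s (σ k))]
    · rw [if_pos (fun i => by simp only [hκσ, σ.apply_symm_apply]), mul_one]
      have h1 : ((SignType.sign L.det : SignType) : ℤ) =
          Equiv.Perm.sign σ * ∏ i, ((s (σ i) : ℤˣ) : ℤ) := by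
        have hsign : ∀ i, ((SignType.sign (L (σ i) i) : SignType) : ℤ) = (s (σ i) : ℤˣ) := by
          intro i
          simp only [hs, hσ]
          have := hκ (σ i)
          rw [hσ] at this
          rcases lt_or_gt_of_ne this with h | h
          · rw [if_neg (not_lt.2 h.le), sign_neg h]; simp
          · rw [if_pos h, sign_pos h]; simp
        rw [htri σ ((hcond σ).2 hσ), sign_mul, SignType.coe_mul]
        congr 1
        · rcases Int.units_eq_one_or (Equiv.Perm.sign σ) with h | h <;> rw [h] <;> simp
        · rw [← Finset.prod_congr rfl fun i _ => hsign i]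
          have : SignType.sign (∏ i, L (σ i) i) = ∏ i, SignType.sign (L (σ i) i) :=
            map_prod signHom _ _
          rw [this]
          exact map_prod (SignType.castHom : SignType →*₀ ℤ) _ _
      rw [h1, mul_assoc, ← Finset.prod_mul_distrib]
      have : ∀ i, ((s (σ i) : ℤˣ) : ℤ) * (s (σ i) : ℤˣ) = 1 := fun i => by
        rw [← Units.val_mul, Int.units_mul_self]; rfl
      simp [this]
    · intro ε _ hne
      rw [if_neg, mul_zero]
      intro h
      refine hne (funext fun k => ?_)
      rw [← h (σ k), hσ]
    · simp
    · intro τ _ hne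
      rw [if_neg]
      intro h
      refine hne (Equiv.ext fun i => ?_)
      have := hκσ (τ i)
      rw [h] at this
      exact ((Equiv.eq_symm_apply σ).1 this).symm
    · simp
  · rw [Finset.sum_eq_zero fun σ _ => if_neg fun h => hex ⟨σ, h⟩]
    symm
    rw [mul_eq_zero]
    right
    -- Otherwise some `ε k₀` is unconstrained, and flipping it cancels the sum.
    have hnb : ¬Function.Surjective κ := fun h => by
      have hb : Function.Bijective κ := ⟨Finite.injective_iff_surjective.2 h, h⟩
      exact hex ⟨(Equiv.ofBijective κ hb).symm, (Equiv.ofBijective κ hb).apply_symm_apply⟩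
    obtain ⟨k₀, hk₀⟩ := not_forall.1 hnb
    refine Finset.sum_involution (fun ε _ => Function.update ε k₀ (-ε k₀)) ?_ ?_
      (fun _ _ => Finset.mem_univ _) ?_
    · intro ε _
      have h1 : ∀ i, Function.update ε k₀ (-ε k₀) (κ i) = ε (κ i) := fun i =>
        Function.update_of_ne (fun h => hk₀ ⟨i, h⟩) _ _
      simp only [h1]
      rw [← add_mul]
      have h2 : ∏ k, ((Function.update ε k₀ (-ε k₀) k : ℤˣ) : ℤ) = -∏ k, (ε k : ℤ) := by
        rw [← Finset.mul_prod_erase _ _ (Finset.mem_univ k₀),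
          ← Finset.mul_prod_erase (a := k₀) _ (fun k => (ε k : ℤ)) (Finset.mem_univ k₀),
          Function.update_self, Units.val_neg, neg_mul]
        congr 2
        refine Finset.prod_congr rfl fun k hk => ?_
        rw [Function.update_of_ne (Finset.ne_of_mem_erase hk)]
      rw [h2, add_neg_cancel, zero_mul]
    · intro ε _ _ h
      have := congrFun h k₀
      rw [Function.update_self] at this
      exact absurd this (by rcases Int.units_eq_one_or (ε k₀) with h | h <;> rw [h] <;> decide)
    · intro ε _
      simp

/-! ### Flags -/

/-- The descending flag of subspaces spanned by the final segments of a tuple of vectors. -/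
def flag {k : ℕ} (v : Fin k → Fin n → ℚ) (j : Fin k) : Submodule ℚ (Fin n → ℚ) :=
  Submodule.span ℚ (v '' Set.Ici j)

lemma flag_zero {k : ℕ} (v : Fin (k + 1) → Fin n → ℚ) :
    flag v 0 = Submodule.span ℚ (Set.range v) := by
  rw [flag, ← Set.image_univ]
  congr 2
  ext i
  simp

lemma flag_succ {k : ℕ} (v : Fin (k + 1) → Fin n → ℚ) (j : Fin k) :
    flag v j.succ = flag (fun i => v i.succ) j := by
  rw [flag, flag]
  congr 1
  ext x
  constructor
  · rintro ⟨i, hi, rfl⟩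
    have hi' : j.succ ≤ i := hi
    obtain ⟨i, rfl⟩ := Fin.exists_succ_eq.2 ((Fin.succ_pos j).trans_le hi').ne'
    exact ⟨i, Fin.succ_le_succ_iff.1 hi', rfl⟩
  · rintro ⟨i, hi, rfl⟩
    exact ⟨i.succ, Fin.succ_le_succ_iff.2 hi, rfl⟩

lemma flag_permCons_zero {k : ℕ} (v : Fin (k + 1) → Fin n → ℚ) (i : Fin (k + 1))
    (τ : Equiv.Perm (Fin k)) :
    flag (v ∘ permCons i τ) 0 = Submodule.span ℚ (Set.range v) := by
  rw [flag_zero, (permCons i τ).surjective.range_comp]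

lemma flag_permCons_succ {k : ℕ} (v : Fin (k + 1) → Fin n → ℚ) (i : Fin (k + 1))
    (τ : Equiv.Perm (Fin k)) (j : Fin k) :
    flag (v ∘ permCons i τ) j.succ = flag ((v ∘ i.succAbove) ∘ τ) j := by
  rw [flag_succ]
  simp only [Function.comp_apply, permCons_succ]
  rfl

/-- Two bases span the same flag if and only if the matrix between them is triangular. -/
lemma flag_comp_perm_eq_iff (b e : Module.Basis (Fin n) ℚ (Fin n → ℚ)) (σ : Equiv.Perm (Fin n)) :
    flag (b ∘ σ) = flag e ↔ ∀ i k, i < k → b.toMatrix e (σ i) k = 0 := by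
  have himage : ∀ k, flag (b ∘ σ) k = Submodule.span ℚ (b '' (σ '' Set.Ici k)) := fun k => by
    rw [flag, Set.image_comp]
  have hmem : ∀ k m, m ∈ flag (b ∘ σ) k ↔ ∀ i, i < k → b.repr m (σ i) = 0 := by
    intro k m
    rw [himage, Module.Basis.mem_span_image]
    constructor
    · intro h i hik
      by_contra hne
      obtain ⟨j, hj, hji⟩ := h (Finsupp.mem_support_iff.2 hne)
      rw [σ.injective hji] at hj
      exact absurd hik (not_lt.2 hj)
    · intro h i hi
      refine ⟨σ.symm i, ?_, σ.apply_symm_apply i⟩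
      by_contra hne
      refine Finsupp.mem_support_iff.1 hi ?_
      have := h (σ.symm i) (not_le.1 hne)
      rwa [σ.apply_symm_apply] at this
  have hrank : ∀ (v : Fin n → Fin n → ℚ), LinearIndependent ℚ v → ∀ k,
      Module.finrank ℚ (flag v k) = Fintype.card (Set.Ici k) := by
    intro v hv k
    rw [flag, Set.image_eq_range]
    exact finrank_span_eq_card (hv.comp _ Subtype.val_injective)
  simp only [Module.Basis.toMatrix_apply]
  constructor
  · intro h i k hik
    have hk : e k ∈ flag (b ∘ σ) k := by
      rw [h]
      exact Submodule.subset_span ⟨k, le_refl k, rfl⟩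
    exact (hmem k _).1 hk i hik
  · intro h
    funext k
    symm
    refine Submodule.eq_of_le_of_finrank_eq (Submodule.span_le.2 ?_) ?_
    · rintro _ ⟨j, hj, rfl⟩
      exact (hmem k _).2 fun i hik => h i j (lt_of_lt_of_le hik hj)
    · rw [hrank _ e.linearIndependent, hrank _ (b.linearIndependent.comp _ σ.injective)]

/-! ### Relations in the Orlik-Solomon algebra -/

lemma OS.mk_eq_zero {z : Symbols (Line n)} : OS.mk n z = 0 ↔ z ∈ osIdeal n := by
  rw [← map_zero (OS.mk n)]
  refine (RingCon.eq _).trans ?_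
  rw [TwoSidedIdeal.rel_iff, sub_zero]

lemma OS.mk_boundary_monomial {k : ℕ} {ℓ : Fin k → Line n}
    (h : ¬LinearIndependent ℚ fun i => (ℓ i).rep) :
    OS.mk n (boundary (Line n) (monomial ℓ)) = 0 :=
  OS.mk_eq_zero.2 (TwoSidedIdeal.subset_span ⟨k, ℓ, (finrank_iSup_line_lt_iff ℓ).2 h, rfl⟩)

lemma OS.mk_monomial_of_not {k : ℕ} {ℓ : Fin k → Line n}
    (h : ¬LinearIndependent ℚ fun i => (ℓ i).rep) : OS.mk n (monomial ℓ) = 0 := by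
  cases k with
  | zero => exact absurd linearIndependent_empty_type h
  | succ k => rw [monomial_eq_symbol_mul_boundary, map_mul, OS.mk_boundary_monomial h, mul_zero]

/-- A monomial is multiplied by its boundary and a line in the span. -/
lemma OS.mk_monomial_eq {k : ℕ} (ℓ : Fin k → Line n) (p : Line n)
    (h : p.rep ∈ Submodule.span ℚ (Set.range fun i => (ℓ i).rep)) :
    OS.mk n (monomial ℓ) = OS.mk n (symbol p) * OS.mk n (boundary (Line n) (monomial ℓ)) := by
  -- Adding `p` makes the family dependent, so `∂ ([p] ∧ ℓ) = ℓ - [p] ∧ ∂ ℓ` lies in the ideal.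
  have h1 : ¬LinearIndependent ℚ fun i => ((Fin.cons p ℓ : Fin (k + 1) → Line n) i).rep := by
    intro hli
    have h2 : (fun i => ((Fin.cons p ℓ : Fin (k + 1) → Line n) i).rep) =
        Fin.cons p.rep fun i => (ℓ i).rep := by
      funext i
      refine Fin.cases ?_ (fun i => ?_) i <;> simp
    rw [h2, linearIndependent_finCons] at hli
    exact hli.2 h
  have h3 := OS.mk_boundary_monomial h1
  rw [monomial_cons, boundary_symbol_mul, map_sub, map_mul, sub_eq_zero] at h3
  exact h3

/-- A line in a given subspace (an arbitrary line if the subspace is trivial). -/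
def lineIn (ℓ₀ : Line n) (W : Submodule ℚ (Fin n → ℚ)) : Line n :=
  open Classical in if h : ∃ p : Line n, p.rep ∈ W then h.choose else ℓ₀

lemma lineIn_mem (ℓ₀ : Line n) {W : Submodule ℚ (Fin n → ℚ)} {v : Fin n → ℚ} (hv : v ≠ 0)
    (hW : v ∈ W) : (lineIn ℓ₀ W).rep ∈ W := by
  have h : ∃ p : Line n, p.rep ∈ W := by
    refine ⟨Projectivization.mk ℚ v hv, ?_⟩
    obtain ⟨a, ha⟩ := Projectivization.exists_smul_eq_mk_rep ℚ v hv
    rw [← ha]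
    exact W.smul_mem _ hW
  rw [lineIn, dif_pos h]
  exact h.choose_spec

/-- The monomial attached to a flag. -/
def flagMonomial (ℓ₀ : Line n) {k : ℕ} (F : Fin k → Submodule ℚ (Fin n → ℚ)) : OS n :=
  OS.mk n (monomial fun j => lineIn ℓ₀ (F j))

lemma span_range_rep {k : ℕ} (v : Fin k → Fin n → ℚ) (hv : ∀ i, v i ≠ 0) :
    Submodule.span ℚ (Set.range fun i => (Projectivization.mk ℚ (v i) (hv i)).rep) =
      Submodule.span ℚ (Set.range v) := by
  rw [Submodule.span_range_eq_iSup, Submodule.span_range_eq_iSup]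
  refine iSup_congr fun i => ?_
  rw [← Projectivization.submodule_eq, Projectivization.submodule_mk]

/-- Monomials of lines expressed through flags. -/
lemma OS.mk_monomial_eq_sum_flag (ℓ₀ : Line n) {k : ℕ} (v : Fin k → Fin n → ℚ)
    (hv : ∀ i, v i ≠ 0) :
    OS.mk n (monomial fun i => Projectivization.mk ℚ (v i) (hv i)) =
      ∑ σ : Equiv.Perm (Fin k), (Equiv.Perm.sign σ : ℤ) • flagMonomial ℓ₀ (flag (v ∘ σ)) := by
  induction k with
  | zero => simp [flagMonomial, monomial_zero]
  | succ k ih =>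
    -- The span of `v` is the top member of every `flag (v ∘ σ)`, so this choice of `p` depends only
    -- on the flag.
    set p := lineIn ℓ₀ (Submodule.span ℚ (Set.range v)) with hp
    have hmem : p.rep ∈ Submodule.span ℚ (Set.range v) :=
      lineIn_mem ℓ₀ (hv 0) (Submodule.subset_span ⟨0, rfl⟩)
    rw [OS.mk_monomial_eq _ p (by rwa [span_range_rep]), boundary_monomial, map_sum,
      Finset.mul_sum, sum_perm_succ]
    refine Finset.sum_congr rfl fun i _ => ?_
    have h := ih (v ∘ i.succAbove) fun j => hv _
    rw [map_zsmul, mul_smul_comm]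
    change _ • (_ * OS.mk n (monomial fun j => Projectivization.mk ℚ ((v ∘ i.succAbove) j) (hv _))) = _
    rw [h, Finset.mul_sum, Finset.smul_sum]
    refine Finset.sum_congr rfl fun τ _ => ?_
    rw [sign_permCons, mul_smul, mul_smul_comm]
    congr 2
    rw [flagMonomial, flagMonomial, ← map_mul, ← monomial_cons]
    congr 2
    funext j
    refine Fin.cases ?_ (fun j => ?_) j
    · rw [flag_permCons_zero, Fin.cons_zero]
    · rw [flag_permCons_succ, Fin.cons_succ]

/-! ### Additivity of the Steinberg symbol -/

open Filter Topology in
open Classical in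
/-- A linear relation between the indicator functions of oriented simplicial cones away from
finitely many hyperplanes is a relation between the corresponding monomials of lines. -/
theorem OS.sum_monomial_eq_zero [NeZero n] {A : Type*} [Fintype A] (c : A → ℤ)
    (b : A → Module.Basis (Fin n) ℚ (Fin n → ℚ)) (B : Module.Basis (Fin n) ℚ (Fin n → ℚ))
    (Z : Finset ((Fin n → ℚ) →ₗ[ℚ] ℚ)) (hZ : ∀ φ ∈ Z, φ ≠ 0)
    (h : ∀ x, (∀ φ ∈ Z, φ x ≠ 0) →
      ∑ a, c a * ((SignType.sign (B.toMatrix (b a)).det : ℤ) *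
        if ∀ i, 0 ≤ (b a).repr x i then 1 else 0) = 0) :
    ∑ a, c a • OS.mk n (monomial fun i => Projectivization.mk ℚ (b a i) ((b a).ne_zero i)) = 0 := by
  let ℓ₀ : Line n := Projectivization.mk ℚ (B 0) (B.ne_zero 0)
  -- The total coefficient of the flag of `e` vanishes: evaluate the relation `h` at the points `x ε
  -- δ` for one small `δ`, where they avoid the hyperplanes of `Z`, and sum with weights `∏ ε_k`.
  have key : ∀ e : Module.Basis (Fin n) ℚ (Fin n → ℚ),
      ∑ a, c a * ∑ σ : Equiv.Perm (Fin n),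
        (if flag (b a ∘ σ) = flag e then (Equiv.Perm.sign σ : ℤ) else 0) = 0 := by
    intro e
    have hdet : ∀ b' : Module.Basis (Fin n) ℚ (Fin n → ℚ), (b'.toMatrix e).det ≠ 0 := by
      intro b'
      rw [← Module.Basis.det_apply]
      exact (b'.isUnit_det e).ne_zero
    have hdet' : ∀ a, (B.toMatrix (b a)).det ≠ 0 := by
      intro a
      rw [← Module.Basis.det_apply]
      exact (B.isUnit_det _).ne_zero
    have hsq : ∀ q : ℚ, q ≠ 0 → (SignType.sign q : ℤ) * (SignType.sign q : ℤ) = 1 := by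
      intro q hq
      rcases lt_or_gt_of_ne hq with h | h
      · rw [sign_neg h]; simp
      · rw [sign_pos h]; simp
    have hsign : ∀ a, (SignType.sign ((b a).toMatrix e).det : ℤ) =
        (SignType.sign (B.toMatrix e).det : ℤ) * (SignType.sign (B.toMatrix (b a)).det : ℤ) := by
      intro a
      have : (B.toMatrix e).det = (B.toMatrix (b a)).det * ((b a).toMatrix e).det := by
        rw [← Matrix.det_mul, Module.Basis.toMatrix_mul_toMatrix]
      rw [this, sign_mul, SignType.coe_mul, mul_right_comm, hsq _ (hdet' a), one_mul]
    let x : (Fin n → ℤˣ) → ℚ → (Fin n → ℚ) := fun ε δ => ∑ k, perturb ε δ k • e k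
    have hx : ∀ (φ : (Fin n → ℚ) →ₗ[ℚ] ℚ) ε δ, φ (x ε δ) = ∑ k, φ (e k) * perturb ε δ k := by
      intro φ ε δ
      simp only [x, map_sum, map_smul, smul_eq_mul, mul_comm]
    have hev1 : ∀ᶠ δ in 𝓝[>] (0 : ℚ), ∀ ε, ∀ φ ∈ Z, φ (x ε δ) ≠ 0 := by
      refine eventually_all.2 fun ε => (eventually_all_finset Z).2 fun φ hφ => ?_
      simp only [hx]
      refine eventually_ne_zero_of_ne_zero (fun k => φ (e k)) (fun h0 => hZ φ hφ ?_) ε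
      exact e.ext fun k => congrFun h0 k
    have hev2 := eventually_all.2 fun a => eventually_sum_signs ((b a).toMatrix e) (hdet (b a))
    obtain ⟨δ, h1, h2⟩ := (hev1.and hev2).exists
    have hrepr : ∀ a ε i, ∑ k, (b a).toMatrix e i k * perturb ε δ k = (b a).repr (x ε δ) i := by
      intro a ε i
      have := hx ((b a).coord i) ε δ
      rw [Module.Basis.coord_apply] at this
      rw [this]
      rfl
    simp only [flag_comp_perm_eq_iff, h2, hrepr, hsign]
    have h3 : ∀ a, c a * ((SignType.sign (B.toMatrix e).det : ℤ) *
        (SignType.sign (B.toMatrix (b a)).det : ℤ) * ∑ ε : Fin n → ℤˣ, (∏ k, (ε k : ℤ)) *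
          if ∀ i, 0 ≤ (b a).repr (x ε δ) i then 1 else 0) =
        ∑ ε : Fin n → ℤˣ, ((SignType.sign (B.toMatrix e).det : ℤ) * ∏ k, (ε k : ℤ)) *
          (c a * ((SignType.sign (B.toMatrix (b a)).det : ℤ) *
            if ∀ i, 0 ≤ (b a).repr (x ε δ) i then 1 else 0)) := by
      intro a
      rw [Finset.mul_sum, Finset.mul_sum]
      refine Finset.sum_congr rfl fun ε _ => ?_
      ring
    simp only [h3]
    rw [Finset.sum_comm]
    refine Finset.sum_eq_zero fun ε _ => ?_
    rw [← Finset.mul_sum, h _ (h1 ε), mul_zero]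
  simp only [OS.mk_monomial_eq_sum_flag ℓ₀, Finset.smul_sum, smul_smul]
  rw [← Fintype.sum_prod_type' fun a (σ : Equiv.Perm (Fin n)) =>
    (c a * (Equiv.Perm.sign σ : ℤ)) • flagMonomial ℓ₀ (flag (b a ∘ σ))]
  rw [← Finset.sum_fiberwise_of_maps_to (s := Finset.univ)
    (t := Finset.univ.image fun y : A × Equiv.Perm (Fin n) => flag (b y.1 ∘ y.2))
    (g := fun y : A × Equiv.Perm (Fin n) => flag (b y.1 ∘ y.2))
    fun y _ => Finset.mem_image_of_mem _ (Finset.mem_univ y)]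
  refine Finset.sum_eq_zero fun F hF => ?_
  obtain ⟨⟨a₀, σ₀⟩, -, rfl⟩ := Finset.mem_image.1 hF
  rw [Finset.sum_congr rfl (g := fun y : A × Equiv.Perm (Fin n) =>
    (c y.1 * (Equiv.Perm.sign y.2 : ℤ)) • flagMonomial ℓ₀ (flag (b a₀ ∘ σ₀)))
    fun y hy => by rw [(Finset.mem_filter.1 hy).2], ← Finset.sum_smul]
  -- Every flag that occurs is spanned by a reordering of one of the given bases, to which `key`
  -- applies.
  have h4 := key ((b a₀).reindex σ₀.symm)
  have h5 : (⇑((b a₀).reindex σ₀.symm)) = b a₀ ∘ σ₀ := by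
    rw [Module.Basis.coe_reindex]; rfl
  rw [h5] at h4
  rw [Finset.sum_filter, Fintype.sum_prod_type]
  simp only [Finset.mul_sum, mul_ite, mul_zero] at h4
  rw [h4, zero_smul]

/-! ### The map to the Steinberg module -/

lemma mem_cone_range_iff {r : Fin n → RatRay n} (h : Indep r) (v : Fin n → ℚ) :
    toReal v ∈ cone (Set.range r) ↔ ∀ i, 0 ≤ h.basis.repr v i := by
  constructor
  · intro hv i
    have := realFun_nonneg (φ := h.basis.coord i) (s := Set.range r) (by
      rintro _ ⟨j, rfl⟩
      rw [← h.basis_apply, Module.Basis.coord_apply, Module.Basis.repr_self, Finsupp.single_apply]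
      split_ifs <;> simp) hv
    rw [realFun_toReal] at this
    exact_mod_cast this
  · intro hv
    rw [← h.basis.sum_repr v, toReal_sum]
    refine Submodule.sum_mem _ fun i _ => ?_
    rw [toReal_smul, h.basis_apply]
    exact PointedCone.smul_mem _ (by exact_mod_cast hv i) (rayVec_mem_cone ⟨i, rfl⟩)

lemma exists_functional_eq_zero {u : Set (RatRay n)} (hu : u.Finite) (hcard : u.ncard < n) :
    ∃ φ : (Fin n → ℚ) →ₗ[ℚ] ℚ, φ ≠ 0 ∧ ∀ ρ ∈ u, φ ρ.someVector = 0 := by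
  classical
  have hlt : Submodule.span ℚ ((hu.toFinset.image Module.Ray.someVector : Finset (Fin n → ℚ)) :
      Set (Fin n → ℚ)) < ⊤ := by
    refine lt_top_iff_ne_top.2 fun htop => ?_
    have h1 := finrank_span_finset_le_card (R := ℚ) (hu.toFinset.image Module.Ray.someVector)
    rw [Set.finrank, htop, finrank_top, Module.finrank_fin_fun] at h1
    have h2 := h1.trans Finset.card_image_le
    rw [← Set.ncard_eq_toFinset_card u hu] at h2
    exact absurd hcard (not_lt.2 h2)
  obtain ⟨φ, hφ, hle⟩ := Submodule.exists_le_ker_of_lt_top _ hlt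
  refine ⟨φ, hφ, fun ρ hρ => hle (Submodule.subset_span ?_)⟩
  rw [Finset.coe_image]
  exact ⟨ρ, by simpa using hρ, rfl⟩

lemma ncard_le_of_indep {s : Set (RatRay n)} (hs : Indep (fun ρ : s => (ρ : RatRay n))) :
    s.ncard ≤ n := by
  have hfin := hs.finite
  have : Fintype s := hfin.fintype
  have hv : LinearIndependent ℚ (fun ρ : s => (ρ : RatRay n).someVector) := hs
  have h := hv.fintype_card_le_finrank
  rwa [Module.finrank_fin_fun, ← Nat.card_eq_fintype_card, Nat.card_coe_set_eq] at h

/-! ### Generic points of a subdivided simplex -/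

/-- A generic vector of the cone over a simplex lies in exactly one cone of a subdivision. -/
lemma Triangulation.IsSubdivision.existsUnique_mem {T T' : Triangulation n} (hT : T'.Refines T)
    {r : Fin n → RatRay n} (h : T.IsFace r) {m : ℕ} {t : Fin m → Fin n → RatRay n}
    (ht : T'.IsSubdivision r t) {v : Fin n → ℚ}
    (hv : ∀ u ∈ T'.faces, u.ncard < n → toReal v ∉ cone u) (hvr : toReal v ∈ cone (Set.range r)) :
    ∃! j, toReal v ∈ cone (Set.range (t j)) := by
  -- Refinement supplies a simplex of `T'` through `v` inside the cone; genericity forces it to have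
  -- `n` vertices.
  obtain ⟨U, hU, hUr⟩ := hT _ h.2
  have hvU : toReal v ∈ ⋃ u ∈ U, (cone u : Set (Fin n → ℝ)) := hUr ▸ hvr
  obtain ⟨u, hu, hvu⟩ := Set.mem_iUnion₂.1 hvU
  have hur : cone u ≤ cone (Set.range r) := by
    intro x hx
    have : x ∈ (cone (Set.range r) : Set (Fin n → ℝ)) := by
      rw [hUr]
      exact Set.mem_iUnion₂.2 ⟨u, hu, hx⟩
    exact this
  have hind := T'.indep u (hU hu)
  have hcard : u.ncard = n := le_antisymm (ncard_le_of_indep hind)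
    (not_lt.1 fun hlt => hv u (hU hu) hlt hvu)
  have : Fintype u := hind.finite.fintype
  have e : Fin n ≃ u := by
    refine (Fintype.equivFinOfCardEq ?_).symm
    rw [← Nat.card_eq_fintype_card, Nat.card_coe_set_eq, hcard]
  have hrange : Set.range (fun i => (e i : RatRay n)) = u := by
    ext ρ
    exact ⟨by rintro ⟨i, rfl⟩; exact (e i).2, fun h => ⟨e.symm ⟨ρ, h⟩, by simp⟩⟩
  obtain ⟨j, hj, hj'⟩ := ht.unique (fun i => (e i : RatRay n))
    ⟨Subtype.val_injective.comp e.injective, by rw [hrange]; exact hU hu⟩ (by rwa [hrange])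
  rw [hrange] at hj hj'
  refine ⟨j, by change _ ∈ cone (Set.range (t j)); rw [hj]; exact hvu, fun j' hvj' => hj' j' ?_⟩
  -- A second cone through `v` meets the first in the cone over their common vertices; by genericity
  -- there are `n` of them, so the two simplices coincide.
  have hF := (ht.isFace j').2
  have hinter : toReal v ∈ cone (Set.range (t j') ∩ u) := by
    rw [← T'.inter _ hF _ (hU hu)]
    exact ⟨hvj', hvu⟩
  have hge : n ≤ (Set.range (t j') ∩ u).ncard := not_lt.1 fun hlt =>
    hv _ (T'.down_closed _ hF _ Set.inter_subset_left) hlt hinter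
  have h1 : Set.range (t j') ∩ u = Set.range (t j') :=
    Set.eq_of_subset_of_ncard_le Set.inter_subset_left
      ((ncard_le_of_indep (T'.indep _ hF)).trans hge) (Set.finite_range _)
  have h2 : Set.range (t j') ∩ u = u :=
    Set.eq_of_subset_of_ncard_le Set.inter_subset_right (hcard.le.trans hge) hind.finite
  exact h1.symm.trans h2

lemma SameOrientation.sign_eq {r t : Fin n → RatRay n} (hr : Indep r) (ht : Indep t)
    (h : SameOrientation r t) (B : Module.Basis (Fin n) ℚ (Fin n → ℚ)) :
    SignType.sign (B.toMatrix ht.basis).det = SignType.sign (B.toMatrix hr.basis).det := by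
  obtain ⟨A, hA, hAt⟩ := h
  have hm : hr.basis.toMatrix ht.basis = A.transpose := by
    ext i j
    rw [Module.Basis.toMatrix_apply, ht.basis_apply, hAt, map_sum]
    simp only [map_smul, ← hr.basis_apply, Module.Basis.repr_self]
    simp [Finsupp.single_apply]
  rw [← Module.Basis.toMatrix_mul_toMatrix B hr.basis ht.basis, hm, Matrix.det_mul,
    Matrix.det_transpose, sign_mul, sign_pos hA, mul_one]

lemma mk_basis_eq_line {r : Fin n → RatRay n} (h : Indep r) (i : Fin n) :
    Projectivization.mk ℚ (h.basis i) (h.basis.ne_zero i) = line (r i) :=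
  (Projectivization.mk_eq_mk_iff' ℚ _ _ _ _).2 ⟨1, by rw [one_smul, h.basis_apply]⟩

/-- The Steinberg symbol is additive under subdivision. -/
lemma Triangulation.IsSubdivision.mk_monomial_line [NeZero n] {T T' : Triangulation n}
    (hT : T'.Refines T) {r : Fin n → RatRay n} (h : T.IsFace r) {m : ℕ}
    {t : Fin m → Fin n → RatRay n} (ht : T'.IsSubdivision r t) :
    OS.mk n (monomial fun i => line (r i)) =
      ∑ j, OS.mk n (monomial fun i => line (t j i)) := by
  classical
  have hr := h.indep
  have hti : ∀ j, Indep (t j) := fun j => (ht.isFace j).indep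
  -- The simplex itself has weight `1` and each piece weight `-1`. The excluded hyperplanes contain
  -- the simplices of `T'` with fewer than `n` vertices.
  let c : Option (Fin m) → ℤ := fun a => a.elim 1 fun _ => -1
  let b : Option (Fin m) → Module.Basis (Fin n) ℚ (Fin n → ℚ) :=
    fun a => a.elim hr.basis fun j => (hti j).basis
  choose! φ hφ hφu using fun (u : Set (RatRay n)) (hu : u.Finite ∧ u.ncard < n) =>
    exists_functional_eq_zero hu.1 hu.2
  have hfin : ∀ u ∈ T'.faces, u.Finite := fun u hu => (T'.indep u hu).finite
  have hsum := OS.sum_monomial_eq_zero c b hr.basis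
    ((T'.finite.toFinset.filter fun u => u.ncard < n).image φ)
    (by
      intro ψ hψ
      obtain ⟨u, hu, rfl⟩ := Finset.mem_image.1 hψ
      rw [Finset.mem_filter, Set.Finite.mem_toFinset] at hu
      exact hφ u ⟨hfin u hu.1, hu.2⟩)
    (by
      intro x hx
      have hgen : ∀ u ∈ T'.faces, u.ncard < n → toReal x ∉ cone u := by
        intro u hu hlt hxu
        refine hx _ (Finset.mem_image_of_mem φ
          (Finset.mem_filter.2 ⟨T'.finite.mem_toFinset.2 hu, hlt⟩)) ?_
        have h0 := hφu u ⟨hfin u hu, hlt⟩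
        have h1 := realFun_nonneg (fun ρ hρ => (h0 ρ hρ).ge) hxu
        have h2 := realFun_nonneg (φ := -φ u) (s := u)
          (fun ρ hρ => by simp [h0 ρ hρ]) hxu
        rw [realFun_toReal] at h1 h2
        have h1' : 0 ≤ φ u x := by exact_mod_cast h1
        have h2' : 0 ≤ (-φ u) x := by exact_mod_cast h2
        rw [LinearMap.neg_apply] at h2'
        linarith
      rw [Fintype.sum_option]
      have hs : ∀ j, SignType.sign (hr.basis.toMatrix (hti j).basis).det =
          SignType.sign (hr.basis.toMatrix hr.basis).det := fun j =>
        (ht.sameOrientation j).sign_eq hr (hti j) hr.basis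
      simp only [c, b, Option.elim_none, Option.elim_some, hs, ← mem_cone_range_iff]
      by_cases hxr : toReal x ∈ cone (Set.range r)
      · obtain ⟨j, hj, hj'⟩ := ht.existsUnique_mem hT h hgen hxr
        rw [Finset.sum_eq_single j]
        · rw [if_pos hxr, if_pos hj]; ring
        · intro j' _ hne
          rw [if_neg fun h => hne (hj' j' h), mul_zero, mul_zero]
        · simp
      · rw [if_neg hxr, mul_zero, mul_zero, zero_add]
        refine Finset.sum_eq_zero fun j _ => ?_
        rw [if_neg fun h => hxr (ht.le j h), mul_zero, mul_zero])
  rw [Fintype.sum_option] at hsum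
  simp only [c, b, Option.elim_none, Option.elim_some, mk_basis_eq_line, one_smul, neg_smul,
    Finset.sum_neg_distrib] at hsum
  rwa [← sub_eq_add_neg, sub_eq_zero] at hsum

/-! ### The map to the Steinberg module -/

lemma line_rayOfNeZero (ℓ : Line n) : line (rayOfNeZero ℚ ℓ.rep ℓ.rep_nonzero) = ℓ := by
  obtain ⟨d, hd, h⟩ := someVector_rayOfNeZero ℓ.rep ℓ.rep_nonzero
  conv_rhs => rw [← ℓ.mk_rep]
  exact (Projectivization.mk_eq_mk_iff' ℚ _ _ _ _).2 ⟨d, h.symm⟩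

lemma line_neg (ρ : RatRay n) : line (-ρ) = line ρ := by
  obtain ⟨d, hd, h⟩ := someVector_neg ρ
  exact (Projectivization.mk_eq_mk_iff' ℚ _ _ _ _).2 ⟨-d, by rw [h, neg_smul]⟩

lemma exteriorPower_le_closure {X : Type} (k : ℕ) :
    (⋀[ℤ]^k (X →₀ ℤ)).toAddSubgroup ≤
      AddSubgroup.closure {z : Symbols X | ∃ x : Fin k → X, z = monomial x} := by
  classical
  have hext : multilinearExtension (fun x : Fin k → X => monomial x) =
      (ExteriorAlgebra.ιMulti ℤ k).toMultilinearMap := by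
    refine Module.Basis.ext_multilinear (fun _ => Finsupp.basisSingleOne) fun x => ?_
    simp only [Finsupp.coe_basisSingleOne]
    exact multilinearExtension_single _ x
  intro z hz
  have hz' : z ∈ Submodule.span ℤ (Set.range (ExteriorAlgebra.ιMulti ℤ (M := X →₀ ℤ) k)) := by
    rw [ExteriorAlgebra.ιMulti_span_fixedDegree]; exact hz
  clear hz
  induction hz' using Submodule.span_induction with
  | mem w hw =>
    obtain ⟨v, rfl⟩ := hw
    have h := multilinearExtension_apply (fun x : Fin k → X => monomial x) v
      (Finset.univ.biUnion fun i => (v i).support)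
      fun i => Finset.subset_biUnion_of_mem (fun i => (v i).support) (Finset.mem_univ i)
    rw [hext] at h
    change ExteriorAlgebra.ιMulti ℤ k v = _ at h
    rw [h]
    refine sum_mem fun x _ => zsmul_mem ?_ _
    exact AddSubgroup.subset_closure ⟨x, rfl⟩
  | zero => exact zero_mem _
  | add x y _ _ hx hy => exact add_mem hx hy
  | smul a x _ hx => exact zsmul_mem hx a

/-- The map to the Steinberg module on the chains of a triangulation. -/
def Triangulation.chainsToSt (T : Triangulation n) : T.chains n →+ St n :=
  (((OS.mk n).comp (symbolsMap line).toRingHom).toAddMonoidHom.comp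
    (T.chains n).subtype).codRestrict _ <| by
    rintro ⟨x, hx⟩
    refine ⟨symbolsMap line x, ?_, rfl⟩
    induction hx using AddSubgroup.closure_induction with
    | mem x hx =>
      obtain ⟨r, hr, rfl⟩ := hx
      rw [symbolsMap_monomial]
      exact monomial_mem _
    | zero => rw [map_zero]; exact zero_mem _
    | add x y _ _ hx hy => rw [map_add]; exact add_mem hx hy
    | neg x _ hx => rw [map_neg]; exact neg_mem hx

lemma Triangulation.chainsToSt_simplex (T : Triangulation n) (r : Fin n → RatRay n)
    (h : T.IsFace r) : T.chainsToSt (T.simplex r h) = St.wedge fun i => line (r i) :=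
  Subtype.ext (congrArg (OS.mk n) (symbolsMap_monomial line r))

lemma closure_Δ : AddSubgroup.closure {x : TopChains n | ∃ r, Indep r ∧ x = Δ r} = ⊤ := by
  classical
  refine (AddSubgroup.eq_top_iff' _).2 fun x => ?_
  obtain ⟨y, rfl⟩ := QuotientAddGroup.mk'_surjective (topHomology n) x
  obtain ⟨z, rfl⟩ := QuotientAddGroup.mk'_surjective (refinementRelations n n) y
  induction z using DirectSum.induction_on with
  | zero => rw [map_zero, map_zero]; exact zero_mem _
  | add x y hx hy => rw [map_add, map_add]; exact add_mem hx hy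
  | of T x =>
    change QuotientAddGroup.mk' (topHomology n) (T.toPreChains n x) ∈ _
    obtain ⟨x, hx⟩ := x
    induction hx using AddSubgroup.closure_induction with
    | mem x hx =>
      obtain ⟨r, hr, rfl⟩ := hx
      exact AddSubgroup.subset_closure ⟨r, hr.indep, T.simplexClass_eq_Δ hr⟩
    | zero =>
      change QuotientAddGroup.mk' (topHomology n) (T.toPreChains n 0) ∈ _
      rw [map_zero, map_zero]; exact zero_mem _
    | add x y hxT hyT hx hy =>
      change QuotientAddGroup.mk' (topHomology n) (T.toPreChains n (⟨x, hxT⟩ + ⟨y, hyT⟩)) ∈ _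
      rw [map_add, map_add]; exact add_mem hx hy
    | neg x hxT hx =>
      change QuotientAddGroup.mk' (topHomology n) (T.toPreChains n (-⟨x, hxT⟩)) ∈ _
      rw [map_neg, map_neg]; exact neg_mem hx

lemma topChains_hom_ext {A : Type*} [AddGroup A] {f g : TopChains n →+ A}
    (h : ∀ r, Indep r → f (Δ r) = g (Δ r)) : f = g := by
  refine AddMonoidHom.ext fun x => ?_
  have hx : x ∈ AddSubgroup.closure {x : TopChains n | ∃ r, Indep r ∧ x = Δ r} := by
    rw [closure_Δ]; trivial
  induction hx using AddSubgroup.closure_induction with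
  | mem x hx => obtain ⟨r, hr, rfl⟩ := hx; exact h r hr
  | zero => rw [map_zero, map_zero]
  | add x y _ _ hx hy => rw [map_add, map_add, hx, hy]
  | neg x _ hx => rw [map_neg, map_neg, hx]

lemma act_Δ (γ : GLQ n) {r : Fin n → RatRay n} (h : Indep r) :
    TopChains.act γ (Δ r) = Δ fun i => rayAct γ (r i) := by
  have hF := orthants_isFace r h
  rw [← (orthants r h).simplexClass_eq_Δ hF,
    ← ((orthants r h).act γ).simplexClass_eq_Δ (Triangulation.act_isFace γ hF)]
  change QuotientAddGroup.mk' (topHomology n) (preChainsAct γ n _) = _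
  rw [preChainsAct_toPreChains, Triangulation.chainsAct_simplex]
  rfl

lemma act_wedge (γ : GLQ n) (ℓ : Fin n → Line n) :
    St.act γ (St.wedge ℓ) = St.wedge fun i => lineAct γ (ℓ i) :=
  Subtype.ext (congrArg (OS.mk n) (symbolsMap_monomial (lineAct γ) ℓ))

/-! ### The homomorphism `topChainsToSt` and its kernel -/

section Steinberg

variable [NeZero n]

/-- A cycle is the boundary of its join with any ray `ρ`, and boundaries of monomials in `n + 1`
lines of `ℚ^n` lie in the Orlik-Solomon ideal. -/
lemma Triangulation.chainsToSt_eq_zero (T : Triangulation n) {x : T.chains n}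
    (hx : x ∈ T.cycles n) : T.chainsToSt x = 0 := by
  obtain ⟨x, hxT⟩ := x
  have hx0 : boundary _ x = 0 := hx
  have h1 : (1 : Fin n → ℚ) ≠ 0 := one_ne_zero
  let ρ : RatRay n := rayOfNeZero ℚ 1 h1
  have hbd : x = boundary _ (symbol ρ * x) := by
    rw [boundary_symbol_mul, hx0, mul_zero, sub_zero]
  refine Subtype.ext ?_
  change OS.mk n (symbolsMap line x) = 0
  rw [hbd]
  -- What remains holds for every chain, not only for cycles, so induction over the generators
  -- applies.
  clear hbd hx0 hx
  induction hxT using AddSubgroup.closure_induction with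
  | mem x hx =>
    obtain ⟨r, hr, rfl⟩ := hx
    rw [← monomial_cons, ← boundary_symbolsMap, symbolsMap_monomial]
    refine OS.mk_boundary_monomial fun hli => ?_
    have := hli.fintype_card_le_finrank
    simp at this
  | zero => simp
  | add x y _ _ hx hy => rw [mul_add, map_add, map_add, map_add, hx, hy, add_zero]
  | neg x _ hx => rw [mul_neg, map_neg, map_neg, map_neg, hx, neg_zero]

open Classical in
/-- The map to the Steinberg module on the colimit of the chains of all triangulations. -/
def preChainsToSt (n : ℕ) [NeZero n] : PreChains n n →+ St n :=
  QuotientAddGroup.lift (refinementRelations n n)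
    (DirectSum.toAddMonoid fun T : Triangulation n => T.chainsToSt) <| by
    refine (AddSubgroup.closure_le _).2 ?_
    rintro _ ⟨T, T', hT, r, h, m, t, ht, rfl⟩
    change DirectSum.toAddMonoid _ _ = 0
    rw [map_sub, map_sum, sub_eq_zero]
    simp only [DirectSum.toAddMonoid_of, Triangulation.chainsToSt_simplex]
    refine Subtype.ext ?_
    rw [AddSubgroup.val_finsetSum]
    exact ht.mk_monomial_line hT h

lemma preChainsToSt_toPreChains (T : Triangulation n) (x : T.chains n) :
    preChainsToSt n (T.toPreChains n x) = T.chainsToSt x := by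
  classical
  exact DirectSum.toAddMonoid_of _ _ _

/-- The map from top spherical chains to the Steinberg module. -/
def topChainsToSt (n : ℕ) [NeZero n] : TopChains n →+ St n :=
  QuotientAddGroup.lift (topHomology n) (preChainsToSt n) <| by
    refine iSup_le fun T => ?_
    rintro _ ⟨x, hx, rfl⟩
    change preChainsToSt n _ = 0
    rw [preChainsToSt_toPreChains, T.chainsToSt_eq_zero hx]

lemma topChainsToSt_Δ {r : Fin n → RatRay n} (h : Indep r) :
    topChainsToSt n (Δ r) = St.wedge fun i => line (r i) := by
  rw [← (orthants r h).simplexClass_eq_Δ (orthants_isFace r h),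
    ← (orthants r h).chainsToSt_simplex r (orthants_isFace r h), ← preChainsToSt_toPreChains]
  rfl

lemma topChainsToSt_act (γ : GLQ n) (x : TopChains n) :
    topChainsToSt n (TopChains.act γ x) = St.act γ (topChainsToSt n x) := by
  have h : (topChainsToSt n).comp (TopChains.act γ) = (St.act γ).comp (topChainsToSt n) := by
    refine topChains_hom_ext fun r hr => ?_
    rw [AddMonoidHom.comp_apply, AddMonoidHom.comp_apply, act_Δ γ hr,
      topChainsToSt_Δ (indep_rayAct γ hr), topChainsToSt_Δ hr, act_wedge]
    simp only [line_rayAct]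
  exact DFunLike.congr_fun h x

lemma topChainsToSt_surjective : Function.Surjective (topChainsToSt n) := by
  rw [← AddMonoidHom.range_eq_top, AddSubgroup.eq_top_iff']
  rintro ⟨_, z, hz, rfl⟩
  have hmono : ∀ ℓ : Fin n → Line n, St.wedge ℓ ∈ (topChainsToSt n).range := by
    intro ℓ
    by_cases hℓ : LinearIndependent ℚ fun i => (ℓ i).rep
    · have hI : Indep fun i => rayOfNeZero ℚ (ℓ i).rep (ℓ i).rep_nonzero :=
        Indep.of_smul hℓ fun i => by
          obtain ⟨d, hd, h⟩ := someVector_rayOfNeZero (ℓ i).rep (ℓ i).rep_nonzero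
          exact ⟨d, hd.ne', h⟩
      refine ⟨Δ _, (topChainsToSt_Δ hI).trans ?_⟩
      simp only [line_rayOfNeZero]
    · have : St.wedge ℓ = 0 := Subtype.ext (OS.mk_monomial_of_not hℓ)
      rw [this]
      exact zero_mem _
  have hcl := exteriorPower_le_closure n hz
  have key : ∀ w : OS n, (∃ y ∈ AddSubgroup.closure
      {z : Symbols (Line n) | ∃ x : Fin n → Line n, z = monomial x}, OS.mk n y = w) →
      ∃ x, (topChainsToSt n x : OS n) = w := by
    rintro _ ⟨y, hy, rfl⟩
    induction hy using AddSubgroup.closure_induction with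
    | mem y hy =>
      obtain ⟨ℓ, rfl⟩ := hy
      obtain ⟨x, hx⟩ := hmono ℓ
      exact ⟨x, by rw [hx]; rfl⟩
    | zero => exact ⟨0, by simp⟩
    | add y y' _ _ h h' =>
      obtain ⟨x, hx⟩ := h
      obtain ⟨x', hx'⟩ := h'
      exact ⟨x + x', by rw [map_add, map_add, AddSubgroup.coe_add, hx, hx']⟩
    | neg y _ h =>
      obtain ⟨x, hx⟩ := h
      exact ⟨-x, by rw [map_neg, map_neg, AddSubgroup.coe_neg, hx]⟩
  obtain ⟨x, hx⟩ := key _ ⟨z, hcl, rfl⟩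
  exact ⟨x, Subtype.ext hx⟩

lemma wedges_le_ker : wedges n ≤ (topChainsToSt n).ker := by
  refine (AddSubgroup.closure_le _).2 ?_
  rintro _ ⟨r, hr, rfl⟩
  change topChainsToSt n _ = 0
  have hr' : Indep (Function.update r 0 (-r 0)) := hr.of_eq_or_eq_neg fun k => by
    by_cases hk : k = 0
    · subst hk; right; rw [Function.update_self]
    · left; rw [Function.update_of_ne hk]
  rw [map_sub, topChainsToSt_Δ hr, topChainsToSt_Δ hr', sub_eq_zero]
  congr 1
  funext k
  by_cases hk : k = 0
  · subst hk; rw [Function.update_self, line_neg]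
  · rw [Function.update_of_ne hk]

/-- One symbol represents `x` both in the Steinberg module and modulo wedges. The kernel then
follows from the vanishing of `symbolsToChains` on the ideal, without constructing an inverse map on
`St n`. -/
lemma exists_symbol (x : TopChains n) : ∃ y : Symbols (Line n),
    (topChainsToSt n x : OS n) = OS.mk n y ∧ symbolsToChains n y = WedgeQuotient.mk n x := by
  have hx : x ∈ AddSubgroup.closure {x : TopChains n | ∃ r, Indep r ∧ x = Δ r} := by
    rw [closure_Δ]; trivial
  induction hx using AddSubgroup.closure_induction with
  | mem x hx =>
    obtain ⟨r, hr, rfl⟩ := hx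
    exact ⟨monomial fun i => line (r i), by rw [topChainsToSt_Δ hr]; rfl,
      symbolsToChains_monomial_line hr⟩
  | zero => exact ⟨0, by simp, by simp⟩
  | add x x' _ _ h h' =>
    obtain ⟨y, h1, h2⟩ := h
    obtain ⟨y', h1', h2'⟩ := h'
    exact ⟨y + y', by rw [map_add, map_add, AddSubgroup.coe_add, h1, h1'],
      by rw [map_add, map_add, h2, h2']⟩
  | neg x _ h =>
    obtain ⟨y, h1, h2⟩ := h
    exact ⟨-y, by rw [map_neg, map_neg, AddSubgroup.coe_neg, h1], by rw [map_neg, map_neg, h2]⟩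

lemma ker_topChainsToSt : (topChainsToSt n).ker = wedges n := by
  refine le_antisymm (fun x hx => ?_) wedges_le_ker
  obtain ⟨y, h1, h2⟩ := exists_symbol x
  have hx0 : topChainsToSt n x = 0 := hx
  rw [hx0] at h1
  rw [← WedgeQuotient.mk_eq_zero, ← h2]
  exact symbolsToChains_of_mem_osIdeal (OS.mk_eq_zero.1 h1.symm)

end Steinberg

end SphericalChains

end

theorem mainTheorem10 (n : ℕ) [NeZero n] :
    (∀ r : Fin n → SphericalChains.RatRay n, SphericalChains.Indep r →
      (∃ T : SphericalChains.Triangulation n, T.IsFace r) ∧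
        ∀ (T : SphericalChains.Triangulation n) (h : T.IsFace r),
          T.simplexClass r h = SphericalChains.Δ r) ∧
    ∃ R : SphericalChains.TopChains n →+ SphericalChains.St n,
      (∀ r : Fin n → SphericalChains.RatRay n, SphericalChains.Indep r →
        R (SphericalChains.Δ r) =
          SphericalChains.St.wedge (fun i => SphericalChains.line (r i))) ∧
      (∀ R' : SphericalChains.TopChains n →+ SphericalChains.St n,
        (∀ r : Fin n → SphericalChains.RatRay n, SphericalChains.Indep r →
          R' (SphericalChains.Δ r) =
            SphericalChains.St.wedge (fun i => SphericalChains.line (r i))) → R' = R) ∧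
      Function.Surjective R ∧
      (∀ (γ : SphericalChains.GLQ n) (x : SphericalChains.TopChains n),
        R (SphericalChains.TopChains.act γ x) = SphericalChains.St.act γ (R x)) ∧
      R.ker = AddSubgroup.closure
        {x | ∃ r : Fin n → SphericalChains.RatRay n, SphericalChains.Indep r ∧
          x = SphericalChains.Δ r - SphericalChains.Δ (Function.update r 0 (-r 0))} := by
  refine ⟨fun r hr => ⟨⟨SphericalChains.orthants r hr, SphericalChains.orthants_isFace r hr⟩,
      fun T h => T.simplexClass_eq_Δ h⟩,
    SphericalChains.topChainsToSt n, fun r hr => SphericalChains.topChainsToSt_Δ hr,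
    fun R' hR' => SphericalChains.topChains_hom_ext fun r hr =>
      (hR' r hr).trans (SphericalChains.topChainsToSt_Δ hr).symm,
    SphericalChains.topChainsToSt_surjective, SphericalChains.topChainsToSt_act,
    SphericalChains.ker_topChainsToSt⟩
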